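/- Let $M>0$ and $a,Q\in\mathbb{R}$ with $a^2+Q^2<M^2$, and put $R_+=\tfrac12\sqrt{M^2-(a^2+Q^2)}>0$, $r=R+M+\frac{M^2-a^2-Q^2}{4R}$, $\Delta=r^2-2Mr+a^2+Q^2$, $\Sigma=r^2+a^2\cos^2\theta$. On $M_b=\{(R,\theta): R>R_+,\ 0<\theta<\pi\}$, with the flat metric $h=dR^2+R^2d\theta^2$ (so that $\sqrt h\,h^{ab}u_av_b=R\,u_Rv_R+\tfrac1R u_\theta v_\theta$), let $\gamma,\lambda,\eta,\omega$ be the Kerr-Newman wave map fields $$e^{2\gamma}=\frac{\sin^2\theta}{\Sigma}\left[(r^2+a^2)^2-a^2\Delta\sin^2\theta\right],\qquad \lambda=\frac{2Qra\sin^2\theta}{\Sigma},\qquad \eta=\frac{-4Q(a^2+r^2)\cos\theta}{a^2+2r^2+a^2\cos2\theta},$$ $$\omega=aM\cos\theta\,(5-\cos2\theta)+\frac{4a^3\cos\theta\sin^4\theta\left[a^2M+2r(Q^2+Mr)+a^2M\cos2\theta\right]}{(a^2+2r^2+a^2\cos2\theta)^2}.$$ Call $\{\gamma',\omega',\eta',\lambda'\}$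 regular data if (i) each of the four, as a function of the spherical coordinates $(R,\theta)$, is an axisymmetric scalar on $\{x\in\mathbb{R}^3:|x|\ge R_+\}$ that is smooth up to and including the horizon $|x|=R_+$ and is $O(1/R)$ as $R\to\infty$, with first and second (Cartesian) derivatives $O(1/R^2)$ and $O(1/R^3)$; (ii) $\omega',\eta',\lambda'$ vanish on the axes $\theta=0,\pi$; (iii) $\gamma'_{,R}=0$ at the two points $R=R_+$, $\theta=0,\pi$. Theorem. For every choice of regular data the linearized Hamiltonian constraint, a flat Poisson equation for $\nu'$, $$\sqrt h\,h^{ab}\Big[4\gamma_{,a}\gamma'_{,b}-e^{-2\gamma}\gamma'(\eta_{,a}\eta_{,b}+\lambda_{,a}\lambda_{,b})+e^{-2\gamma}(\eta_{,a}\eta'_{,b}+\lambda_{,a}\lambda'_{,b})-2e^{-4\gamma}\gamma'(\omega_{,a}+\lambda\eta_{,a})(\omega_{,b}+\lambda\eta_{,b})$$ $$\qquad+e^{-4\gamma}(\omega_{,a}+\lambda\eta_{,a})(\omega'_{,b}+\lambda\eta'_{,b}+\lambda'\eta_{,b})\Big]+2\,\partial_a\big(\sqrt h\,h^{ab}\nu'_{,b}\big)=0\quad\text{on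 }M_b,$$ has a unique classical solution $\nu'$ (continuous on $\{R\ge R_+,\ 0\le\theta\le\pi\}$ and $C^2$ on $M_b$) that tends to $0$ as $R\to\infty$ uniformly in $\theta$ and satisfies the mixed boundary conditions $\nu'=2\gamma'$ on the axes ($\theta=0,\pi$, $R\ge R_+$) and $\nu'_{,R}=0$ on the horizon ($R=R_+$, $0\le\theta\le\pi$, as a one-sided derivative). Moreover this $\nu'$ is $C^1$ up to the boundary of $M_b$. -/

import Mathlib

namespace KerrNewman

noncomputable section

/-! Polar Weyl-Papapetrou coordinates `(R, θ)`, `R > R₊`, `0 < θ < π`, on the quotient of a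
constant-time slice of the domain of outer communications by the axial rotations. A scalar on the
quotient is a function `f : ℝ → ℝ → ℝ`, evaluated as `f R θ`. -/

/-- The coordinate radius `R₊ = √(M² - (a² + Q²)) / 2` of the horizon. -/
def Rplus (M a Q : ℝ) : ℝ := Real.sqrt (M ^ 2 - (a ^ 2 + Q ^ 2)) / 2

/-- The Boyer-Lindquist radius `r` as a function of `R`. -/
def rBL (M a Q R : ℝ) : ℝ := R + M + (M ^ 2 - a ^ 2 - Q ^ 2) / (4 * R)

/-- `Δ = r² - 2 M r + a² + Q²`. -/
def Delta (M a Q R : ℝ) : ℝ :=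
  rBL M a Q R ^ 2 - 2 * M * rBL M a Q R + a ^ 2 + Q ^ 2

/-- `Σ = r² + a² cos² θ`. -/
def Sigma (M a Q R θ : ℝ) : ℝ := rBL M a Q R ^ 2 + a ^ 2 * Real.cos θ ^ 2

/-- The squared norm `e^{2γ}` of the axial Killing field. -/
def axialNormSq (M a Q R θ : ℝ) : ℝ :=
  Real.sin θ ^ 2 / Sigma M a Q R θ *
    ((rBL M a Q R ^ 2 + a ^ 2) ^ 2 - a ^ 2 * Delta M a Q R * Real.sin θ ^ 2)

/-- Background field `γ`. -/
def bgGamma (M a Q R θ : ℝ) : ℝ := Real.log (axialNormSq M a Q R θ) / 2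

/-- Background field `λ` (the axial component of the vector potential). -/
def bgLambda (M a Q R θ : ℝ) : ℝ :=
  2 * Q * rBL M a Q R * a * Real.sin θ ^ 2 / Sigma M a Q R θ

/-- Background field `η` (the electric twist potential). -/
def bgEta (M a Q R θ : ℝ) : ℝ :=
  -4 * Q * (a ^ 2 + rBL M a Q R ^ 2) * Real.cos θ /
    (a ^ 2 + 2 * rBL M a Q R ^ 2 + a ^ 2 * Real.cos (2 * θ))

/-- Background field `ω` (the gravitational twist potential). -/
def bgOmega (M a Q R θ : ℝ) : ℝ :=
  a * M * Real.cos θ * (5 - Real.cos (2 * θ)) +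
    4 * a ^ 3 * Real.cos θ * Real.sin θ ^ 4 *
        (a ^ 2 * M + 2 * rBL M a Q R * (Q ^ 2 + M * rBL M a Q R) +
          a ^ 2 * M * Real.cos (2 * θ)) /
      (a ^ 2 + 2 * rBL M a Q R ^ 2 + a ^ 2 * Real.cos (2 * θ)) ^ 2

/-- `∂f/∂R`. -/
def dR (f : ℝ → ℝ → ℝ) (R θ : ℝ) : ℝ := deriv (fun s => f s θ) R

/-- `∂f/∂θ`. -/
def dTheta (f : ℝ → ℝ → ℝ) (R θ : ℝ) : ℝ := deriv (fun t => f R t) θ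

/-- The differential of `f`, as the pair of its components `(f_{,R}, f_{,θ})`. -/
def grad (f : ℝ → ℝ → ℝ) (R θ : ℝ) : ℝ × ℝ := (dR f R θ, dTheta f R θ)

/-- `√h h^{ab} u_a v_b` for the flat metric `h = dR² + R² dθ²`. -/
def hPair (R : ℝ) (u v : ℝ × ℝ) : ℝ := R * (u.1 * v.1) + 1 / R * (u.2 * v.2)

/-- `∂_a (√h h^{ab} f_{,b})`, i.e. `R` times the flat Laplacian of `f`. -/
def hLaplace (f : ℝ → ℝ → ℝ) (R θ : ℝ) : ℝ :=
  dR (fun s t => s * dR f s t) R θ + dTheta (fun s t => 1 / s * dTheta f s t) R θ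

/-- The first variation of the Hamiltonian constraint about the Kerr-Newman background with
parameters `M, a, Q`, for the perturbations `γ', ω', η', λ'` (here `l`) and `ν'` (here `n`). -/
def linHamiltonian (M a Q : ℝ) (g w e l n : ℝ → ℝ → ℝ) (R θ : ℝ) : ℝ :=
  let G := grad (bgGamma M a Q) R θ
  let E := grad (bgEta M a Q) R θ
  let L := grad (bgLambda M a Q) R θ
  let lam := bgLambda M a Q R θ
  let T := grad (bgOmega M a Q) R θ + lam • E
  let e2 := Real.exp (-2 * bgGamma M a Q R θ)
  let e4 := Real.exp (-4 * bgGamma M a Q R θ)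
  4 * hPair R G (grad g R θ)
    - e2 * g R θ * (hPair R E E + hPair R L L)
    + e2 * (hPair R E (grad e R θ) + hPair R L (grad l R θ))
    - 2 * e4 * g R θ * hPair R T T
    + e4 * hPair R T (grad w R θ + lam • grad e R θ + l R θ • E)
    + 2 * hLaplace n R θ

/-- The point of Euclidean 3-space with spherical coordinates `(R, θ, φ)`. -/
def spherical (R θ φ : ℝ) : EuclideanSpace ℝ (Fin 3) :=
  !₂[R * Real.sin θ * Real.cos φ, R * Real.sin θ * Real.sin φ, R * Real.cos θ]

/-- `f` is a regular axisymmetric scalar outside the horizon `R = Rp`: it lifts to a function on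
the 3-dimensional slice that is smooth up to and including the horizon, and that is `O(1/R)` at
infinity, its first and second derivatives being `O(1/R²)` and `O(1/R³)`. -/
def IsRegularScalar (Rp : ℝ) (f : ℝ → ℝ → ℝ) : Prop :=
  ∃ F : EuclideanSpace ℝ (Fin 3) → ℝ,
    (∀ R θ φ : ℝ, Rp ≤ R → θ ∈ Set.Icc 0 Real.pi → F (spherical R θ φ) = f R θ) ∧
    ContDiffOn ℝ ((⊤ : ℕ∞) : WithTop ℕ∞) F {x | Rp ≤ ‖x‖} ∧
    ∃ C : ℝ, ∀ k : ℕ, k ≤ 2 → ∀ x : EuclideanSpace ℝ (Fin 3), Rp < ‖x‖ →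
      ‖iteratedFDeriv ℝ k F x‖ ≤ C / ‖x‖ ^ (k + 1)

/-- `f` vanishes on both axes of symmetry. -/
def VanishesOnAxes (Rp : ℝ) (f : ℝ → ℝ → ℝ) : Prop :=
  ∀ R : ℝ, Rp ≤ R → f R 0 = 0 ∧ f R Real.pi = 0

/-- Regular data `γ', ω', η', λ'`. -/
structure IsRegularData (Rp : ℝ) (g w e l : ℝ → ℝ → ℝ) : Prop where
  regular_gamma : IsRegularScalar Rp g
  regular_omega : IsRegularScalar Rp w
  regular_eta : IsRegularScalar Rp e
  regular_lambda : IsRegularScalar Rp l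
  omega_axes : VanishesOnAxes Rp w
  eta_axes : VanishesOnAxes Rp e
  lambda_axes : VanishesOnAxes Rp l
  /-- `∂γ'/∂R = 0` at the two points where the horizon meets the axes. -/
  gamma_poles : ∀ θ ∈ ({0, Real.pi} : Set ℝ),
    HasDerivWithinAt (fun R => g R θ) 0 (Set.Ici Rp) Rp

/-- `n` is a classical solution `ν'` of the linearized Hamiltonian constraint that vanishes at
infinity and satisfies the mixed boundary conditions. -/
structure IsMixedSolution (M a Q : ℝ) (g w e l n : ℝ → ℝ → ℝ) : Prop where
  continuousOn : ContinuousOn (fun p : ℝ × ℝ => n p.1 p.2)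
    (Set.Ici (Rplus M a Q) ×ˢ Set.Icc 0 Real.pi)
  contDiffOn : ContDiffOn ℝ 2 (fun p : ℝ × ℝ => n p.1 p.2)
    (Set.Ioi (Rplus M a Q) ×ˢ Set.Ioo 0 Real.pi)
  /-- the constraint holds in the interior -/
  constraint : ∀ R θ : ℝ, Rplus M a Q < R → θ ∈ Set.Ioo 0 Real.pi →
    linHamiltonian M a Q g w e l n R θ = 0
  /-- `ν' → 0` as `R → ∞`, uniformly in `θ` -/
  vanishes : Filter.Tendsto (fun p : ℝ × ℝ => n p.1 p.2)
    (Filter.atTop ×ˢ Filter.principal (Set.Icc 0 Real.pi)) (nhds 0)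
  /-- `ν' = 2γ'` on the axes -/
  dirichlet : ∀ R : ℝ, Rplus M a Q ≤ R →
    n R 0 = 2 * g R 0 ∧ n R Real.pi = 2 * g R Real.pi
  /-- `∂ν'/∂R = 0` on the horizon -/
  neumann : ∀ θ ∈ Set.Icc 0 Real.pi,
    HasDerivWithinAt (fun R => n R θ) 0 (Set.Ici (Rplus M a Q)) (Rplus M a Q)

end

end KerrNewman

open Set Filter Topology MeasureTheory
open scoped ContDiff

namespace KerrNewman

/-! ### One-dimensional calculus -/

/-! Put `u = log (R / R₊)`. The exterior becomes the half-strip `u ≥ 0`, `0 ≤ θ ≤ π`, the horizon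
becomes `u = 0`, and by conformal invariance in two dimensions `R` times `hLaplace` becomes `∂_u² +
∂_θ²`. The constraint multiplied by `R` is therefore a Poisson equation `S + 2 (ν'_uu + ν'_θθ) = 0`
in a flat half-strip.

The source `S` is smooth up to the boundary and `O(exp (-u))`, although `exp (-2γ)` and `γ_{,θ}`
blow up on the axes. Every singular factor is paired with enough powers of `sin θ`: the background
derivatives carry explicit ones (`background_coefficients`), and the `θ`-derivative of a smooth
axisymmetric function is `sin θ` times a smooth function (`exists_strip_representation`).
`exists_strip_source` does the bookkeeping.

The boundary data are removed by writing `ν' = 2 γ' - 2 χ(u) γ'_u(0, θ) + v`, where `χ(0) = 0` and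
`χ'(0) = 1`. The middle term cancels the normal derivative at the horizon. It vanishes on the axes
because `γ'_{,R} = 0` at the poles, which is the compatibility of the two boundary conditions at the
corners. So `v` solves a homogeneous mixed problem with a smooth decaying source `H`.

For `v`, extend `H` evenly across `u = 0` and expand in sines: `v = ∑ m_k(u) sin (k θ)` with `m_k''
= k² m_k + h_k`. The decaying solution for an even source is even, which gives the Neumann
condition; the sines give the Dirichlet condition. The reflection also removes the corners, so `v`
is `C¹` on the whole plane. Since `H` need not vanish on the axes, `h_k` is only `O(1/k)`. The
resulting `m_k = O(k⁻³)`, `m_k' = O(k⁻²)` suffice for `C¹` but not for `C²`; in the interior the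
slowly decaying part is summed in closed form as a cubic in `θ` (`modeSeries_interior`).

Uniqueness is a maximum principle with an explicit barrier that handles the horizon without Hopf's
lemma (`mixed_problem_nonpos`). -/

theorem secondDeriv_nonpos_of_isLocalMax {f f1 : ℝ → ℝ} {f2 x : ℝ}
    (hf : ∀ᶠ y in 𝓝 x, HasDerivAt f (f1 y) y) (hf1 : HasDerivAt f1 f2 x)
    (hmax : IsLocalMax f x) : f2 ≤ 0 := by
  by_contra! hpos
  have hd : deriv f =ᶠ[𝓝 x] f1 := hf.mono fun y hy => hy.deriv
  have h2 : deriv (deriv f) x = f2 := by rw [hd.deriv_eq, hf1.deriv]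
  have hmin : IsLocalMin f x :=
    isLocalMin_of_deriv_deriv_pos (by rw [h2]; exact hpos) hmax.deriv_eq_zero
      hf.self_of_nhds.continuousAt
  -- Being both a local maximum and a local minimum forces `f` to be locally constant, contradicting
  -- `f2 > 0`.
  have hconst : f =ᶠ[𝓝 x] fun _ => f x := by
    filter_upwards [hmin, hmax] with y h1 h2 using le_antisymm h2 h1
  have h3 : deriv (deriv f) x = 0 := by
    have : deriv f =ᶠ[𝓝 x] fun _ => 0 := by
      filter_upwards [hconst.eventuallyEq_nhds] with y hy
      rw [hy.deriv_eq]; simp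
    rw [this.deriv_eq]; simp
  linarith

theorem le_of_second_order_subsolution {f f1 f2 : ℝ → ℝ} {α β k : ℝ} (hk : 0 < k)
    (hc : ContinuousOn f (Icc α β))
    (hf : ∀ x ∈ Ioo α β, HasDerivAt f (f1 x) x) (hf1 : ∀ x ∈ Ioo α β, HasDerivAt f1 (f2 x) x)
    (hsub : ∀ x ∈ Ioo α β, k ^ 2 * f x ≤ f2 x) (hα : f α ≤ 0) (hβ : f β ≤ 0)
    {x : ℝ} (hx : x ∈ Icc α β) : f x ≤ 0 := by
  obtain ⟨y, hy, hmax⟩ := isCompact_Icc.exists_isMaxOn ⟨x, hx⟩ hc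
  refine (hmax hx).trans ?_
  by_contra! hpos
  have hyα : y ≠ α := by rintro rfl; linarith
  have hyβ : y ≠ β := by rintro rfl; linarith
  have hyo : y ∈ Ioo α β := ⟨lt_of_le_of_ne hy.1 hyα.symm, lt_of_le_of_ne hy.2 hyβ⟩
  have hn : Ioo α β ∈ 𝓝 y := isOpen_Ioo.mem_nhds hyo
  have h1 := secondDeriv_nonpos_of_isLocalMax (Filter.eventually_of_mem hn hf) (hf1 y hyo)
    (hmax.isLocalMax (mem_of_superset hn Ioo_subset_Icc_self))
  have h2 := hsub y hyo
  have : 0 < k ^ 2 * f y := by positivity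
  linarith

/-- Comparison with the right-hand side `b`: it satisfies `b'' - k² b = -B`, since the exponentials
are annihilated, and `b ≥ A` at both ends. Crude endpoint bounds thus enter only through terms
exponentially small in `k` times the distance to the endpoints. -/
theorem abs_le_of_second_order {f f1 f2 : ℝ → ℝ} {α β k A B : ℝ} (hk : 0 < k)
    (hA : 0 ≤ A) (hB : 0 ≤ B) (hc : ContinuousOn f (Icc α β))
    (hf : ∀ x ∈ Ioo α β, HasDerivAt f (f1 x) x) (hf1 : ∀ x ∈ Ioo α β, HasDerivAt f1 (f2 x) x)
    (hres : ∀ x ∈ Ioo α β, |f2 x - k ^ 2 * f x| ≤ B) (hα : |f α| ≤ A) (hβ : |f β| ≤ A)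
    {x : ℝ} (hx : x ∈ Icc α β) :
    |f x| ≤ B / k ^ 2 + A * (Real.exp (-(k * (x - α))) + Real.exp (-(k * (β - x)))) := by
  -- The sign `σ` treats `f` and `-f` together.
  have key : ∀ σ : ℝ, σ = 1 ∨ σ = -1 →
      σ * f x - (B / k ^ 2 +
        A * (Real.exp (-(k * (x - α))) + Real.exp (-(k * (β - x))))) ≤ 0 := by
    intro σ hσ
    have hσ1 : |σ| = 1 := by rcases hσ with rfl | rfl <;> simp
    have e1 : ∀ y, HasDerivAt (fun y => Real.exp (-(k * (y - α))))
        (-k * Real.exp (-(k * (y - α)))) y := fun y => by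
      have := ((((hasDerivAt_id y).sub_const α).const_mul k).fun_neg).exp
      refine this.congr_deriv ?_
      simp only [id]; ring
    have e2 : ∀ y, HasDerivAt (fun y => Real.exp (-(k * (β - y))))
        (k * Real.exp (-(k * (β - y)))) y := fun y => by
      have := ((((hasDerivAt_id y).const_sub β).const_mul k).fun_neg).exp
      refine this.congr_deriv ?_
      simp only [id]; ring
    have hB2 : k ^ 2 * (B / k ^ 2) = B := by field_simp
    have hBk : 0 ≤ B / k ^ 2 := by positivity
    refine le_of_second_order_subsolution (α := α) (β := β)
      (f := fun y => σ * f y - (B / k ^ 2 +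
        A * (Real.exp (-(k * (y - α))) + Real.exp (-(k * (β - y))))))
      (f1 := fun y => σ * f1 y - (A * (-k * Real.exp (-(k * (y - α)))
        + k * Real.exp (-(k * (β - y))))))
      (f2 := fun y => σ * f2 y - (A * (-k * (-k * Real.exp (-(k * (y - α))))
        + k * (k * Real.exp (-(k * (β - y)))))))
      hk ?_ ?_ ?_ ?_ ?_ ?_ hx
    · refine (hc.const_smul σ).sub (Continuous.continuousOn ?_)
      fun_prop
    · intro y hy
      exact ((hf y hy).const_mul σ).sub ((((e1 y).add (e2 y)).const_mul A).const_add _)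
    · intro y hy
      exact ((hf1 y hy).const_mul σ).sub ((((e1 y).const_mul (-k)).add
        ((e2 y).const_mul k)).const_mul A)
    · intro y hy
      have h1 : |σ * (f2 y - k ^ 2 * f y)| ≤ B := by rw [abs_mul, hσ1, one_mul]; exact hres y hy
      have h2 := (abs_le.1 h1).1
      simp only [mul_sub, mul_add, hB2]
      linarith
    · have h1 : σ * f α ≤ A := (le_abs_self _).trans (by rw [abs_mul, hσ1, one_mul]; exact hα)
      have h2 : 0 ≤ A * Real.exp (-(k * (β - α))) := by positivity
      simp only [sub_self, mul_zero, neg_zero, Real.exp_zero, mul_add, mul_one]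
      linarith
    · have h1 : σ * f β ≤ A := (le_abs_self _).trans (by rw [abs_mul, hσ1, one_mul]; exact hβ)
      have h2 : 0 ≤ A * Real.exp (-(k * (β - α))) := by positivity
      simp only [sub_self, mul_zero, neg_zero, Real.exp_zero, mul_add, mul_one]
      linarith
  rw [abs_le]
  constructor
  · linarith [key (-1) (Or.inr rfl)]
  · linarith [key 1 (Or.inl rfl)]

/-- Interpolation: the mean value theorem gives a point of `(x, x + h)` where the derivative is at
most `2 A / h`, and over that distance it changes by at most `h B`. -/
theorem abs_deriv_le_of_second_order {f f1 f2 : ℝ → ℝ} {x h A B : ℝ} (hh : 0 < h)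
    (hf : ∀ y ∈ Icc x (x + h), HasDerivAt f (f1 y) y)
    (hf1 : ∀ y ∈ Icc x (x + h), HasDerivAt f1 (f2 y) y)
    (hA : ∀ y ∈ Icc x (x + h), |f y| ≤ A) (hB : ∀ y ∈ Icc x (x + h), |f2 y| ≤ B) :
    |f1 x| ≤ 2 * A / h + h * B := by
  have hB0 : 0 ≤ B := (abs_nonneg _).trans (hB x ⟨le_rfl, by linarith⟩)
  obtain ⟨ξ, hξ, hξ'⟩ := exists_hasDerivAt_eq_slope f f1 (show x < x + h by linarith)
    (fun y hy => (hf y hy).continuousAt.continuousWithinAt)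
    (fun y hy => hf y (Ioo_subset_Icc_self hy))
  have h1 : |f1 ξ| ≤ 2 * A / h := by
    rw [hξ', add_sub_cancel_left, abs_div, abs_of_pos hh]
    gcongr
    have := abs_sub (f (x + h)) (f x)
    linarith [hA x ⟨le_rfl, by linarith⟩, hA (x + h) ⟨by linarith, le_rfl⟩]
  have h2 : |f1 ξ - f1 x| ≤ h * B := by
    have := Convex.norm_image_sub_le_of_norm_hasDerivWithin_le (f := f1) (f' := f2) (C := B)
      (s := Icc x (x + h)) (x := x) (y := ξ) (fun y hy => (hf1 y hy).hasDerivWithinAt)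
      (fun y hy => by simpa using hB y hy) (convex_Icc _ _) ⟨le_rfl, by linarith⟩
      (Ioo_subset_Icc_self hξ)
    simp only [Real.norm_eq_abs] at this
    refine this.trans ?_
    rw [abs_of_pos (by linarith [hξ.1]), mul_comm]
    gcongr
    linarith [hξ.2]
  have h3 := abs_sub_abs_le_abs_sub (f1 x) (f1 ξ)
  rw [abs_sub_comm] at h3
  linarith

/-- The decaying solution of `m'' = k² m + h` on the line, for an even source `h`. -/
theorem exists_even_solution {h : ℝ → ℝ} {k C : ℝ} (hk : 1 ≤ k) (hcont : Continuous h)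
    (heven : ∀ s, h (-s) = h s) (hbound : ∀ s, |h s| ≤ C * Real.exp (-|s|)) :
    ∃ m m1 : ℝ → ℝ, (∀ u, HasDerivAt m (m1 u) u) ∧
      (∀ u, HasDerivAt m1 (k ^ 2 * m u + h u) u) ∧ m1 0 = 0 ∧
      ∀ u, |m u| ≤ 2 * C / k ^ 2 * Real.exp (-|u| / 2) := by
  have hk0 : 0 < k := by linarith
  have hC : 0 ≤ C := by
    have := (abs_nonneg _).trans (hbound 0)
    simpa using this
  set φ : ℝ → ℝ := fun s => Real.exp (-(k * s)) * h s with hφ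
  have hφc : Continuous φ := by fun_prop
  -- The bound `exp (-|s|)` is weakened to `exp (σ s / 2)`, with either sign of `σ`. Giving up half
  -- the rate avoids the resonance at `k = 1`, where `u exp (-u)` would appear.
  have hb1 : ∀ σ : ℝ, |σ| = 1 → ∀ s, ‖φ s‖ ≤ C * Real.exp ((σ / 2 - k) * s) := by
    intro σ hσ s
    rw [hφ, Real.norm_eq_abs, abs_mul, abs_of_pos (Real.exp_pos _), sub_mul, sub_eq_add_neg,
      Real.exp_add]
    have h1 : |h s| ≤ C * Real.exp (σ / 2 * s) := by
      refine (hbound s).trans ?_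
      gcongr
      have : |σ * s| = |s| := by rw [abs_mul, hσ, one_mul]
      have h2 := neg_abs_le (σ * s)
      rw [this] at h2
      linarith [abs_nonneg s]
    calc _ ≤ Real.exp (-(k * s)) * (C * Real.exp (σ / 2 * s)) := by gcongr
      _ = _ := by ring
  have hneg : ∀ σ : ℝ, |σ| = 1 → σ / 2 - k < 0 := by
    intro σ hσ
    have := le_abs_self σ
    linarith
  have hint : ∀ u, IntegrableOn φ (Ioi u) := by
    intro u
    refine Integrable.mono' ((integrableOn_exp_mul_Ioi (hneg 1 (by simp)) u).const_mul C)
      hφc.aestronglyMeasurable ?_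
    exact Eventually.of_forall (hb1 1 (by simp))
  set A : ℝ → ℝ := fun u => ∫ s in Ioi u, φ s with hAdef
  have hAb : ∀ σ : ℝ, |σ| = 1 → ∀ u,
      |A u| ≤ C * (Real.exp ((σ / 2 - k) * u) / (k - σ / 2)) := by
    intro σ hσ u
    have := norm_integral_le_of_norm_le
      ((integrableOn_exp_mul_Ioi (hneg σ hσ) u).const_mul C)
      (Eventually.of_forall (hb1 σ hσ) : ∀ᵐ s ∂(volume.restrict (Ioi u)), _)
    rw [integral_const_mul, integral_exp_mul_Ioi (hneg σ hσ)] at this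
    refine this.trans (le_of_eq ?_)
    rw [neg_div, ← div_neg, neg_sub]
  have hAd : ∀ u, HasDerivAt A (-φ u) u := by
    intro u
    have e : A = fun u => A 0 - ∫ s in (0:ℝ)..u, φ s := by
      funext v
      rw [hAdef]
      simp only
      rw [← intervalIntegral.integral_interval_add_Ioi (hint 0) (hint v)]
      ring
    rw [e]
    exact ((intervalIntegral.integral_hasDerivAt_right (hφc.intervalIntegrable _ _)
      (hφc.stronglyMeasurableAtFilter _ _) hφc.continuousAt).const_sub _)
  have hAneg : ∀ u, HasDerivAt (fun u => A (-u)) (φ (-u)) u := by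
    intro u
    exact ((hAd (-u)).comp u (hasDerivAt_neg u)).congr_deriv (by ring)
  have hE : ∀ c u : ℝ, HasDerivAt (fun u => Real.exp (c * u)) (c * Real.exp (c * u)) u := by
    intro c u
    have := ((hasDerivAt_id u).const_mul c).exp
    refine this.congr_deriv ?_
    simp only [id]; ring
  have hee : ∀ u, Real.exp (k * u) * Real.exp (-(k * u)) = 1 := fun u => by
    rw [← Real.exp_add]; simp
  -- Convolution of `h` with the Green function `-exp (-k |s|) / (2 k)`; evenness of `h` turns the
  -- integral over `(-∞, u)` into `A (-u)`.
  refine ⟨fun u => -(1 / (2 * k)) * (Real.exp (k * u) * A u + Real.exp (-k * u) * A (-u)),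
    fun u => -(1 / 2) * (Real.exp (k * u) * A u - Real.exp (-k * u) * A (-u)), ?_, ?_, ?_, ?_⟩
  · intro u
    refine (((((hE k u).mul (hAd u)).add ((hE (-k) u).mul (hAneg u)))).const_mul
      (-(1 / (2 * k)))).congr_deriv ?_
    simp only [hφ, heven, neg_mul, mul_neg, neg_neg]
    field_simp
    ring
  · intro u
    refine (((((hE k u).mul (hAd u)).sub ((hE (-k) u).mul (hAneg u)))).const_mul
      (-(1 / 2))).congr_deriv ?_
    simp only [hφ, heven, neg_mul, mul_neg, neg_neg]
    have h1 := hee u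
    field_simp
    linear_combination (2 * h u) * h1
  · simp
  · have main : ∀ u, 0 ≤ u →
        |Real.exp (k * u) * A u + Real.exp (-k * u) * A (-u)| ≤
          4 * C / k * Real.exp (-u / 2) := by
      intro u hu
      have h1 := hAb (-1) (by simp) u
      have h2 := hAb 1 (by simp) (-u)
      have h3 : |Real.exp (k * u) * A u| ≤ C / k * Real.exp (-u / 2) := by
        rw [abs_mul, abs_of_pos (Real.exp_pos _)]
        calc _ ≤ Real.exp (k * u) * (C * (Real.exp ((-1 / 2 - k) * u) / (k - -1 / 2))) := by
              gcongr
          _ = C / (k + 1 / 2) * (Real.exp (k * u) * Real.exp ((-1 / 2 - k) * u)) := by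
              rw [show k - -1 / 2 = k + 1 / 2 by ring]; ring
          _ = C / (k + 1 / 2) * Real.exp (-u / 2) := by
              rw [← Real.exp_add]; ring_nf
          _ ≤ _ := by gcongr; linarith
      have h4 : |Real.exp (-k * u) * A (-u)| ≤ 2 * C / k * Real.exp (-u / 2) := by
        rw [abs_mul, abs_of_pos (Real.exp_pos _)]
        calc _ ≤ Real.exp (-k * u) * (C * (Real.exp ((1 / 2 - k) * -u) / (k - 1 / 2))) := by
              gcongr
          _ = C / (k - 1 / 2) * (Real.exp (-k * u) * Real.exp ((1 / 2 - k) * -u)) := by ring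
          _ = C / (k - 1 / 2) * Real.exp (-u / 2) := by
              rw [← Real.exp_add]; ring_nf
          _ ≤ _ := by
              gcongr ?_ * _
              rw [div_le_div_iff₀ (by linarith) hk0]
              nlinarith
      refine (abs_add_le _ _).trans ((add_le_add h3 h4).trans ?_)
      rw [← add_mul]
      gcongr
      rw [← add_div]
      gcongr
      linarith
    intro u
    have h5 : |Real.exp (k * u) * A u + Real.exp (-k * u) * A (-u)| ≤
        4 * C / k * Real.exp (-|u| / 2) := by
      rcases le_total 0 u with hu | hu
      · rw [abs_of_nonneg hu]; exact main u hu
      · rw [abs_of_nonpos hu]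
        have := main (-u) (by linarith)
        simp only [neg_neg, mul_neg, neg_mul] at this ⊢
        rwa [add_comm] at this
    rw [abs_mul, abs_neg, abs_of_pos (by positivity : 0 < 1 / (2 * k))]
    calc _ ≤ 1 / (2 * k) * (4 * C / k * Real.exp (-|u| / 2)) := by gcongr
      _ = _ := by field_simp; ring

/-! ### Uniqueness by the maximum principle -/

theorem ContDiffOn.slice_left {n : ℝ × ℝ → ℝ} {k : WithTop ℕ∞} {s t : Set ℝ}
    (h : ContDiffOn ℝ k n (s ×ˢ t)) {θ : ℝ} (hθ : θ ∈ t) :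
    ContDiffOn ℝ k (fun u => n (u, θ)) s :=
  h.comp (by fun_prop : ContDiff ℝ k fun u : ℝ => (u, θ)).contDiffOn fun _ hu => ⟨hu, hθ⟩

theorem ContDiffOn.slice_right {n : ℝ × ℝ → ℝ} {k : WithTop ℕ∞} {s t : Set ℝ}
    (h : ContDiffOn ℝ k n (s ×ˢ t)) {u : ℝ} (hu : u ∈ s) :
    ContDiffOn ℝ k (fun θ => n (u, θ)) t :=
  h.comp (by fun_prop : ContDiff ℝ k fun θ : ℝ => (u, θ)).contDiffOn fun _ hθ => ⟨hu, hθ⟩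

theorem hasDerivAt_of_contDiffOn_two {f : ℝ → ℝ} {s : Set ℝ} (hs : IsOpen s)
    (hf : ContDiffOn ℝ 2 f s) {x : ℝ} (hx : x ∈ s) :
    HasDerivAt f (deriv f x) x ∧ HasDerivAt (deriv f) (deriv (deriv f) x) x := by
  refine ⟨((hf.differentiableOn (by norm_num)).differentiableAt (hs.mem_nhds hx)).hasDerivAt, ?_⟩
  have h1 : ContDiffOn ℝ 1 (deriv f) s := hf.deriv_of_isOpen hs (by norm_num)
  exact ((h1.differentiableOn (by norm_num)).differentiableAt (hs.mem_nhds hx)).hasDerivAt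

theorem hLaplace_eq {n : ℝ → ℝ → ℝ} {Rp R θ : ℝ} (hRp : 0 ≤ Rp)
    (hn : ContDiffOn ℝ 2 (fun p : ℝ × ℝ => n p.1 p.2) (Ioi Rp ×ˢ Ioo 0 Real.pi))
    (hR : Rp < R) (hθ : θ ∈ Ioo 0 Real.pi) :
    R * hLaplace n R θ = R ^ 2 * deriv (deriv fun s => n s θ) R + R * deriv (fun s => n s θ) R +
      deriv (deriv fun t => n R t) θ := by
  have hR0 : 0 < R := hRp.trans_lt hR
  have h1 := hasDerivAt_of_contDiffOn_two isOpen_Ioi (ContDiffOn.slice_left hn hθ) hR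
  have h2 := hasDerivAt_of_contDiffOn_two isOpen_Ioo (ContDiffOn.slice_right hn hR) hθ
  have e1 : deriv (fun s => s * deriv (fun s => n s θ) s) R =
      deriv (fun s => n s θ) R + R * deriv (deriv fun s => n s θ) R := by
    have := ((hasDerivAt_id R).mul h1.2).deriv
    simp only [one_mul, id] at this
    exact this
  have e2 : deriv (fun t => 1 / R * deriv (fun t => n R t) t) θ =
      1 / R * deriv (deriv fun t => n R t) θ := (h2.2.const_mul _).deriv
  unfold hLaplace
  unfold dR dTheta
  rw [e1, e2]
  field_simp
  ring

/-- Add `ε φ` with `φ = (θ - π/2)² - Rp / R`. Then `R² φ_RR + R φ_R + φ_θθ = 2 - Rp / R ≥ 1`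
excludes interior maxima, and `φ_R = 1 / Rp > 0` at the horizon excludes maxima there. What remains
are the axes and a large circle, where `n ≤ ε`. -/
theorem mixed_problem_nonpos {n : ℝ → ℝ → ℝ} {Rp : ℝ} (hRp : 0 < Rp)
    (hc : ContinuousOn (fun p : ℝ × ℝ => n p.1 p.2) (Ici Rp ×ˢ Icc 0 Real.pi))
    (hd : ContDiffOn ℝ 2 (fun p : ℝ × ℝ => n p.1 p.2) (Ioi Rp ×ˢ Ioo 0 Real.pi))
    (hL : ∀ R θ : ℝ, Rp < R → θ ∈ Ioo 0 Real.pi → hLaplace n R θ = 0)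
    (hv : Tendsto (fun p : ℝ × ℝ => n p.1 p.2) (atTop ×ˢ 𝓟 (Icc 0 Real.pi)) (𝓝 0))
    (hD : ∀ R, Rp ≤ R → n R 0 = 0 ∧ n R Real.pi = 0)
    (hN : ∀ θ ∈ Icc 0 Real.pi, HasDerivWithinAt (fun R => n R θ) 0 (Ici Rp) Rp)
    {R θ : ℝ} (hR : Rp ≤ R) (hθ : θ ∈ Icc 0 Real.pi) : n R θ ≤ 0 := by
  refine le_of_forall_pos_le_add fun δ hδ => ?_
  rw [zero_add]
  -- With `-1 ≤ φ ≤ 16`, the maximum of `n + ε φ` is at most `ε + 16 ε`, and removing `ε φ` costs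
  -- one more `ε`.
  obtain ⟨ε, hε, hεδ⟩ : ∃ ε : ℝ, 0 < ε ∧ 18 * ε ≤ δ := ⟨δ / 18, by positivity, by linarith⟩
  have hpi := Real.pi_le_four
  have hpi0 := Real.pi_pos
  -- a bounded strictly subharmonic barrier, increasing in `R` at the horizon
  set φ : ℝ → ℝ → ℝ := fun s t => (t - Real.pi / 2) ^ 2 - Rp / s with hφ
  have hφb : ∀ s t, Rp ≤ s → t ∈ Icc 0 Real.pi → -1 ≤ φ s t ∧ φ s t ≤ 16 := by
    intro s t hs ht
    have hs0 : 0 < s := hRp.trans_le hs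
    have h1 : Rp / s ≤ 1 := (div_le_one hs0).2 hs
    have h2 : 0 ≤ Rp / s := by positivity
    have h3 : (t - Real.pi / 2) ^ 2 ≤ 16 := by nlinarith [ht.1, ht.2]
    simp only [hφ]
    constructor
    · nlinarith [sq_nonneg (t - Real.pi / 2)]
    · linarith
  set v : ℝ → ℝ → ℝ := fun s t => n s t + ε * φ s t with hvdef
  obtain ⟨S, hSR, hS⟩ : ∃ S, max R Rp < S ∧ ∀ t ∈ Icc 0 Real.pi, n S t ≤ ε := by
    have h1 : ∀ᶠ p : ℝ × ℝ in atTop ×ˢ 𝓟 (Icc 0 Real.pi), n p.1 p.2 < ε :=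
      hv.eventually (gt_mem_nhds hε)
    rw [eventually_prod_principal_iff] at h1
    obtain ⟨S, h2, h3⟩ := (h1.and (eventually_gt_atTop (max R Rp))).exists
    exact ⟨S, h3, fun t ht => (h2 t ht).le⟩
  have hSRp : Rp < S := (le_max_right _ _).trans_lt hSR
  have hvc : ContinuousOn (fun p : ℝ × ℝ => v p.1 p.2) (Icc Rp S ×ˢ Icc 0 Real.pi) := by
    refine (hc.mono (prod_mono_left Icc_subset_Ici_self)).add (continuousOn_const.mul ?_)
    refine ContinuousOn.sub (by fun_prop) (continuousOn_const.div continuousOn_fst ?_)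
    intro p hp
    exact (hRp.trans_le hp.1.1).ne'
  obtain ⟨⟨R₀, θ₀⟩, ⟨hR₀, hθ₀⟩, hmax⟩ := (isCompact_Icc.prod isCompact_Icc).exists_isMaxOn
    (⟨(R, θ), ⟨hR, ((le_max_left _ _).trans_lt hSR).le⟩, hθ⟩ :
      (Icc Rp S ×ˢ Icc 0 Real.pi).Nonempty) hvc
  have hmax' : ∀ s t, s ∈ Icc Rp S → t ∈ Icc 0 Real.pi → v s t ≤ v R₀ θ₀ :=
    fun s t hs ht => hmax (show (s, t) ∈ _ from ⟨hs, ht⟩)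
  have key : v R₀ θ₀ ≤ 17 * ε := by
    have hφ0 := (hφb R₀ θ₀ hR₀.1 hθ₀).2
    have bdry : n R₀ θ₀ ≤ ε → v R₀ θ₀ ≤ 17 * ε := by
      intro h
      simp only [hvdef]
      nlinarith
    rcases hθ₀.1.eq_or_lt with h0 | h0
    · subst h0; exact bdry (by rw [(hD R₀ hR₀.1).1]; exact hε.le)
    rcases hθ₀.2.eq_or_lt with h1 | h1
    · subst h1; exact bdry (by rw [(hD R₀ hR₀.1).2]; exact hε.le)
    rcases hR₀.2.eq_or_lt with h2 | h2
    · subst h2; exact bdry (hS _ hθ₀)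
    exfalso
    have hR₀0 : 0 < R₀ := hRp.trans_le hR₀.1
    have hφR : ∀ s : ℝ, s ≠ 0 → HasDerivAt (fun s => φ s θ₀) (Rp / s ^ 2) s := by
      intro s hs
      have := (((hasDerivAt_inv hs).const_mul Rp).const_sub ((θ₀ - Real.pi / 2) ^ 2))
      refine (this.congr_deriv ?_)
      field_simp
    rcases hR₀.1.eq_or_lt with h3 | h3
    · subst h3
      -- The normal derivative of `n` vanishes, so that of `v` is `ε / Rp > 0`: `v` exceeds its
      -- supposed maximum just outside the horizon.
      have hder : HasDerivWithinAt (fun s => v s θ₀) (0 + ε * (Rp / Rp ^ 2)) (Ici Rp) Rp :=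
        (hN θ₀ hθ₀).add ((hφR Rp hRp.ne').hasDerivWithinAt.const_mul ε)
      have hpos : 0 < 0 + ε * (Rp / Rp ^ 2) := by positivity
      have hslope := (hasDerivWithinAt_iff_tendsto_slope' self_notMem_Ioi).1
        (hder.mono Ioi_subset_Ici_self)
      have hev := hslope.eventually (lt_mem_nhds hpos)
      have hev2 : ∀ᶠ s in 𝓝[>] Rp, s < S := nhdsWithin_le_nhds (gt_mem_nhds hSRp)
      obtain ⟨s, ⟨hs1, hs2⟩, hs3⟩ := ((hev.and hev2).and self_mem_nhdsWithin).exists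
      rw [slope_def_field] at hs1
      have hs4 : 0 < s - Rp := sub_pos.2 hs3
      have := (div_pos_iff_of_pos_right hs4).1 hs1
      have h5 := hmax' s θ₀ ⟨le_of_lt hs3, hs2.le⟩ hθ₀
      linarith
    · have hθo : θ₀ ∈ Ioo 0 Real.pi := ⟨h0, h1⟩
      have hl1 : IsLocalMax (fun s => v s θ₀) R₀ := by
        filter_upwards [Ioo_mem_nhds h3 h2] with s hs
        exact hmax' s θ₀ (Ioo_subset_Icc_self hs) hθ₀
      have hl2 : IsLocalMax (fun t => v R₀ t) θ₀ := by
        filter_upwards [Ioo_mem_nhds h0 h1] with t ht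
        exact hmax' R₀ t hR₀ (Ioo_subset_Icc_self ht)
      have dn1 : ∀ s ∈ Ioi Rp, _ := fun s hs => hasDerivAt_of_contDiffOn_two isOpen_Ioi
        (ContDiffOn.slice_left hd hθo) hs
      have dn2 : ∀ t ∈ Ioo 0 Real.pi, _ := fun t ht => hasDerivAt_of_contDiffOn_two isOpen_Ioo
        (ContDiffOn.slice_right hd h3) ht
      have hφRR : HasDerivAt (fun s : ℝ => Rp / s ^ 2) (-(2 * Rp / R₀ ^ 3)) R₀ := by
        have := ((hasDerivAt_pow 2 R₀).inv (by positivity)).const_mul Rp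
        refine this.congr_deriv ?_
        push_cast
        field_simp
      have hφt : ∀ t : ℝ, HasDerivAt (fun t => φ R₀ t) (2 * (t - Real.pi / 2)) t := by
        intro t
        have := ((((hasDerivAt_id t).sub_const (Real.pi / 2)).pow 2).sub_const (Rp / R₀))
        refine this.congr_deriv ?_
        simp
      have hφtt : HasDerivAt (fun t => 2 * (t - Real.pi / 2)) 2 θ₀ := by
        have := ((hasDerivAt_id θ₀).sub_const (Real.pi / 2)).const_mul 2
        simpa using this
      have i1 := secondDeriv_nonpos_of_isLocalMax (f := fun s => v s θ₀)
        (f1 := fun s => deriv (fun s => n s θ₀) s + ε * (Rp / s ^ 2))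
        (by
          filter_upwards [Ioi_mem_nhds h3] with s hs
          exact (dn1 s hs).1.add ((hφR s (hRp.trans hs).ne').const_mul ε))
        ((dn1 R₀ h3).2.add (hφRR.const_mul ε)) hl1
      have i2 := secondDeriv_nonpos_of_isLocalMax (f := fun t => v R₀ t)
        (f1 := fun t => deriv (fun t => n R₀ t) t + ε * (2 * (t - Real.pi / 2)))
        (by
          filter_upwards [Ioo_mem_nhds h0 h1] with t ht
          exact (dn2 t ht).1.add ((hφt t).const_mul ε))
        ((dn2 θ₀ hθo).2.add (hφtt.const_mul ε)) hl2
      have i3 := hl1.hasDerivAt_eq_zero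
        ((dn1 R₀ h3).1.add ((hφR R₀ hR₀0.ne').const_mul ε))
      have e := hLaplace_eq hRp.le hd h3 hθo
      rw [hL R₀ θ₀ h3 hθo, mul_zero] at e
      -- At an interior maximum `R² v_RR + R v_R + v_θθ ≤ 0`, whereas harmonicity of `n` makes it `ε
      -- (2 - Rp / R₀) > 0`.
      have j1 : R₀ ^ 2 * (deriv (deriv fun s => n s θ₀) R₀ + ε * -(2 * Rp / R₀ ^ 3)) ≤ 0 :=
        mul_nonpos_of_nonneg_of_nonpos (by positivity) i1
      have j2 : R₀ * (deriv (fun s => n s θ₀) R₀ + ε * (Rp / R₀ ^ 2)) = 0 := by rw [i3, mul_zero]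
      have j3 : R₀ ^ 2 * (ε * -(2 * Rp / R₀ ^ 3)) = -2 * (ε * (Rp / R₀)) := by field_simp
      have j4 : R₀ * (ε * (Rp / R₀ ^ 2)) = ε * (Rp / R₀) := by field_simp
      have j5 : Rp / R₀ ≤ 1 := (div_le_one hR₀0).2 h3.le
      rw [mul_add, j3] at j1
      rw [mul_add, j4] at j2
      nlinarith
  have h1 := hmax' R θ ⟨hR, ((le_max_left _ _).trans_lt hSR).le⟩ hθ
  have h2 := (hφb R θ hR hθ).1
  simp only [hvdef] at h1 key
  nlinarith

theorem IsMixedSolution.unique {M a Q : ℝ} (hsub : a ^ 2 + Q ^ 2 < M ^ 2)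
    {g w e l n μ : ℝ → ℝ → ℝ} (hn : IsMixedSolution M a Q g w e l n)
    (hμ : IsMixedSolution M a Q g w e l μ) {R θ : ℝ} (hR : Rplus M a Q ≤ R)
    (hθ : θ ∈ Icc 0 Real.pi) : μ R θ = n R θ := by
  have hRp : 0 < Rplus M a Q := by
    unfold Rplus
    have := Real.sqrt_pos.2 (sub_pos.2 hsub)
    positivity
  have main : ∀ {n μ : ℝ → ℝ → ℝ}, IsMixedSolution M a Q g w e l n →
      IsMixedSolution M a Q g w e l μ → μ R θ - n R θ ≤ 0 := by
    intro n μ hn hμ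
    have hd := hμ.contDiffOn.sub hn.contDiffOn
    refine mixed_problem_nonpos (n := fun s t => μ s t - n s t) hRp
      (hμ.continuousOn.sub hn.continuousOn) hd ?_ ?_ ?_ ?_ hR hθ
    · intro s t hs ht
      have e1 := hLaplace_eq (n := fun s t => μ s t - n s t) hRp.le hd hs ht
      have e2 := hLaplace_eq hRp.le hn.contDiffOn hs ht
      have e3 := hLaplace_eq hRp.le hμ.contDiffOn hs ht
      have e4 : hLaplace μ s t = hLaplace n s t := by
        have c1 := hn.constraint s t hs ht
        have c2 := hμ.constraint s t hs ht
        simp only [linHamiltonian] at c1 c2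
        linarith
      have hs0 : s ≠ 0 := (hRp.trans hs).ne'
      have d1 : ∀ s ∈ Ioi (Rplus M a Q), _ := fun s hs => hasDerivAt_of_contDiffOn_two isOpen_Ioi
        (ContDiffOn.slice_left hn.contDiffOn ht) hs
      have d2 : ∀ s ∈ Ioi (Rplus M a Q), _ := fun s hs => hasDerivAt_of_contDiffOn_two isOpen_Ioi
        (ContDiffOn.slice_left hμ.contDiffOn ht) hs
      have d3 : ∀ t ∈ Ioo 0 Real.pi, _ := fun t ht => hasDerivAt_of_contDiffOn_two isOpen_Ioo
        (ContDiffOn.slice_right hn.contDiffOn hs) ht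
      have d4 : ∀ t ∈ Ioo 0 Real.pi, _ := fun t ht => hasDerivAt_of_contDiffOn_two isOpen_Ioo
        (ContDiffOn.slice_right hμ.contDiffOn hs) ht
      have f1 : deriv (fun s => μ s t - n s t) s =
          deriv (fun s => μ s t) s - deriv (fun s => n s t) s := ((d2 s hs).1.sub (d1 s hs).1).deriv
      have f2 : deriv (deriv fun s => μ s t - n s t) s =
          deriv (deriv fun s => μ s t) s - deriv (deriv fun s => n s t) s := by
        refine (HasDerivAt.congr_of_eventuallyEq ((d2 s hs).2.sub (d1 s hs).2) ?_).deriv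
        filter_upwards [Ioi_mem_nhds hs] with r hr
        exact ((d2 r hr).1.sub (d1 r hr).1).deriv
      have f3 : deriv (deriv fun t => μ s t - n s t) t =
          deriv (deriv fun t => μ s t) t - deriv (deriv fun t => n s t) t := by
        refine (HasDerivAt.congr_of_eventuallyEq ((d4 t ht).2.sub (d3 t ht).2) ?_).deriv
        filter_upwards [Ioo_mem_nhds ht.1 ht.2] with r hr
        exact ((d4 r hr).1.sub (d3 r hr).1).deriv
      have : s * hLaplace (fun s t => μ s t - n s t) s t = 0 := by
        rw [e1, f1, f2, f3]
        linear_combination e2 - e3 + s * e4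
      exact (mul_eq_zero.1 this).resolve_left hs0
    · simpa using hμ.vanishes.sub hn.vanishes
    · intro s hs
      rw [(hμ.dirichlet s hs).1, (hμ.dirichlet s hs).2, (hn.dirichlet s hs).1,
        (hn.dirichlet s hs).2]
      simp
    · intro t ht
      simpa using (hμ.neumann t ht).fun_sub (hn.neumann t ht)
  linarith [main hn hμ, main hμ hn]

/-! ### Sine series on `[0, π]` -/

/-- The coefficient of `sin ((n + 1) t)` in the sine series of `φ` on `[0, π]`. -/
noncomputable def sineCoeff (φ : ℝ → ℝ) (n : ℕ) : ℝ :=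
  2 / Real.pi * ∫ t in (0 : ℝ)..Real.pi, φ t * Real.sin ((n + 1) * t)

theorem sin_succ_mul_pi (n : ℕ) : Real.sin (((n : ℝ) + 1) * Real.pi) = 0 := by
  have := Real.sin_nat_mul_pi (n + 1)
  push_cast at this
  exact this

theorem abs_sineCoeff_le {φ : ℝ → ℝ} {B : ℝ} (hB : ∀ t ∈ Icc 0 Real.pi, |φ t| ≤ B) (n : ℕ) :
    |sineCoeff φ n| ≤ 2 * B := by
  have hpi := Real.pi_pos
  have h := intervalIntegral.norm_integral_le_of_norm_le_const (a := 0) (b := Real.pi)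
    (f := fun t => φ t * Real.sin ((n + 1) * t)) (C := B) (fun t ht => by
      rw [uIoc_of_le hpi.le] at ht
      rw [norm_mul, Real.norm_eq_abs, Real.norm_eq_abs]
      have h1 := hB t (Ioc_subset_Icc_self ht)
      have h2 := Real.abs_sin_le_one ((n + 1) * t)
      have h3 := abs_nonneg (φ t)
      nlinarith [abs_nonneg (Real.sin ((n + 1) * t))])
  rw [sub_zero, abs_of_pos hpi, Real.norm_eq_abs] at h
  rw [sineCoeff, abs_mul, abs_of_pos (by positivity)]
  calc _ ≤ 2 / Real.pi * (B * Real.pi) := by gcongr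
    _ = _ := by field_simp

theorem hasDerivAt_sin_mul (k t : ℝ) :
    HasDerivAt (fun t => Real.sin (k * t)) (k * Real.cos (k * t)) t := by
  have := ((hasDerivAt_id t).const_mul k).sin
  refine this.congr_deriv ?_
  simp only [id]; ring

theorem hasDerivAt_cos_mul (k t : ℝ) :
    HasDerivAt (fun t => Real.cos (k * t)) (-k * Real.sin (k * t)) t := by
  have := ((hasDerivAt_id t).const_mul k).cos
  refine this.congr_deriv ?_
  simp only [id]; ring

/-- Two integrations by parts. The boundary values of `φ` give the `O(1/n)` part; the derivative
boundary terms drop out because the sines vanish at `0` and `π`. -/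
theorem sineCoeff_by_parts {φ φ1 φ2 : ℝ → ℝ} (h1 : ∀ t, HasDerivAt φ (φ1 t) t)
    (h2 : ∀ t, HasDerivAt φ1 (φ2 t) t) (hc : Continuous φ2) (n : ℕ) :
    sineCoeff φ n = 2 / (Real.pi * (n + 1)) *
      (φ 0 - Real.cos ((n + 1) * Real.pi) * φ Real.pi) - sineCoeff φ2 n / (n + 1) ^ 2 := by
  have hk : (n : ℝ) + 1 ≠ 0 := by positivity
  have hc0 : Continuous φ := continuous_iff_continuousAt.2 fun t => (h1 t).continuousAt
  have e : ∫ t in (0 : ℝ)..Real.pi, (φ t * Real.sin ((n + 1) * t) +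
      φ2 t * Real.sin ((n + 1) * t) / (n + 1) ^ 2) =
      (φ 0 - Real.cos ((n + 1) * Real.pi) * φ Real.pi) / (n + 1) := by
    have := intervalIntegral.integral_eq_sub_of_hasDerivAt (a := 0) (b := Real.pi)
      (f := fun t => -(φ t * Real.cos ((n + 1) * t)) / (n + 1)
        + φ1 t * Real.sin ((n + 1) * t) / (n + 1) ^ 2)
      (f' := fun t => φ t * Real.sin ((n + 1) * t) +
        φ2 t * Real.sin ((n + 1) * t) / (n + 1) ^ 2) (fun t _ => ?_)
      (Continuous.intervalIntegrable (by fun_prop) _ _)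
    · rw [this, sin_succ_mul_pi]
      simp
      field_simp
      ring
    · refine (((((h1 t).mul (hasDerivAt_cos_mul (n + 1) t)).fun_neg).div_const ((n : ℝ) + 1)).add
        (((h2 t).mul (hasDerivAt_sin_mul (n + 1) t)).div_const (((n : ℝ) + 1) ^ 2))).congr_deriv ?_
      field_simp
      ring
  rw [intervalIntegral.integral_add (Continuous.intervalIntegrable (by fun_prop) _ _)
    (Continuous.intervalIntegrable (by fun_prop) _ _), intervalIntegral.integral_div] at e
  unfold sineCoeff
  rw [eq_sub_of_add_eq e]
  have := Real.pi_ne_zero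
  field_simp

theorem summable_one_div_succ_sq : Summable fun n : ℕ => 1 / ((n : ℝ) + 1) ^ 2 := by
  have := (summable_nat_add_iff 1).2 (Real.summable_one_div_nat_pow.2 (by norm_num : 1 < 2))
  simpa using this

theorem hasSum_cos_div_sq {x : ℝ} (h0 : 0 ≤ x) (h1 : x ≤ 2 * Real.pi) :
    HasSum (fun n : ℕ => Real.cos ((n + 1) * x) / (n + 1) ^ 2)
      (Real.pi ^ 2 / 6 - Real.pi * x / 2 + x ^ 2 / 4) := by
  have hpi := Real.pi_pos
  have h := hasSum_one_div_nat_pow_mul_cos (k := 1) one_ne_zero (x := x / (2 * Real.pi))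
    ⟨by positivity, (div_le_one (by positivity)).2 h1⟩
  have hB : (Polynomial.map (algebraMap ℚ ℝ) (Polynomial.bernoulli 2)).eval
      (x / (2 * Real.pi)) = (x / (2 * Real.pi)) ^ 2 - x / (2 * Real.pi) + 1 / 6 := by
    simp_rw [Polynomial.bernoulli, Finset.sum_range_succ, Polynomial.map_add,
      Polynomial.map_monomial, Polynomial.eval_add, Polynomial.eval_monomial]
    rw [Finset.sum_range_zero, Polynomial.map_zero, Polynomial.eval_zero, zero_add]
    norm_num [bernoulli_zero, bernoulli_one, bernoulli_two]
    ring
  simp only [mul_one] at h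
  rw [hB] at h
  rw [← hasSum_nat_add_iff' 1] at h
  simp only [Finset.range_one, Finset.sum_singleton, Nat.cast_zero] at h
  convert! h using 1
  · funext n
    push_cast
    rw [show 2 * Real.pi * ((n : ℝ) + 1) * (x / (2 * Real.pi)) = (n + 1) * x by field_simp]
    ring
  · simp only [Nat.factorial]
    push_cast
    field_simp
    ring

/-- The eigenfunction expansion, up to the factor `π / 2`, of the Dirichlet Green function of
`-d²/dt²` on `[0, π]`. The product formula reduces it to the cosine series of the second Bernoulli
polynomial at `|θ - t|` and `θ + t`. -/
theorem hasSum_sin_mul_sin_div_sq {θ t : ℝ} (hθ : θ ∈ Icc 0 Real.pi) (ht : t ∈ Icc 0 Real.pi) :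
    HasSum (fun n : ℕ => Real.sin ((n + 1) * t) * Real.sin ((n + 1) * θ) / (n + 1) ^ 2)
      ((Real.pi * min θ t - θ * t) / 2) := by
  have hs : |θ - t| ≤ 2 * Real.pi := by
    rw [abs_le]; constructor <;> linarith [hθ.1, hθ.2, ht.1, ht.2, Real.pi_pos]
  have h := ((hasSum_cos_div_sq (abs_nonneg (θ - t)) hs).sub
    (hasSum_cos_div_sq (x := θ + t) (by linarith [hθ.1, ht.1])
      (by linarith [hθ.2, ht.2]))).div_const 2
  convert! h using 1
  · funext n
    have e : Real.cos (((n : ℝ) + 1) * |θ - t|) = Real.cos ((n + 1) * θ - (n + 1) * t) := by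
      rw [← Real.cos_abs ((n + 1) * θ - (n + 1) * t), ← mul_sub, abs_mul,
        abs_of_pos (by positivity : (0 : ℝ) < n + 1)]
    rw [e, mul_add, Real.cos_sub, Real.cos_add]
    ring
  · rcases le_total θ t with h1 | h1
    · rw [min_eq_left h1, abs_of_nonpos (by linarith)]; ring
    · rw [min_eq_right h1, abs_of_nonneg (by linarith)]; ring

/-- Integrating the Green function expansion against `φ''` recovers `φ`. Pointwise convergence thus
comes from dominated convergence with majorant `B / (n + 1)²`, with no appeal to completeness of the
sines. -/
theorem hasSum_sineCoeff {φ φ1 φ2 : ℝ → ℝ} (h1 : ∀ t, HasDerivAt φ (φ1 t) t)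
    (h2 : ∀ t, HasDerivAt φ1 (φ2 t) t) (hc : Continuous φ2) (h0 : φ 0 = 0) (hpi : φ Real.pi = 0)
    {θ : ℝ} (hθ : θ ∈ Icc 0 Real.pi) :
    HasSum (fun n : ℕ => sineCoeff φ n * Real.sin ((n + 1) * θ)) (φ θ) := by
  have hπ := Real.pi_pos
  obtain ⟨B, hB⟩ := isCompact_Icc.exists_bound_of_continuousOn
    (hc.continuousOn (s := Icc 0 Real.pi))
  have hB0 : 0 ≤ B := (norm_nonneg _).trans (hB 0 ⟨le_rfl, hπ.le⟩)
  have key := intervalIntegral.hasSum_integral_of_dominated_convergence (μ := volume)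
    (a := 0) (b := Real.pi)
    (F := fun (n : ℕ) t =>
      φ2 t * (Real.sin ((n + 1) * t) * Real.sin ((n + 1) * θ) / (n + 1) ^ 2))
    (f := fun t => φ2 t * ((Real.pi * min θ t - θ * t) / 2))
    (fun n _ => B * (1 / ((n : ℝ) + 1) ^ 2))
    (fun n => Continuous.aestronglyMeasurable (by fun_prop))
    (fun n => Eventually.of_forall fun t ht => ?_)
    (Eventually.of_forall fun t _ => summable_one_div_succ_sq.mul_left B)
    (by simp)
    (Eventually.of_forall fun t ht => ?_)
  -- The kernel is linear in `t` on each side of `θ`; integrating by parts on the two pieces, the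
  -- `φ1 θ` terms cancel.
  · have split : ∫ t in (0 : ℝ)..Real.pi, φ2 t * ((Real.pi * min θ t - θ * t) / 2) =
        -(Real.pi / 2) * φ θ := by
      have hcont : Continuous fun t => φ2 t * ((Real.pi * min θ t - θ * t) / 2) := by fun_prop
      rw [← intervalIntegral.integral_add_adjacent_intervals (b := θ)
        (hcont.intervalIntegrable _ _) (hcont.intervalIntegrable _ _)]
      have i1 : ∫ t in (0 : ℝ)..θ, φ2 t * ((Real.pi * min θ t - θ * t) / 2) =
          (Real.pi - θ) / 2 * (θ * φ1 θ - φ θ) := by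
        have e : ∫ t in (0 : ℝ)..θ, φ2 t * ((Real.pi * min θ t - θ * t) / 2) =
            ∫ t in (0 : ℝ)..θ, (Real.pi - θ) / 2 * (t * φ2 t) := by
          refine intervalIntegral.integral_congr fun t ht => ?_
          rw [uIcc_of_le hθ.1] at ht
          simp only [min_eq_right ht.2]
          ring
        rw [e, intervalIntegral.integral_eq_sub_of_hasDerivAt
          (f := fun t => (Real.pi - θ) / 2 * (t * φ1 t - φ t)) (fun t _ => ?_)
          (Continuous.intervalIntegrable (by fun_prop) _ _)]
        · simp [h0]
        · refine ((((hasDerivAt_id t).mul (h2 t)).sub (h1 t)).const_mul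
            ((Real.pi - θ) / 2)).congr_deriv ?_
          simp
      have i2 : ∫ t in θ..Real.pi, φ2 t * ((Real.pi * min θ t - θ * t) / 2) =
          -(θ / 2 * ((Real.pi - θ) * φ1 θ + φ θ)) := by
        have e : ∫ t in θ..Real.pi, φ2 t * ((Real.pi * min θ t - θ * t) / 2) =
            ∫ t in θ..Real.pi, θ / 2 * ((Real.pi - t) * φ2 t) := by
          refine intervalIntegral.integral_congr fun t ht => ?_
          rw [uIcc_of_le hθ.2] at ht
          simp only [min_eq_left ht.1]
          ring
        rw [e, intervalIntegral.integral_eq_sub_of_hasDerivAt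
          (f := fun t => θ / 2 * ((Real.pi - t) * φ1 t + φ t)) (fun t _ => ?_)
          (Continuous.intervalIntegrable (by fun_prop) _ _)]
        · simp [hpi]
        · refine (((((hasDerivAt_id t).const_sub Real.pi).mul (h2 t)).add (h1 t)).const_mul
            (θ / 2)).congr_deriv ?_
          simp
      rw [i1, i2]
      ring
    rw [split] at key
    have := key.mul_left (-(2 / Real.pi))
    convert! this using 1
    · funext n
      rw [sineCoeff_by_parts h1 h2 hc, h0, hpi]
      unfold sineCoeff
      rw [← intervalIntegral.integral_const_mul, ← intervalIntegral.integral_const_mul]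
      simp only [mul_zero, sub_zero, zero_sub]
      rw [← neg_div, ← intervalIntegral.integral_neg, ← intervalIntegral.integral_div,
        ← intervalIntegral.integral_mul_const]
      congr 1
      funext t
      ring
    · field_simp
  · rw [uIoc_of_le hπ.le] at ht
    have hb := hB t (Ioc_subset_Icc_self ht)
    rw [norm_mul]
    gcongr
    rw [norm_div, norm_mul, Real.norm_eq_abs, Real.norm_eq_abs, Real.norm_eq_abs,
      abs_of_pos (by positivity : (0 : ℝ) < ((n : ℝ) + 1) ^ 2)]
    gcongr
    exact mul_le_one₀ (Real.abs_sin_le_one _) (abs_nonneg _) (Real.abs_sin_le_one _)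
  · rw [uIoc_of_le hπ.le] at ht
    exact (hasSum_sin_mul_sin_div_sq hθ (Ioc_subset_Icc_self ht)).mul_left _

/-! ### Series of separated modes -/

/-- Elliptic regularity for single modes, uniform in `k`: away from the endpoints, a residual
`O(k⁻ᵖ)` and merely bounded end values give a gain of two powers for `f` and one for `f'`. The
comparison bound controls `f`, the equation then controls `f''`, and interpolation controls `f'`. -/
theorem mode_bounds (p : ℕ) {d A B : ℝ} (hd : 0 < d) (hA : 0 ≤ A) (hB : 0 ≤ B) :
    ∃ K, 0 ≤ K ∧ ∀ k : ℝ, 1 ≤ k → ∀ (α β : ℝ) (f f1 f2 : ℝ → ℝ),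
      (∀ x ∈ Icc α β, HasDerivAt f (f1 x) x) → (∀ x ∈ Icc α β, HasDerivAt f1 (f2 x) x) →
      (∀ x ∈ Icc α β, |f2 x - k ^ 2 * f x| ≤ B / k ^ p) → |f α| ≤ A → |f β| ≤ A →
      ∀ x, α + d ≤ x → x + 1 + d ≤ β →
        |f x| ≤ K / k ^ (p + 2) ∧ |f1 x| ≤ K / k ^ (p + 1) ∧ |f2 x| ≤ K / k ^ p := by
  set K1 : ℝ := B + 2 * A * ((p + 2).factorial / d ^ (p + 2)) with hK1
  have hK10 : 0 ≤ K1 := by positivity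
  refine ⟨3 * K1 + B, by positivity, ?_⟩
  intro k hk α β f f1 f2 hf hf1 hres hα hβ x hxα hxβ
  have hk0 : 0 < k := by linarith
  -- One term of the exponential series, `(k d)^(p+2) / (p+2)! ≤ exp (k d)`, turns the endpoint
  -- contributions into the required power of `k`.
  have hexp : ∀ r, d ≤ r → Real.exp (-(k * r)) ≤ (p + 2).factorial / d ^ (p + 2) / k ^ (p + 2) := by
    intro r hr
    have h1 := Real.pow_div_factorial_le_exp (k * d) (by positivity) (p + 2)
    have h2 : Real.exp (-(k * r)) ≤ (Real.exp (k * d))⁻¹ := by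
      rw [← Real.exp_neg]; gcongr
    refine h2.trans ((inv_anti₀ (by positivity) h1).trans (le_of_eq ?_))
    rw [inv_div, mul_pow]
    field_simp
  have b0 : ∀ y, α + d ≤ y → y + d ≤ β → |f y| ≤ K1 / k ^ (p + 2) := by
    intro y hy1 hy2
    have h1 := abs_le_of_second_order hk0 hA (by positivity : 0 ≤ B / k ^ p)
      (fun z hz => (hf z hz).continuousAt.continuousWithinAt)
      (fun z hz => hf z (Ioo_subset_Icc_self hz)) (fun z hz => hf1 z (Ioo_subset_Icc_self hz))
      (fun z hz => hres z (Ioo_subset_Icc_self hz)) hα hβ (x := y)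
      ⟨by linarith, by linarith⟩
    refine h1.trans ?_
    calc _ ≤ B / k ^ p / k ^ 2 + A * ((p + 2).factorial / d ^ (p + 2) / k ^ (p + 2) +
          (p + 2).factorial / d ^ (p + 2) / k ^ (p + 2)) := by
          gcongr
          · exact hexp _ (by linarith)
          · exact hexp _ (by linarith)
      _ = _ := by rw [hK1, div_div, ← pow_add]; ring
  have b2 : ∀ y, α + d ≤ y → y + d ≤ β → |f2 y| ≤ (K1 + B) / k ^ p := by
    intro y hy1 hy2
    have h1 := hres y ⟨by linarith, by linarith⟩
    have h2 : |k ^ 2 * f y| ≤ K1 / k ^ p := by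
      rw [abs_mul, abs_of_pos (by positivity)]
      calc _ ≤ k ^ 2 * (K1 / k ^ (p + 2)) := by gcongr; exact b0 y hy1 hy2
        _ = _ := by rw [pow_add]; field_simp
    have h3 := abs_add_le (f2 y - k ^ 2 * f y) (k ^ 2 * f y)
    rw [sub_add_cancel] at h3
    rw [add_div]
    linarith
  have hk1 : 1 / k ≤ 1 := (div_le_one hk0).2 hk
  have b1 : |f1 x| ≤ (3 * K1 + B) / k ^ (p + 1) := by
    -- The step `1 / k` balances the bounds on `f` and `f''`; it is at most `1`, hence the extra
    -- unit of room on the right in the hypothesis on `x`.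
    have := abs_deriv_le_of_second_order (x := x) (h := 1 / k) (by positivity)
      (fun y hy => hf y ⟨by linarith [hy.1], by linarith [hy.2]⟩)
      (fun y hy => hf1 y ⟨by linarith [hy.1], by linarith [hy.2]⟩)
      (fun y hy => b0 y (by linarith [hy.1]) (by linarith [hy.2]))
      (fun y hy => b2 y (by linarith [hy.1]) (by linarith [hy.2]))
    refine this.trans (le_of_eq ?_)
    rw [pow_add, pow_add]
    field_simp
    ring
  refine ⟨(b0 x hxα (by linarith)).trans ?_, b1, (b2 x hxα (by linarith)).trans ?_⟩
  · gcongr; linarith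
  · gcongr; linarith

/-- A common summable majorant of the terms and their partials permits termwise differentiation, and
uniform convergence makes both partials continuous. Applied to a series and again to its partials,
this gives `C²`. -/
theorem hasFDerivAt_productSeries {a a' b b' : ℕ → ℝ → ℝ} {I : Set ℝ} {c : ℕ → ℝ}
    (hI : IsOpen I) (hI' : IsPreconnected I) (hc : Summable c)
    (ha : ∀ n, ∀ u ∈ I, HasDerivAt (a n) (a' n u) u) (hb : ∀ n t, HasDerivAt (b n) (b' n t) t)
    (ha' : ∀ n, ContinuousOn (a' n) I) (hb' : ∀ n, Continuous (b' n))
    (h0 : ∀ n, ∀ u ∈ I, ∀ t, |a n u * b n t| ≤ c n)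
    (h1 : ∀ n, ∀ u ∈ I, ∀ t, |a' n u * b n t| ≤ c n)
    (h2 : ∀ n, ∀ u ∈ I, ∀ t, |a n u * b' n t| ≤ c n) :
    (∀ p ∈ I ×ˢ (univ : Set ℝ), HasFDerivAt (fun p : ℝ × ℝ => ∑' n, a n p.1 * b n p.2)
      ((∑' n, a' n p.1 * b n p.2) • ContinuousLinearMap.fst ℝ ℝ ℝ +
        (∑' n, a n p.1 * b' n p.2) • ContinuousLinearMap.snd ℝ ℝ ℝ) p) ∧
    ContinuousOn (fun p : ℝ × ℝ => ∑' n, a' n p.1 * b n p.2) (I ×ˢ univ) ∧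
    ContinuousOn (fun p : ℝ × ℝ => ∑' n, a n p.1 * b' n p.2) (I ×ˢ univ) := by
  have hac : ∀ n, ContinuousOn (a n) I := fun n u hu => (ha n u hu).continuousAt.continuousWithinAt
  have hbc : ∀ n, Continuous (b n) := fun n =>
    continuous_iff_continuousAt.2 fun t => (hb n t).continuousAt
  have prodc : ∀ {x y : ℝ → ℝ}, ContinuousOn x I → Continuous y →
      ContinuousOn (fun p : ℝ × ℝ => x p.1 * y p.2) (I ×ˢ univ) := fun hx hy =>
    (hx.comp continuousOn_fst fun p hp => hp.1).mul (hy.comp continuous_snd).continuousOn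
  refine ⟨fun p hp => ?_, continuousOn_tsum (fun n => prodc (ha' n) (hbc n)) hc
    fun n q hq => h1 n _ hq.1 _, continuousOn_tsum (fun n => prodc (hac n) (hb' n)) hc
    fun n q hq => h2 n _ hq.1 _⟩
  have s1 : Summable fun n => a' n p.1 * b n p.2 :=
    Summable.of_norm_bounded hc fun n => h1 n _ hp.1 _
  have s2 : Summable fun n => a n p.1 * b' n p.2 :=
    Summable.of_norm_bounded hc fun n => h2 n _ hp.1 _
  have key := hasFDerivAt_tsum_of_isPreconnected (𝕜 := ℝ) (hc.mul_left 2) (hI.prod isOpen_univ)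
    (hI'.prod isPreconnected_univ) (f := fun n (p : ℝ × ℝ) => a n p.1 * b n p.2)
    (f' := fun n p => (a' n p.1 * b n p.2) • ContinuousLinearMap.fst ℝ ℝ ℝ +
        (a n p.1 * b' n p.2) • ContinuousLinearMap.snd ℝ ℝ ℝ) (x₀ := p) (x := p)
    (fun n q hq => ?_) (fun n q hq => ?_) hp
    (Summable.of_norm_bounded hc fun n => h0 n _ hp.1 _) hp
  · rwa [Summable.tsum_add (s1.smul_const _) (s2.smul_const _), s1.tsum_smul_const,
      s2.tsum_smul_const] at key
  · have d1 := (ha n q.1 hq.1).comp_hasFDerivAt q (hasFDerivAt_fst (𝕜 := ℝ) (p := q))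
    have d2 := (hb n q.2).comp_hasFDerivAt q (hasFDerivAt_snd (𝕜 := ℝ) (p := q))
    refine (d1.mul d2).congr_fderiv ?_
    ext
    · simp; ring
    · simp
  · refine (norm_add_le _ _).trans ?_
    rw [norm_smul, norm_smul, two_mul]
    refine add_le_add ?_ ?_
    · calc _ ≤ c n * 1 := mul_le_mul (h1 n _ hq.1 _) (ContinuousLinearMap.norm_fst_le ℝ ℝ ℝ)
            (norm_nonneg _) ((abs_nonneg _).trans (h1 n _ hq.1 q.2))
        _ = _ := mul_one _
    · calc _ ≤ c n * 1 := mul_le_mul (h2 n _ hq.1 _) (ContinuousLinearMap.norm_snd_le ℝ ℝ ℝ)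
            (norm_nonneg _) ((abs_nonneg _).trans (h2 n _ hq.1 q.2))
        _ = _ := mul_one _

theorem contDiffOn_succ_of_partials {F A B : ℝ × ℝ → ℝ} {s : Set (ℝ × ℝ)} {k : ℕ}
    (hs : IsOpen s)
    (hF : ∀ p ∈ s, HasFDerivAt F (A p • ContinuousLinearMap.fst ℝ ℝ ℝ +
      B p • ContinuousLinearMap.snd ℝ ℝ ℝ) p)
    (hA : ContDiffOn ℝ k A s) (hB : ContDiffOn ℝ k B s) : ContDiffOn ℝ (k + 1) F s := by
  rw [contDiffOn_succ_iff_fderiv_of_isOpen hs]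
  refine ⟨fun p hp => (hF p hp).differentiableAt.differentiableWithinAt, by simp, ?_⟩
  refine ContDiffOn.congr ?_ fun p hp => (hF p hp).fderiv
  exact (hA.smul contDiffOn_const).add (hB.smul contDiffOn_const)

theorem contDiffOn_one_of_partials {F A B : ℝ × ℝ → ℝ} {s : Set (ℝ × ℝ)} (hs : IsOpen s)
    (hF : ∀ p ∈ s, HasFDerivAt F (A p • ContinuousLinearMap.fst ℝ ℝ ℝ +
      B p • ContinuousLinearMap.snd ℝ ℝ ℝ) p)
    (hA : ContinuousOn A s) (hB : ContinuousOn B s) : ContDiffOn ℝ 1 F s := by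
  have := contDiffOn_succ_of_partials (k := 0) hs hF
    (by simpa only [Nat.cast_zero, contDiffOn_zero] using hA)
    (by simpa only [Nat.cast_zero, contDiffOn_zero] using hB)
  simpa only [Nat.cast_zero, zero_add] using this

theorem hasDerivAt_fst_of_partials {F : ℝ × ℝ → ℝ} {A B : ℝ} {p : ℝ × ℝ}
    (h : HasFDerivAt F (A • ContinuousLinearMap.fst ℝ ℝ ℝ +
      B • ContinuousLinearMap.snd ℝ ℝ ℝ) p) : HasDerivAt (fun u => F (u, p.2)) A p.1 := by
  have := h.comp_hasDerivAt p.1 ((hasDerivAt_id p.1).prodMk (hasDerivAt_const p.1 p.2))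
  simpa [Function.comp_def] using this

theorem hasDerivAt_snd_of_partials {F : ℝ × ℝ → ℝ} {A B : ℝ} {p : ℝ × ℝ}
    (h : HasFDerivAt F (A • ContinuousLinearMap.fst ℝ ℝ ℝ +
      B • ContinuousLinearMap.snd ℝ ℝ ℝ) p) : HasDerivAt (fun t => F (p.1, t)) B p.2 := by
  have := h.comp_hasDerivAt p.2 ((hasDerivAt_const p.2 p.1).prodMk (hasDerivAt_id p.2))
  simpa [Function.comp_def] using this

/-! ### Linear data and their primitives -/

/-- The affine function on `[0, π]` with boundary values `A`, `B`. -/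
noncomputable def affineData (A B t : ℝ) : ℝ := A * (1 - t / Real.pi) + B * (t / Real.pi)

/-- The solution of `φ'' = affineData A B` vanishing at `0` and `π`. -/
noncomputable def cubicData (A B t : ℝ) : ℝ :=
  A * (t ^ 2 / 2 - t ^ 3 / (6 * Real.pi) - Real.pi / 3 * t) +
    B * (t ^ 3 / (6 * Real.pi) - Real.pi / 6 * t)

/-- The derivative of `cubicData A B`. -/
noncomputable def cubicDataDeriv (A B t : ℝ) : ℝ :=
  A * (t - t ^ 2 / (2 * Real.pi) - Real.pi / 3) + B * (t ^ 2 / (2 * Real.pi) - Real.pi / 6)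

/-- The sine coefficients of `affineData A B`. -/
noncomputable def affineCoeff (A B : ℝ) (n : ℕ) : ℝ :=
  2 / (Real.pi * (n + 1)) * (A - Real.cos ((n + 1) * Real.pi) * B)

theorem hasDerivAt_affineData (A B t : ℝ) :
    HasDerivAt (affineData A B) ((B - A) / Real.pi) t := by
  have h := (hasDerivAt_id t).div_const Real.pi
  refine (((h.const_sub 1).const_mul A).add (h.const_mul B)).congr_deriv ?_
  ring

theorem hasDerivAt_cubicData (A B t : ℝ) :
    HasDerivAt (cubicData A B) (cubicDataDeriv A B t) t := by
  have h1 := hasDerivAt_id t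
  have h2 := (hasDerivAt_pow 2 t).div_const 2
  have h3 := (hasDerivAt_pow 3 t).div_const (6 * Real.pi)
  have hpi := Real.pi_ne_zero
  refine ((((h2.sub h3).sub (h1.const_mul (Real.pi / 3))).const_mul A).add
    ((h3.sub (h1.const_mul (Real.pi / 6))).const_mul B)).congr_deriv ?_
  unfold cubicDataDeriv
  norm_num
  field_simp
  ring

theorem hasDerivAt_cubicDataDeriv (A B t : ℝ) :
    HasDerivAt (cubicDataDeriv A B) (affineData A B t) t := by
  have h1 := hasDerivAt_id t
  have h2 := (hasDerivAt_pow 2 t).div_const (2 * Real.pi)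
  have hpi := Real.pi_ne_zero
  refine ((((h1.sub h2).sub_const (Real.pi / 3)).const_mul A).add
    ((h2.sub_const (Real.pi / 6)).const_mul B)).congr_deriv ?_
  unfold affineData
  norm_num
  field_simp

theorem continuous_affineData (A B : ℝ) : Continuous (affineData A B) :=
  continuous_iff_continuousAt.2 fun t => (hasDerivAt_affineData A B t).continuousAt

theorem affineData_zero (A B : ℝ) : affineData A B 0 = A := by simp [affineData]

theorem affineData_pi (A B : ℝ) : affineData A B Real.pi = B := by
  simp [affineData, Real.pi_ne_zero]

theorem cubicData_zero (A B : ℝ) : cubicData A B 0 = 0 := by simp [cubicData]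

theorem cubicData_pi (A B : ℝ) : cubicData A B Real.pi = 0 := by
  have := Real.pi_ne_zero
  unfold cubicData
  field_simp
  ring

theorem sineCoeff_affineData (A B : ℝ) (n : ℕ) :
    sineCoeff (affineData A B) n = affineCoeff A B n := by
  rw [sineCoeff_by_parts (hasDerivAt_affineData A B) (fun t => hasDerivAt_const t _)
    continuous_const, affineData_zero, affineData_pi]
  simp [sineCoeff, affineCoeff]

theorem sineCoeff_cubicData (A B : ℝ) (n : ℕ) :
    sineCoeff (cubicData A B) n = -(affineCoeff A B n / (n + 1) ^ 2) := by
  rw [sineCoeff_by_parts (hasDerivAt_cubicData A B) (hasDerivAt_cubicDataDeriv A B)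
    (continuous_affineData A B), cubicData_zero, cubicData_pi, sineCoeff_affineData]
  ring

/-- Sums in closed form the part of a mode series that decays only like `n⁻³`, whose second
`θ`-derivative cannot be controlled by absolute convergence. -/
theorem hasSum_cubicData (A B : ℝ) {θ : ℝ} (hθ : θ ∈ Icc 0 Real.pi) :
    HasSum (fun n : ℕ => -(affineCoeff A B n / (n + 1) ^ 2) * Real.sin ((n + 1) * θ))
      (cubicData A B θ) := by
  have := hasSum_sineCoeff (hasDerivAt_cubicData A B) (hasDerivAt_cubicDataDeriv A B)
    (continuous_affineData A B) (cubicData_zero A B) (cubicData_pi A B) hθ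
  simpa only [sineCoeff_cubicData] using this

theorem abs_affineCoeff_le {A B K : ℝ} (hA : |A| ≤ K) (hB : |B| ≤ K) (n : ℕ) :
    |affineCoeff A B n| ≤ 2 * K / (n + 1) := by
  have hpi := Real.pi_gt_three
  have hK : 0 ≤ K := (abs_nonneg A).trans hA
  have hn : (0 : ℝ) < n + 1 := by positivity
  have h1 : |A - Real.cos ((n + 1) * Real.pi) * B| ≤ 2 * K := by
    have h2 : |Real.cos ((n + 1) * Real.pi) * B| ≤ 1 * K := by
      rw [abs_mul]
      exact mul_le_mul (Real.abs_cos_le_one _) hB (abs_nonneg _) zero_le_one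
    have := abs_sub A (Real.cos ((n + 1) * Real.pi) * B)
    linarith
  rw [affineCoeff, abs_mul, abs_of_pos (by positivity)]
  calc _ ≤ 2 / (Real.pi * (n + 1)) * (2 * K) := by gcongr
    _ ≤ 1 / (n + 1) * (2 * K) := by
        gcongr ?_ * _
        rw [div_le_div_iff₀ (by positivity) hn]
        nlinarith
    _ = _ := by ring

/-! ### The Poisson equation in a half-strip -/

/-- The closed half-plane `u ≥ 0`, in the coordinates `u = log (R / R₊)` and `θ`. -/
def halfPlane : Set (ℝ × ℝ) := Ici 0 ×ˢ univ

theorem uniqueDiffOn_halfPlane : UniqueDiffOn ℝ halfPlane :=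
  (uniqueDiffOn_Ici 0).prod uniqueDiffOn_univ

/-- Lines `u = const` stay in the half-plane, so the derivative within it in the direction `(0, 1)`
is an ordinary two-sided derivative, even at `u = 0`. -/
theorem exists_theta_deriv {H : ℝ × ℝ → ℝ} (hH : ContDiffOn ℝ ∞ H halfPlane) :
    ∃ H1 : ℝ × ℝ → ℝ, ContDiffOn ℝ ∞ H1 halfPlane ∧
      ∀ u t, 0 ≤ u → HasDerivAt (fun t => H (u, t)) (H1 (u, t)) t := by
  refine ⟨fun p => fderivWithin ℝ H halfPlane p (0, 1),
    (hH.fderivWithin uniqueDiffOn_halfPlane (by simp)).clm_apply contDiffOn_const, ?_⟩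
  intro u t hu
  have h1 := ((hH.differentiableOn (by simp)) (u, t) ⟨hu, mem_univ _⟩).hasFDerivWithinAt
  have h2 := h1.comp_hasDerivWithinAt (s := univ) t
    ((hasDerivAt_const t u).prodMk (hasDerivAt_id t)).hasDerivWithinAt
    (fun s _ => ⟨hu, mem_univ _⟩)
  rw [hasDerivWithinAt_univ] at h2
  exact h2

theorem exists_abs_le_of_contDiffOn {H : ℝ × ℝ → ℝ} (hH : ContDiffOn ℝ ∞ H halfPlane) (U : ℝ) :
    ∃ K, 0 ≤ K ∧ ∀ u ∈ Icc 0 U, ∀ t ∈ Icc 0 Real.pi, |H (u, t)| ≤ K := by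
  have hc : ContinuousOn H (Icc 0 U ×ˢ Icc 0 Real.pi) :=
    hH.continuousOn.mono (prod_mono Icc_subset_Ici_self (subset_univ _))
  obtain ⟨K, hK⟩ := (isCompact_Icc.prod isCompact_Icc).exists_bound_of_continuousOn hc
  refine ⟨max K 0, le_max_right _ _, fun u hu t ht => ?_⟩
  exact (hK (u, t) ⟨hu, ht⟩).trans (le_max_left _ _)

/-- The affine interpolant in `θ` carries exactly the boundary terms, so subtracting its
coefficients improves `O(1/n)` to `O(1/n²)`. -/
theorem sineCoeff_sub_affineCoeff {H H1 H2 : ℝ × ℝ → ℝ}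
    (h1 : ∀ u t, 0 ≤ u → HasDerivAt (fun t => H (u, t)) (H1 (u, t)) t)
    (h2 : ∀ u t, 0 ≤ u → HasDerivAt (fun t => H1 (u, t)) (H2 (u, t)) t)
    (hc : ContinuousOn H2 halfPlane) {u : ℝ} (hu : 0 ≤ u) (n : ℕ) :
    sineCoeff (fun t => H (u, t)) n - affineCoeff (H (u, 0)) (H (u, Real.pi)) n =
      -(sineCoeff (fun t => H2 (u, t)) n / (n + 1) ^ 2) := by
  rw [sineCoeff_by_parts (fun t => h1 u t hu) (fun t => h2 u t hu)
    (hc.comp_continuous (by fun_prop) fun t => ⟨hu, mem_univ _⟩)]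
  unfold affineCoeff
  ring

theorem hasSum_sineCoeff_sub_affineCoeff {H H1 H2 : ℝ × ℝ → ℝ}
    (h1 : ∀ u t, 0 ≤ u → HasDerivAt (fun t => H (u, t)) (H1 (u, t)) t)
    (h2 : ∀ u t, 0 ≤ u → HasDerivAt (fun t => H1 (u, t)) (H2 (u, t)) t)
    (hc : ContinuousOn H2 halfPlane) {u θ : ℝ} (hu : 0 ≤ u) (hθ : θ ∈ Icc 0 Real.pi) :
    HasSum (fun n => (sineCoeff (fun t => H (u, t)) n -
        affineCoeff (H (u, 0)) (H (u, Real.pi)) n) * Real.sin ((n + 1) * θ))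
      (H (u, θ) - affineData (H (u, 0)) (H (u, Real.pi)) θ) := by
  have hc' : Continuous fun t => H2 (u, t) :=
    hc.comp_continuous (by fun_prop) fun t => ⟨hu, mem_univ _⟩
  have d1 : ∀ t, HasDerivAt (fun t => H (u, t) - affineData (H (u, 0)) (H (u, Real.pi)) t)
      (H1 (u, t) - (H (u, Real.pi) - H (u, 0)) / Real.pi) t := fun t =>
    (h1 u t hu).sub (hasDerivAt_affineData _ _ t)
  have d2 : ∀ t, HasDerivAt (fun t => H1 (u, t) - (H (u, Real.pi) - H (u, 0)) / Real.pi)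
      (H2 (u, t)) t := fun t => (h2 u t hu).sub_const _
  have e0 : H (u, 0) - affineData (H (u, 0)) (H (u, Real.pi)) 0 = 0 := by
    rw [affineData_zero, sub_self]
  have e1 : H (u, Real.pi) - affineData (H (u, 0)) (H (u, Real.pi)) Real.pi = 0 := by
    rw [affineData_pi, sub_self]
  have key := hasSum_sineCoeff d1 d2 hc' e0 e1 hθ
  refine key.congr_fun fun n => ?_
  rw [sineCoeff_by_parts d1 d2 hc', e0, e1, sineCoeff_sub_affineCoeff h1 h2 hc hu]
  ring

theorem hasDerivAt_affineCoeff {b c b' c' : ℝ → ℝ} {u : ℝ} (hb : HasDerivAt b (b' u) u)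
    (hc : HasDerivAt c (c' u) u) (n : ℕ) :
    HasDerivAt (fun u => affineCoeff (b u) (c u) n) (affineCoeff (b' u) (c' u) n) u :=
  (hb.sub (hc.const_mul _)).const_mul _

theorem hasDerivAt_cubicData_left {b c b' c' : ℝ → ℝ} {u : ℝ} (hb : HasDerivAt b (b' u) u)
    (hc : HasDerivAt c (c' u) u) (θ : ℝ) :
    HasDerivAt (fun u => cubicData (b u) (c u) θ) (cubicData (b' u) (c' u) θ) u :=
  (hb.mul_const _).add (hc.mul_const _)

/-- Near `u₀` the series is split as `∑ f_k sin (k θ) + cubicData`, where the cubic solves `∂_θ² =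
affineData`. The remaining modes have residual `O(k⁻²)`, so `f_k`, `f_k'`, `f_k''` are `O(k⁻⁴)`,
`O(k⁻³)`, `O(k⁻²)`, and all second derivatives converge absolutely. -/
theorem modeSeries_interior {H : ℝ × ℝ → ℝ} {m m1 h : ℕ → ℝ → ℝ} {A u₀ : ℝ}
    (hH : ContDiffOn ℝ ∞ H halfPlane) (hu₀ : 0 < u₀)
    (hm : ∀ n u, 0 < u → HasDerivAt (m n) (m1 n u) u)
    (hm1 : ∀ n u, 0 < u → HasDerivAt (m1 n) (((n : ℝ) + 1) ^ 2 * m n u + h n u) u)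
    (hcont : ∀ n, ContinuousOn (h n) (Ioi 0)) (hA : ∀ n u, |m n u| ≤ A)
    (hres : ∃ K, 0 ≤ K ∧ ∀ n, ∀ u ∈ Icc 0 (u₀ + 3),
      |h n u - affineCoeff (H (u, 0)) (H (u, Real.pi)) n| ≤ K / (n + 1) ^ 2)
    (hsum : ∀ u θ, 0 < u → θ ∈ Icc 0 Real.pi →
      HasSum (fun n => (h n u - affineCoeff (H (u, 0)) (H (u, Real.pi)) n) *
        Real.sin ((n + 1) * θ)) (H (u, θ) - affineData (H (u, 0)) (H (u, Real.pi)) θ)) :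
    ContDiffOn ℝ 2 (fun p : ℝ × ℝ => ∑' n : ℕ, m n p.1 * Real.sin ((n + 1) * p.2))
      (Ioo (u₀ / 2) (u₀ + 1) ×ˢ Ioo 0 Real.pi) ∧
    ∀ u θ, u ∈ Ioo (u₀ / 2) (u₀ + 1) → θ ∈ Ioo 0 Real.pi →
      deriv (deriv fun u => ∑' n : ℕ, m n u * Real.sin ((n + 1) * θ)) u +
        deriv (deriv fun t => ∑' n : ℕ, m n u * Real.sin ((n + 1) * t)) θ = H (u, θ) := by
  have hk1 : ∀ n : ℕ, (1 : ℝ) ≤ n + 1 := fun n => by linarith [(n.cast_nonneg : (0 : ℝ) ≤ n)]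
  have hk0 : ∀ n : ℕ, (0 : ℝ) < n + 1 := fun n => by positivity
  have hA0 : 0 ≤ A := (abs_nonneg _).trans (hA 0 0)
  obtain ⟨K, hK, hK'⟩ := hres
  set b : ℝ → ℝ := fun u => H (u, 0) with hb
  set c : ℝ → ℝ := fun u => H (u, Real.pi) with hc
  have hbs : ContDiffOn ℝ ∞ b (Ioi 0) :=
    (ContDiffOn.slice_left hH (mem_univ 0)).mono Ioi_subset_Ici_self
  have hcs : ContDiffOn ℝ ∞ c (Ioi 0) :=
    (ContDiffOn.slice_left hH (mem_univ Real.pi)).mono Ioi_subset_Ici_self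
  have hb2 := fun u (hu : u ∈ Ioi (0 : ℝ)) => hasDerivAt_of_contDiffOn_two isOpen_Ioi
    (hbs.of_le (by norm_cast)) hu
  have hc2 := fun u (hu : u ∈ Ioi (0 : ℝ)) => hasDerivAt_of_contDiffOn_two isOpen_Ioi
    (hcs.of_le (by norm_cast)) hu
  have hdd : ∀ {x : ℝ → ℝ}, ContDiffOn ℝ ∞ x (Ioi 0) → ContinuousOn (deriv (deriv x)) (Ioi 0) :=
    fun hx => ((hx.deriv_of_isOpen isOpen_Ioi (m := ∞) (by simp)).deriv_of_isOpen isOpen_Ioi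
      (m := ∞) (by simp)).continuousOn
  have hpos : ∀ x ∈ Icc (u₀ / 4) (u₀ + 3), 0 < x := fun x hx => by linarith [hx.1]
  have hbd : ∀ {x : ℝ → ℝ}, ContinuousOn x (Ioi 0) →
      ∃ L, ∀ u ∈ Icc (u₀ / 4) (u₀ + 3), |x u| ≤ L := fun hx =>
    isCompact_Icc.exists_bound_of_continuousOn (hx.mono hpos)
  obtain ⟨L1, hL1⟩ := hbd hbs.continuousOn
  obtain ⟨L2, hL2⟩ := hbd hcs.continuousOn
  obtain ⟨L3, hL3⟩ := hbd (hdd hbs)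
  obtain ⟨L4, hL4⟩ := hbd (hdd hcs)
  obtain ⟨L, hL0, hLb, hLc, hLb2, hLc2⟩ : ∃ L, 0 ≤ L ∧
      (∀ u ∈ Icc (u₀ / 4) (u₀ + 3), |b u| ≤ L) ∧ (∀ u ∈ Icc (u₀ / 4) (u₀ + 3), |c u| ≤ L) ∧
      (∀ u ∈ Icc (u₀ / 4) (u₀ + 3), |deriv (deriv b) u| ≤ L) ∧
      ∀ u ∈ Icc (u₀ / 4) (u₀ + 3), |deriv (deriv c) u| ≤ L := by
    have hu : u₀ ∈ Icc (u₀ / 4) (u₀ + 3) := ⟨by linarith, by linarith⟩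
    have p1 := (abs_nonneg _).trans (hL1 _ hu)
    have p2 := (abs_nonneg _).trans (hL2 _ hu)
    have p3 := (abs_nonneg _).trans (hL3 _ hu)
    have p4 := (abs_nonneg _).trans (hL4 _ hu)
    exact ⟨L1 + L2 + L3 + L4, by positivity, fun u hu => by linarith [hL1 u hu],
      fun u hu => by linarith [hL2 u hu], fun u hu => by linarith [hL3 u hu],
      fun u hu => by linarith [hL4 u hu]⟩
  -- To leading order `m ≈ -h / k²`. The added term cancels the contribution of the boundary values
  -- `b`, `c` of `H`, at the cost of a residual containing `b''`, `c''` over `k²`.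
  set f : ℕ → ℝ → ℝ := fun n u => m n u + affineCoeff (b u) (c u) n / (n + 1) ^ 2 with hf
  set f1 : ℕ → ℝ → ℝ := fun n u =>
    m1 n u + affineCoeff (deriv b u) (deriv c u) n / (n + 1) ^ 2 with hf1
  set f2 : ℕ → ℝ → ℝ := fun n u => ((n + 1) ^ 2 * m n u + h n u) +
    affineCoeff (deriv (deriv b) u) (deriv (deriv c) u) n / (n + 1) ^ 2 with hf2
  have hfd : ∀ n u, 0 < u → HasDerivAt (f n) (f1 n u) u := fun n u hu =>
    (hm n u hu).add ((hasDerivAt_affineCoeff (hb2 u hu).1 (hc2 u hu).1 n).div_const _)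
  have hf1d : ∀ n u, 0 < u → HasDerivAt (f1 n) (f2 n u) u := fun n u hu =>
    (hm1 n u hu).add ((hasDerivAt_affineCoeff (hb2 u hu).2 (hc2 u hu).2 n).div_const _)
  have hf2c : ∀ n, ContinuousOn (f2 n) (Ioi 0) := by
    intro n
    refine ContinuousOn.add (ContinuousOn.add (continuousOn_const.mul fun u hu =>
      (hm n u hu).continuousAt.continuousWithinAt) (hcont n)) (ContinuousOn.div_const ?_ _)
    exact continuousOn_const.mul ((hdd hbs).sub (continuousOn_const.mul (hdd hcs)))
  have hfres : ∀ n u, f2 n u - (n + 1) ^ 2 * f n u = (h n u - affineCoeff (b u) (c u) n) +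
      affineCoeff (deriv (deriv b) u) (deriv (deriv c) u) n / (n + 1) ^ 2 := by
    intro n u
    have := hk0 n
    simp only [hf, hf2]
    field_simp
    ring
  have hsmall : ∀ {x : ℝ} (n : ℕ), |x| ≤ 2 * L / (n + 1) →
      |x / ((n : ℝ) + 1) ^ 2| ≤ 2 * L / (n + 1) ^ 2 := by
    intro x n hx
    have hn := hk0 n
    rw [abs_div, abs_of_pos (by positivity : (0 : ℝ) < ((n : ℝ) + 1) ^ 2)]
    gcongr
    exact hx.trans (div_le_self (by positivity) (hk1 n))
  obtain ⟨B, hB, hB'⟩ := mode_bounds 2 (d := min (u₀ / 4) 1) (A := A + 2 * L) (B := K + 2 * L)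
    (by positivity) (by positivity) (by positivity)
  have hfA : ∀ n, ∀ u ∈ Icc (u₀ / 4) (u₀ + 3), |f n u| ≤ A + 2 * L := by
    intro n u hu
    refine (abs_add_le _ _).trans (add_le_add (hA n u) ((hsmall n (abs_affineCoeff_le
      (hLb u hu) (hLc u hu) n)).trans ?_))
    exact div_le_self (by positivity) (one_le_pow₀ (hk1 n))
  have hbounds : ∀ n, ∀ u ∈ Ioo (u₀ / 2) (u₀ + 1),
      |f n u| ≤ B / (n + 1) ^ 4 ∧ |f1 n u| ≤ B / (n + 1) ^ 3 ∧ |f2 n u| ≤ B / (n + 1) ^ 2 := by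
    intro n u hu
    -- The window `(u₀/2, u₀+1)` has margin `u₀/4` on the left and `2` on the right, as the interior
    -- estimate with `d = min (u₀/4) 1` requires.
    refine hB' (n + 1) (hk1 n) (u₀ / 4) (u₀ + 3) (f n) (f1 n) (f2 n)
      (fun x hx => hfd n x (hpos x hx)) (fun x hx => hf1d n x (hpos x hx)) (fun x hx => ?_)
      (hfA n _ ⟨le_rfl, by linarith⟩) (hfA n _ ⟨by linarith, le_rfl⟩) u
      (by linarith [hu.1, min_le_left (u₀ / 4) 1]) (by linarith [hu.2, min_le_right (u₀ / 4) 1])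
    rw [hfres, add_div]
    exact (abs_add_le _ _).trans (add_le_add (hK' n x ⟨(hpos x hx).le, hx.2⟩)
      (hsmall n (abs_affineCoeff_le (hLb2 x hx) (hLc2 x hx) n)))
  -- the three series for the first and second derivatives
  set I := Ioo (u₀ / 2) (u₀ + 1) with hI
  have hI0 : ∀ u ∈ I, 0 < u := fun u hu => by linarith [hu.1]
  have habs : ∀ {x y α β : ℝ}, |x| ≤ α → |y| ≤ β → |x * y| ≤ α * β := fun hx hy => by
    rw [abs_mul]
    exact mul_le_mul hx hy (abs_nonneg _) ((abs_nonneg _).trans hx)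
  have hs0 : ∀ (n : ℕ) (t : ℝ), |Real.sin (((n : ℝ) + 1) * t)| ≤ 1 := fun n t =>
    Real.abs_sin_le_one _
  have hs1 : ∀ (n : ℕ) (t : ℝ), |((n : ℝ) + 1) * Real.cos (((n : ℝ) + 1) * t)| ≤ n + 1 :=
    fun n t => by
      simpa using habs (abs_of_pos (hk0 n)).le (Real.abs_cos_le_one (((n : ℝ) + 1) * t))
  have hs2 : ∀ (n : ℕ) (t : ℝ),
      |((n : ℝ) + 1) * (-(n + 1) * Real.sin (((n : ℝ) + 1) * t))| ≤ (n + 1) * (n + 1) :=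
    fun n t => by
      have h0 := hk0 n
      rw [← mul_assoc, abs_mul, mul_neg, abs_neg,
        abs_of_pos (by positivity : (0 : ℝ) < ((n : ℝ) + 1) * (n + 1))]
      exact mul_le_of_le_one_right (by positivity) (hs0 n t)
  have hpow : ∀ (n : ℕ) (i j : ℕ), i ≤ j → B / ((n : ℝ) + 1) ^ j ≤ B / (n + 1) ^ i :=
    fun n i j hij => by
      have := hk0 n
      gcongr
      exact hk1 n
  have c0 : ∀ n, ContinuousOn (f1 n) I := fun n u hu =>
    (hf1d n u (hI0 u hu)).continuousAt.continuousWithinAt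
  have S0 := hasFDerivAt_productSeries (a := f) (a' := f1)
    (b := fun n t => Real.sin ((n + 1) * t)) (b' := fun n t => (n + 1) * Real.cos ((n + 1) * t))
    (I := I) (c := fun n => B * (1 / ((n : ℝ) + 1) ^ 2)) isOpen_Ioo isPreconnected_Ioo
    (summable_one_div_succ_sq.mul_left B)
    (fun n u hu => hfd n u (hI0 u hu)) (fun n t => hasDerivAt_sin_mul _ t) c0
    (fun n => by fun_prop)
    (fun n u hu t => by
      have := (habs (hbounds n u hu).1 (hs0 n t)).trans_eq (mul_one _)
      simpa only [mul_one_div, Real.norm_eq_abs] using this.trans (hpow n 2 4 (by norm_num)))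
    (fun n u hu t => by
      have := (habs (hbounds n u hu).2.1 (hs0 n t)).trans_eq (mul_one _)
      simpa only [mul_one_div, Real.norm_eq_abs] using this.trans (hpow n 2 3 (by norm_num)))
    (fun n u hu t => by
      have h0 := hk0 n
      have := (habs (hbounds n u hu).1 (hs1 n t)).trans_eq
        (show _ = B / ((n : ℝ) + 1) ^ 3 by field_simp)
      simpa only [mul_one_div, Real.norm_eq_abs] using this.trans (hpow n 2 3 (by norm_num)))
  have S1 := hasFDerivAt_productSeries (a := f1) (a' := f2)
    (b := fun n t => Real.sin ((n + 1) * t)) (b' := fun n t => (n + 1) * Real.cos ((n + 1) * t))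
    (I := I) (c := fun n => B * (1 / ((n : ℝ) + 1) ^ 2)) isOpen_Ioo isPreconnected_Ioo
    (summable_one_div_succ_sq.mul_left B)
    (fun n u hu => hf1d n u (hI0 u hu)) (fun n t => hasDerivAt_sin_mul _ t)
    (fun n => (hf2c n).mono hI0) (fun n => by fun_prop)
    (fun n u hu t => by
      have := (habs (hbounds n u hu).2.1 (hs0 n t)).trans_eq (mul_one _)
      simpa only [mul_one_div, Real.norm_eq_abs] using this.trans (hpow n 2 3 (by norm_num)))
    (fun n u hu t => by
      have := (habs (hbounds n u hu).2.2 (hs0 n t)).trans_eq (mul_one _)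
      simpa only [mul_one_div, Real.norm_eq_abs] using this)
    (fun n u hu t => by
      have h0 := hk0 n
      have := (habs (hbounds n u hu).2.1 (hs1 n t)).trans_eq
        (show _ = B / ((n : ℝ) + 1) ^ 2 by field_simp)
      simpa only [mul_one_div, Real.norm_eq_abs] using this)
  have S2 := hasFDerivAt_productSeries (a := f) (a' := f1)
    (b := fun n t => (n + 1) * Real.cos ((n + 1) * t))
    (b' := fun n t => (n + 1) * (-(n + 1) * Real.sin ((n + 1) * t)))
    (I := I) (c := fun n => B * (1 / ((n : ℝ) + 1) ^ 2)) isOpen_Ioo isPreconnected_Ioo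
    (summable_one_div_succ_sq.mul_left B)
    (fun n u hu => hfd n u (hI0 u hu)) (fun n t => (hasDerivAt_cos_mul _ t).const_mul _) c0
    (fun n => by fun_prop)
    (fun n u hu t => by
      have h0 := hk0 n
      have := (habs (hbounds n u hu).1 (hs1 n t)).trans_eq
        (show _ = B / ((n : ℝ) + 1) ^ 3 by field_simp)
      simpa only [mul_one_div, Real.norm_eq_abs] using this.trans (hpow n 2 3 (by norm_num)))
    (fun n u hu t => by
      have h0 := hk0 n
      have := (habs (hbounds n u hu).2.1 (hs1 n t)).trans_eq
        (show _ = B / ((n : ℝ) + 1) ^ 2 by field_simp)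
      simpa only [mul_one_div, Real.norm_eq_abs] using this)
    (fun n u hu t => by
      have h0 := hk0 n
      have := (habs (hbounds n u hu).1 (hs2 n t)).trans_eq
        (show _ = B / ((n : ℝ) + 1) ^ 2 by field_simp)
      simpa only [mul_one_div, Real.norm_eq_abs] using this)
  have hsplit : ∀ u ∈ I, ∀ θ ∈ Icc 0 Real.pi, ∑' n : ℕ, m n u * Real.sin ((n + 1) * θ) =
      ∑' n : ℕ, f n u * Real.sin ((n + 1) * θ) + cubicData (b u) (c u) θ := by
    intro u hu θ hθ
    have s1 : Summable fun n : ℕ => f n u * Real.sin ((n + 1) * θ) := by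
      refine Summable.of_norm_bounded (summable_one_div_succ_sq.mul_left B) fun n => ?_
      have := (habs (hbounds n u hu).1 (hs0 n θ)).trans_eq (mul_one _)
      simpa only [mul_one_div, Real.norm_eq_abs] using this.trans (hpow n 2 4 (by norm_num))
    rw [← (hasSum_cubicData (b u) (c u) hθ).tsum_eq,
      ← s1.tsum_add (hasSum_cubicData (b u) (c u) hθ).summable]
    refine tsum_congr fun n => ?_
    simp only [hf]
    ring
  have hopen : IsOpen (I ×ˢ (univ : Set ℝ)) := isOpen_Ioo.prod isOpen_univ
  refine ⟨?_, ?_⟩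
  · have k1 := contDiffOn_one_of_partials hopen S1.1 S1.2.1 S1.2.2
    have k2 := contDiffOn_one_of_partials hopen S2.1 S2.2.1 S2.2.2
    have k3 := contDiffOn_succ_of_partials (k := 1) hopen S0.1 (by exact_mod_cast k1)
      (by exact_mod_cast k2)
    have k4 : ContDiffOn ℝ 2 (fun p : ℝ × ℝ => ∑' n : ℕ, f n p.1 * Real.sin ((n + 1) * p.2))
        (I ×ˢ univ) := k3.of_le (by norm_num)
    have k5 : ContDiffOn ℝ 2 (fun p : ℝ × ℝ => cubicData (b p.1) (c p.1) p.2) (I ×ˢ univ) := by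
      have hfst : ∀ {x : ℝ → ℝ}, ContDiffOn ℝ ∞ x (Ioi 0) →
          ContDiffOn ℝ 2 (fun p : ℝ × ℝ => x p.1) (I ×ˢ (univ : Set ℝ)) := fun hx =>
        (hx.of_le (by norm_cast)).comp contDiff_fst.contDiffOn
          fun p hp => hI0 _ hp.1
      unfold cubicData
      exact ((hfst hbs).mul (ContDiff.contDiffOn (by fun_prop))).add
        ((hfst hcs).mul (ContDiff.contDiffOn (by fun_prop)))
    refine ((k4.add k5).mono (prod_mono_right (subset_univ (Ioo 0 Real.pi)))).congr ?_
    intro p hp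
    exact hsplit p.1 hp.1 p.2 (Ioo_subset_Icc_self hp.2)
  · intro u θ hu hθ
    have hIn : I ∈ 𝓝 u := isOpen_Ioo.mem_nhds hu
    have hJn : Ioo 0 Real.pi ∈ 𝓝 θ := isOpen_Ioo.mem_nhds hθ
    have e1 : deriv (deriv fun u => ∑' n : ℕ, m n u * Real.sin ((n + 1) * θ)) u =
        ∑' n : ℕ, f2 n u * Real.sin ((n + 1) * θ) +
          cubicData (deriv (deriv b) u) (deriv (deriv c) u) θ := by
      refine (HasDerivAt.congr_of_eventuallyEq
        ((hasDerivAt_fst_of_partials (S1.1 (u, θ) ⟨hu, mem_univ _⟩)).add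
          (hasDerivAt_cubicData_left (hb2 u (hI0 u hu)).2 (hc2 u (hI0 u hu)).2 θ)) ?_).deriv
      filter_upwards [hIn] with x hx
      refine (HasDerivAt.congr_of_eventuallyEq
        ((hasDerivAt_fst_of_partials (S0.1 (x, θ) ⟨hx, mem_univ _⟩)).add
          (hasDerivAt_cubicData_left (hb2 x (hI0 x hx)).1 (hc2 x (hI0 x hx)).1 θ)) ?_).deriv
      filter_upwards [isOpen_Ioo.mem_nhds hx] with y hy
      exact hsplit y hy θ (Ioo_subset_Icc_self hθ)
    have e2 : deriv (deriv fun t => ∑' n : ℕ, m n u * Real.sin ((n + 1) * t)) θ =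
        ∑' n : ℕ, f n u * ((n + 1) * (-(n + 1) * Real.sin ((n + 1) * θ))) +
          affineData (b u) (c u) θ := by
      refine (HasDerivAt.congr_of_eventuallyEq
        ((hasDerivAt_snd_of_partials (S2.1 (u, θ) ⟨hu, mem_univ _⟩)).add
          (hasDerivAt_cubicDataDeriv (b u) (c u) θ)) ?_).deriv
      filter_upwards [hJn] with x hx
      refine (HasDerivAt.congr_of_eventuallyEq
        ((hasDerivAt_snd_of_partials (S0.1 (u, x) ⟨hu, mem_univ _⟩)).add
          (hasDerivAt_cubicData (b u) (c u) x)) ?_).deriv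
      filter_upwards [isOpen_Ioo.mem_nhds hx] with y hy
      exact hsplit u hu y (Ioo_subset_Icc_self hy)
    have s1 : Summable fun n : ℕ => f2 n u * Real.sin ((n + 1) * θ) := by
      refine Summable.of_norm_bounded (summable_one_div_succ_sq.mul_left B) fun n => ?_
      have := (habs (hbounds n u hu).2.2 (hs0 n θ)).trans_eq (mul_one _)
      simpa only [mul_one_div, Real.norm_eq_abs] using this
    have s2 : Summable fun n : ℕ =>
        f n u * ((n + 1) * (-(n + 1) * Real.sin ((n + 1) * θ))) := by
      refine Summable.of_norm_bounded (summable_one_div_succ_sq.mul_left B) fun n => ?_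
      have h0 := hk0 n
      have := (habs (hbounds n u hu).1 (hs2 n θ)).trans_eq
        (show _ = B / ((n : ℝ) + 1) ^ 2 by field_simp)
      simpa only [mul_one_div, Real.norm_eq_abs] using this
    have hθ' := Ioo_subset_Icc_self hθ
    -- The residuals `f'' - k² f` sum to `H` minus the affine and cubic parts; those are restored by
    -- the second derivatives of the explicit cubic term.
    have e3 : ∑' n : ℕ, f2 n u * Real.sin ((n + 1) * θ) +
        ∑' n : ℕ, f n u * ((n + 1) * (-(n + 1) * Real.sin ((n + 1) * θ))) =
        H (u, θ) - affineData (b u) (c u) θ -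
          cubicData (deriv (deriv b) u) (deriv (deriv c) u) θ := by
      rw [← s1.tsum_add s2]
      refine (((hsum u θ (hI0 u hu) hθ').sub
        (hasSum_cubicData (deriv (deriv b) u) (deriv (deriv c) u) hθ')).congr_fun
          fun n => ?_).tsum_eq
      linear_combination Real.sin ((n + 1) * θ) * hfres n u
    rw [e1, e2]
    linarith

/-- The homogeneous mixed problem. Even reflection in `u` and the sine expansion define `v` on the
whole plane, so `C¹` regularity at the horizon and at the corners is already interior regularity of
the reflected problem. -/
theorem exists_strip_solution {H : ℝ × ℝ → ℝ} {C : ℝ} (hH : ContDiffOn ℝ ∞ H halfPlane)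
    (hC : ∀ u t, 0 ≤ u → t ∈ Icc 0 Real.pi → |H (u, t)| ≤ C * Real.exp (-u)) :
    ∃ v : ℝ × ℝ → ℝ, ContDiff ℝ 1 v ∧ ContDiffOn ℝ 2 v (Ioi 0 ×ˢ Ioo 0 Real.pi) ∧
      (∀ u, v (u, 0) = 0 ∧ v (u, Real.pi) = 0) ∧
      (∀ θ, HasDerivAt (fun u => v (u, θ)) 0 0) ∧
      (∃ K, ∀ u θ, |v (u, θ)| ≤ K * Real.exp (-|u| / 2)) ∧
      ∀ u θ, 0 < u → θ ∈ Ioo 0 Real.pi →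
        deriv (deriv fun u => v (u, θ)) u + deriv (deriv fun t => v (u, t)) θ = H (u, θ) := by
  obtain ⟨H1, hH1, hHd1⟩ := exists_theta_deriv hH
  obtain ⟨H2, hH2, hHd2⟩ := exists_theta_deriv hH1
  have hpi := Real.pi_pos
  have hC0 : 0 ≤ C := by simpa using (abs_nonneg _).trans (hC 0 0 le_rfl ⟨le_rfl, hpi.le⟩)
  -- The reflected source is in general only continuous at `u = 0`. This is enough for the ordinary
  -- differential equations, and `C²` is claimed only for `u > 0`.
  set h : ℕ → ℝ → ℝ := fun n u => sineCoeff (fun t => H (|u|, t)) n with hdef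
  have hk1 : ∀ n : ℕ, (1 : ℝ) ≤ n + 1 := fun n => by linarith [(n.cast_nonneg : (0 : ℝ) ≤ n)]
  have hk0 : ∀ n : ℕ, (0 : ℝ) < n + 1 := fun n => by positivity
  have hcont : ∀ n, Continuous (h n) := by
    intro n
    refine continuous_const.mul
      (intervalIntegral.continuous_parametric_intervalIntegral_of_continuous' ?_ _ _)
    have : Continuous fun p : ℝ × ℝ => H (|p.1|, p.2) :=
      hH.continuousOn.comp_continuous (by fun_prop)
        fun p => ⟨abs_nonneg p.1, mem_univ _⟩
    exact this.mul (by fun_prop)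
  have hbound : ∀ n u, |h n u| ≤ 2 * C * Real.exp (-|u|) := by
    intro n u
    rw [mul_assoc]
    exact abs_sineCoeff_le (fun t ht => hC |u| t (abs_nonneg _) ht) n
  choose m m1 hm hm1 hm0 hmb using fun n : ℕ => exists_even_solution (hk1 n) (hcont n)
    (fun s => by simp [hdef]) (hbound n)
  -- local bounds on the modes
  have hres : ∀ U, ∃ K, 0 ≤ K ∧ ∀ n, ∀ u ∈ Icc 0 U,
      |h n u - affineCoeff (H (u, 0)) (H (u, Real.pi)) n| ≤ K / (n + 1) ^ 2 := by
    intro U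
    obtain ⟨K, hK, hK'⟩ := exists_abs_le_of_contDiffOn hH2 U
    refine ⟨2 * K, by positivity, fun n u hu => ?_⟩
    simp only [hdef, abs_of_nonneg hu.1]
    rw [sineCoeff_sub_affineCoeff hHd1 hHd2 hH2.continuousOn hu.1, abs_neg, abs_div,
      abs_of_pos (by positivity : (0 : ℝ) < ((n : ℝ) + 1) ^ 2)]
    gcongr
    exact abs_sineCoeff_le (hK' u hu) n
  have hh1 : ∀ U, ∃ K, 0 ≤ K ∧ ∀ n u, |u| ≤ U → |h n u| ≤ K / (n + 1) := by
    intro U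
    obtain ⟨K, hK, hK'⟩ := hres U
    obtain ⟨L, hL, hL'⟩ := exists_abs_le_of_contDiffOn hH U
    refine ⟨K + 2 * L, by positivity, fun n u hu => ?_⟩
    have hu' : |u| ∈ Icc 0 U := ⟨abs_nonneg _, hu⟩
    have e1 := hK' n |u| hu'
    have e2 := abs_affineCoeff_le (hL' |u| hu' 0 ⟨le_rfl, hpi.le⟩)
      (hL' |u| hu' Real.pi ⟨hpi.le, le_rfl⟩) n
    have e3 : h n |u| = h n u := by simp [hdef]
    have e4 : K / ((n : ℝ) + 1) ^ 2 ≤ K / (n + 1) := by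
      have := hk1 n
      gcongr
      nlinarith
    have e5 := abs_add_le (h n |u| - affineCoeff (H (|u|, 0)) (H (|u|, Real.pi)) n)
      (affineCoeff (H (|u|, 0)) (H (|u|, Real.pi)) n)
    rw [sub_add_cancel] at e5
    rw [← e3, add_div]
    linarith
  have hmb' : ∀ n u, |m n u| ≤ 4 * C := by
    intro n u
    refine (hmb n u).trans ?_
    have e1 : Real.exp (-|u| / 2) ≤ 1 := Real.exp_le_one_iff.2 (by linarith [abs_nonneg u])
    have e2 : 2 * (2 * C) / ((n : ℝ) + 1) ^ 2 ≤ 4 * C := by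
      rw [div_le_iff₀ (by have := hk0 n; positivity)]
      have := hk1 n
      have h1 : (1 : ℝ) ≤ ((n : ℝ) + 1) ^ 2 := by nlinarith
      nlinarith
    calc _ ≤ 4 * C * 1 := mul_le_mul e2 e1 (Real.exp_pos _).le (by positivity)
      _ = _ := mul_one _
  have hmU : ∀ U, ∃ K, 0 ≤ K ∧ ∀ n u, |u| ≤ U →
      |m n u| ≤ K / (n + 1) ^ 3 ∧ |m1 n u| ≤ K / (n + 1) ^ 2 := by
    intro U
    obtain ⟨K, hK, hK'⟩ := hh1 (U + 3)
    -- Here `p = 1`, since the unsubtracted coefficients are `O(1/k)`; the interval `[-U-3, U+3]`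
    -- crosses `u = 0`, so the bounds hold up to the horizon.
    obtain ⟨L, hL, hL'⟩ := mode_bounds 1 one_pos (by positivity : 0 ≤ 4 * C) hK
    refine ⟨L, hL, fun n u hu => ?_⟩
    have hu' := abs_le.1 hu
    have := hL' (n + 1) (hk1 n) (-U - 3) (U + 3) (m n) (m1 n) _ (fun x _ => hm n x)
      (fun x _ => hm1 n x) (fun x hx => ?_) (hmb' n _) (hmb' n _) u (by linarith) (by linarith)
    · exact ⟨this.1, this.2.1⟩
    · rw [add_sub_cancel_left, pow_one]
      exact hK' n x (abs_le.2 ⟨by linarith [hx.1], hx.2⟩)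
  set v : ℝ × ℝ → ℝ := fun p => ∑' n : ℕ, m n p.1 * Real.sin ((n + 1) * p.2) with hv
  have hsc : ∀ (x k t : ℝ), |x * Real.sin (k * t)| ≤ |x| := by
    intro x k t
    rw [abs_mul]
    exact mul_le_of_le_one_right (abs_nonneg _) (Real.abs_sin_le_one _)
  have hcc : ∀ (n : ℕ) (x t : ℝ), |x * ((n + 1) * Real.cos ((n + 1) * t))| ≤ |x| * (n + 1) := by
    intro n x t
    rw [abs_mul, abs_mul, abs_of_pos (hk0 n)]
    gcongr
    exact mul_le_of_le_one_right (hk0 n).le (Real.abs_cos_le_one _)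
  have hps : ∀ n : ℕ, ∀ K : ℝ, 0 ≤ K → K / ((n : ℝ) + 1) ^ 3 ≤ K * (1 / (n + 1) ^ 2) := by
    intro n K hK
    rw [mul_one_div]
    gcongr
    · exact hk1 n
    · norm_num
  have hfirst : ∀ U : ℝ,
      (∀ p ∈ Ioo (-U) U ×ˢ (univ : Set ℝ), HasFDerivAt v
        ((∑' n : ℕ, m1 n p.1 * Real.sin ((n + 1) * p.2)) • ContinuousLinearMap.fst ℝ ℝ ℝ +
          (∑' n : ℕ, m n p.1 * ((n + 1) * Real.cos ((n + 1) * p.2))) •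
            ContinuousLinearMap.snd ℝ ℝ ℝ) p) ∧
      ContinuousOn (fun p : ℝ × ℝ => ∑' n : ℕ, m1 n p.1 * Real.sin ((n + 1) * p.2))
        (Ioo (-U) U ×ˢ univ) ∧
      ContinuousOn (fun p : ℝ × ℝ => ∑' n : ℕ, m n p.1 * ((n + 1) * Real.cos ((n + 1) * p.2)))
        (Ioo (-U) U ×ˢ univ) := by
    intro U
    obtain ⟨K, hK, hK'⟩ := hmU U
    exact hasFDerivAt_productSeries (a := m) (a' := m1)
      (b := fun n t => Real.sin ((n + 1) * t))
      (b' := fun n t => (n + 1) * Real.cos ((n + 1) * t)) (I := Ioo (-U) U)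
      isOpen_Ioo isPreconnected_Ioo (summable_one_div_succ_sq.mul_left K)
      (fun n u _ => hm n u) (fun n t => hasDerivAt_sin_mul _ t)
      (fun n u _ => (hm1 n u).continuousAt.continuousWithinAt) (fun n => by fun_prop)
      (fun n u hu t => (hsc _ _ _).trans
        (((hK' n u (abs_le.2 ⟨hu.1.le, hu.2.le⟩)).1).trans (hps n K hK)))
      (fun n u hu t => (hsc _ _ _).trans
        (((hK' n u (abs_le.2 ⟨hu.1.le, hu.2.le⟩)).2).trans (by rw [mul_one_div])))
      (fun n u hu t => (hcc _ _ _).trans (by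
        have := (hK' n u (abs_le.2 ⟨hu.1.le, hu.2.le⟩)).1
        have h0 := hk0 n
        calc _ ≤ K / ((n : ℝ) + 1) ^ 3 * (n + 1) := by gcongr
          _ = _ := by field_simp))
  have hmem : ∀ p : ℝ × ℝ, p ∈ Ioo (-(|p.1| + 1)) (|p.1| + 1) ×ˢ (univ : Set ℝ) := fun p =>
    ⟨⟨by linarith [neg_abs_le p.1], by linarith [le_abs_self p.1]⟩, mem_univ _⟩
  have hvd := fun p => (hfirst (|p.1| + 1)).1 p (hmem p)
  have hinterior := fun u₀ (hu₀ : 0 < u₀) => modeSeries_interior hH hu₀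
    (fun n u _ => hm n u) (fun n u _ => hm1 n u) (fun n => (hcont n).continuousOn) hmb'
    (hres (u₀ + 3)) (fun u θ hu hθ => by
      simpa only [hdef, abs_of_pos hu] using
        hasSum_sineCoeff_sub_affineCoeff hHd1 hHd2 hH2.continuousOn hu.le hθ)
  have hnhd : ∀ u : ℝ, 0 < u → u ∈ Ioo (u / 2) (u + 1) := fun u hu =>
    ⟨by linarith, by linarith⟩
  refine ⟨v, ?_, ?_, ?_, ?_, ?_, ?_⟩
  · rw [contDiff_iff_contDiffAt]
    intro p
    obtain ⟨e1, e2, e3⟩ := hfirst (|p.1| + 1)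
    exact (contDiffOn_one_of_partials (isOpen_Ioo.prod isOpen_univ) e1 e2 e3).contDiffAt ((isOpen_Ioo.prod isOpen_univ).mem_nhds (hmem p))
  · intro p hp
    exact (((hinterior p.1 hp.1).1 p ⟨hnhd _ hp.1, hp.2⟩).contDiffAt
      ((isOpen_Ioo.prod isOpen_Ioo).mem_nhds ⟨hnhd _ hp.1, hp.2⟩)).contDiffWithinAt
  · intro u
    simp [hv, sin_succ_mul_pi]
  · intro θ
    have := hasDerivAt_fst_of_partials (hvd (0, θ))
    simpa [hm0] using this
  · obtain ⟨S, hS⟩ := summable_one_div_succ_sq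
    refine ⟨4 * C * S, fun u θ => ?_⟩
    have hs := hS.mul_left (4 * C * Real.exp (-|u| / 2))
    have := tsum_of_norm_bounded (f := fun n : ℕ => m n u * Real.sin ((n + 1) * θ)) hs
      (fun n => (hsc _ _ _).trans ((hmb n u).trans (le_of_eq (by ring))))
    rw [Real.norm_eq_abs] at this
    exact this.trans (le_of_eq (by ring))
  · intro u θ hu hθ
    exact (hinterior u hu).2 u θ (hnhd u hu) hθ

/-! ### Classes of coefficient functions on the half-plane -/

/-- Smooth functions on the closed half-plane `u ≥ 0` that are `O(exp (-u))`. -/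
structure IsDecaying (f : ℝ × ℝ → ℝ) : Prop where
  contDiffOn : ContDiffOn ℝ ∞ f halfPlane
  bound : ∃ C, 0 ≤ C ∧ ∀ u θ, 0 ≤ u → |f (u, θ)| ≤ C * Real.exp (-u)

/-- Bounded smooth functions on the closed half-plane `u ≥ 0`. -/
structure IsBoundedSmooth (f : ℝ × ℝ → ℝ) : Prop where
  contDiffOn : ContDiffOn ℝ ∞ f halfPlane
  bound : ∃ C, 0 ≤ C ∧ ∀ u θ, 0 ≤ u → |f (u, θ)| ≤ C

namespace IsDecaying

theorem add {f g : ℝ × ℝ → ℝ} (hf : IsDecaying f) (hg : IsDecaying g) :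
    IsDecaying fun p => f p + g p := by
  obtain ⟨C, hC, hC'⟩ := hf.bound
  obtain ⟨D, hD, hD'⟩ := hg.bound
  refine ⟨hf.contDiffOn.add hg.contDiffOn, C + D, by positivity, fun u θ hu => ?_⟩
  rw [add_mul]
  exact (abs_add_le _ _).trans (add_le_add (hC' u θ hu) (hD' u θ hu))

theorem neg {f : ℝ × ℝ → ℝ} (hf : IsDecaying f) : IsDecaying fun p => -f p := by
  obtain ⟨C, hC, hC'⟩ := hf.bound
  exact ⟨hf.contDiffOn.neg, C, hC, fun u θ hu => by rw [abs_neg]; exact hC' u θ hu⟩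

theorem sub {f g : ℝ × ℝ → ℝ} (hf : IsDecaying f) (hg : IsDecaying g) :
    IsDecaying fun p => f p - g p := by
  simpa only [sub_eq_add_neg] using hf.add hg.neg

theorem isBoundedSmooth {f : ℝ × ℝ → ℝ} (hf : IsDecaying f) : IsBoundedSmooth f := by
  obtain ⟨C, hC, hC'⟩ := hf.bound
  refine ⟨hf.contDiffOn, C, hC, fun u θ hu => (hC' u θ hu).trans ?_⟩
  exact mul_le_of_le_one_right hC (Real.exp_le_one_iff.2 (by linarith))

end IsDecaying

namespace IsBoundedSmooth

theorem mul_decaying {f g : ℝ × ℝ → ℝ} (hf : IsBoundedSmooth f) (hg : IsDecaying g) :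
    IsDecaying fun p => f p * g p := by
  obtain ⟨C, hC, hC'⟩ := hf.bound
  obtain ⟨D, hD, hD'⟩ := hg.bound
  refine ⟨hf.contDiffOn.mul hg.contDiffOn, C * D, by positivity, fun u θ hu => ?_⟩
  rw [abs_mul, mul_assoc]
  exact mul_le_mul (hC' u θ hu) (hD' u θ hu) (abs_nonneg _) hC

theorem mul {f g : ℝ × ℝ → ℝ} (hf : IsBoundedSmooth f) (hg : IsBoundedSmooth g) :
    IsBoundedSmooth fun p => f p * g p := by
  obtain ⟨C, hC, hC'⟩ := hf.bound
  obtain ⟨D, hD, hD'⟩ := hg.bound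
  refine ⟨hf.contDiffOn.mul hg.contDiffOn, C * D, by positivity, fun u θ hu => ?_⟩
  rw [abs_mul]
  exact mul_le_mul (hC' u θ hu) (hD' u θ hu) (abs_nonneg _) hC

theorem add {f g : ℝ × ℝ → ℝ} (hf : IsBoundedSmooth f) (hg : IsBoundedSmooth g) :
    IsBoundedSmooth fun p => f p + g p := by
  obtain ⟨C, hC, hC'⟩ := hf.bound
  obtain ⟨D, hD, hD'⟩ := hg.bound
  exact ⟨hf.contDiffOn.add hg.contDiffOn, C + D, by positivity, fun u θ hu =>
    (abs_add_le _ _).trans (add_le_add (hC' u θ hu) (hD' u θ hu))⟩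

theorem neg {f : ℝ × ℝ → ℝ} (hf : IsBoundedSmooth f) : IsBoundedSmooth fun p => -f p := by
  obtain ⟨C, hC, hC'⟩ := hf.bound
  exact ⟨hf.contDiffOn.neg, C, hC, fun u θ hu => by rw [abs_neg]; exact hC' u θ hu⟩

theorem sub {f g : ℝ × ℝ → ℝ} (hf : IsBoundedSmooth f) (hg : IsBoundedSmooth g) :
    IsBoundedSmooth fun p => f p - g p := by
  simpa only [sub_eq_add_neg] using hf.add hg.neg

theorem const (c : ℝ) : IsBoundedSmooth fun _ => c :=
  ⟨contDiffOn_const, |c|, abs_nonneg c, fun _ _ _ => le_rfl⟩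

theorem pow {f : ℝ × ℝ → ℝ} (hf : IsBoundedSmooth f) (n : ℕ) :
    IsBoundedSmooth fun p => f p ^ n := by
  induction n with
  | zero => simpa using const 1
  | succ n ih => simpa only [pow_succ] using ih.mul hf

theorem inv {f : ℝ × ℝ → ℝ} (hf : ContDiffOn ℝ ∞ f halfPlane) (h1 : ∀ p ∈ halfPlane, 1 ≤ f p) :
    IsBoundedSmooth fun p => (f p)⁻¹ := by
  refine ⟨hf.inv fun p hp => (zero_lt_one.trans_le (h1 p hp)).ne', 1, zero_le_one,
    fun u θ hu => ?_⟩
  have := h1 (u, θ) ⟨hu, mem_univ _⟩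
  rw [abs_inv, abs_of_pos (by linarith)]
  exact inv_le_one_of_one_le₀ this

theorem sin : IsBoundedSmooth fun p => Real.sin p.2 :=
  ⟨(by fun_prop : ContDiff ℝ ∞ fun p : ℝ × ℝ => Real.sin p.2).contDiffOn, 1, zero_le_one,
    fun _ _ _ => Real.abs_sin_le_one _⟩

theorem cos : IsBoundedSmooth fun p => Real.cos p.2 :=
  ⟨(by fun_prop : ContDiff ℝ ∞ fun p : ℝ × ℝ => Real.cos p.2).contDiffOn, 1, zero_le_one,
    fun _ _ _ => Real.abs_cos_le_one _⟩

theorem exp_neg : IsBoundedSmooth fun p => Real.exp (-p.1) :=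
  ⟨(by fun_prop : ContDiff ℝ ∞ fun p : ℝ × ℝ => Real.exp (-p.1)).contDiffOn, 1, zero_le_one,
    fun u _ hu => by
      rw [abs_of_pos (Real.exp_pos _)]
      exact Real.exp_le_one_iff.2 (by simpa using hu)⟩

end IsBoundedSmooth

/-- The data are bounded only strictly outside the horizon; continuity carries the estimates to `u =
0`. -/
theorem IsDecaying.of_bound_interior {f : ℝ × ℝ → ℝ} (hf : ContDiffOn ℝ ∞ f halfPlane) {C : ℝ}
    (hC : 0 ≤ C) (h : ∀ u θ, 0 < u → |f (u, θ)| ≤ C * Real.exp (-u)) : IsDecaying f := by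
  refine ⟨hf, C, hC, fun u θ hu => ?_⟩
  have hc : ContinuousOn (fun u => f (u, θ)) (Ici 0) :=
    (ContDiffOn.slice_left hf (mem_univ θ)).continuousOn
  refine ContinuousWithinAt.closure_le (s := Ioi 0) (f := fun u => |f (u, θ)|)
    (g := fun u => C * Real.exp (-u)) (by rwa [closure_Ioi])
    ((hc u hu).mono Ioi_subset_Ici_self).abs
    (Continuous.continuousWithinAt (by fun_prop)) fun y hy => h y θ hy

/-! ### Regular axisymmetric scalars in half-plane coordinates -/

/-- The standard basis of `ℝ³`. -/
noncomputable def e3 (i : Fin 3) : EuclideanSpace ℝ (Fin 3) := EuclideanSpace.single i 1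

theorem norm_e3 (i : Fin 3) : ‖e3 i‖ = 1 := by simp [e3]

theorem spherical_eq (R θ φ : ℝ) : spherical R θ φ = (R * Real.sin θ * Real.cos φ) • e3 0 +
    (R * Real.sin θ * Real.sin φ) • e3 1 + (R * Real.cos θ) • e3 2 := by
  ext i
  fin_cases i <;> simp [spherical, e3]

theorem norm_spherical {R : ℝ} (hR : 0 ≤ R) (θ φ : ℝ) : ‖spherical R θ φ‖ = R := by
  rw [EuclideanSpace.norm_eq, Real.sqrt_eq_iff_mul_self_eq (by positivity) hR]
  simp only [spherical, Fin.sum_univ_three, Real.norm_eq_abs, sq_abs]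
  simp
  linear_combination (R ^ 2 * Real.sin θ ^ 2) * Real.sin_sq_add_cos_sq φ +
    R ^ 2 * Real.sin_sq_add_cos_sq θ

/-- The exterior of a ball is not convex, but by Cauchy-Schwarz it contains the half-space `⟪x, y⟫ ≥
‖x‖²` through each of its points `x`, and that half-space is convex with nonempty interior. -/
theorem uniqueDiffOn_exterior {Rp : ℝ} (hRp : 0 < Rp) :
    UniqueDiffOn ℝ {x : EuclideanSpace ℝ (Fin 3) | Rp ≤ ‖x‖} := by
  intro x hx
  have hx0 : 0 < ‖x‖ := hRp.trans_le hx
  set s : Set (EuclideanSpace ℝ (Fin 3)) := {y | ‖x‖ ^ 2 ≤ inner ℝ x y} with hs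
  have hsub : s ⊆ {x : EuclideanSpace ℝ (Fin 3) | Rp ≤ ‖x‖} := by
    intro y hy
    have h1 : ‖x‖ ^ 2 ≤ ‖x‖ * ‖y‖ := le_trans hy (real_inner_le_norm x y)
    rw [sq] at h1
    exact le_trans hx (le_of_mul_le_mul_left h1 hx0)
  refine UniqueDiffWithinAt.mono (s := s) ?_ hsub
  have hconv : Convex ℝ s := by
    intro y hy z hz α β hα hβ hαβ
    simp only [hs, mem_ofPred_eq, inner_add_right, inner_smul_right] at hy hz ⊢
    nlinarith
  refine uniqueDiffWithinAt_convex hconv ?_ (subset_closure ?_)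
  · refine ⟨(2 : ℝ) • x, mem_interior.2 ⟨{y | ‖x‖ ^ 2 < inner ℝ x y}, fun y hy => show ‖x‖ ^ 2 ≤ inner ℝ x y from
      (show ‖x‖ ^ 2 < inner ℝ x y from hy).le,
      isOpen_lt continuous_const (by fun_prop), ?_⟩⟩
    simp only [mem_ofPred_eq, inner_smul_right, real_inner_self_eq_norm_sq]
    nlinarith
  · simp [hs]

/-- The point of the half-space slice `φ = 0` with half-plane coordinates `(u, θ)`. -/
noncomputable def slicePoint (Rp : ℝ) (p : ℝ × ℝ) : EuclideanSpace ℝ (Fin 3) :=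
  spherical (Rp * Real.exp p.1) p.2 0

/-- The derivative of `slicePoint` in `θ`. -/
noncomputable def slicePointTheta (Rp : ℝ) (p : ℝ × ℝ) : EuclideanSpace ℝ (Fin 3) :=
  (Rp * Real.exp p.1 * Real.cos p.2) • e3 0 - (Rp * Real.exp p.1 * Real.sin p.2) • e3 2

theorem slicePoint_eq (Rp : ℝ) (p : ℝ × ℝ) : slicePoint Rp p =
    (Rp * Real.exp p.1 * Real.sin p.2) • e3 0 + (Rp * Real.exp p.1 * Real.cos p.2) • e3 2 := by
  simp [slicePoint, spherical_eq]

theorem contDiff_slicePoint (Rp : ℝ) : ContDiff ℝ ∞ (slicePoint Rp) := by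
  rw [show slicePoint Rp = _ from funext (slicePoint_eq Rp)]
  fun_prop

theorem contDiff_slicePointTheta (Rp : ℝ) : ContDiff ℝ ∞ (slicePointTheta Rp) := by
  unfold slicePointTheta
  fun_prop

theorem norm_slicePoint {Rp : ℝ} (hRp : 0 < Rp) (p : ℝ × ℝ) :
    ‖slicePoint Rp p‖ = Rp * Real.exp p.1 := norm_spherical (by positivity) _ _

theorem norm_slicePointTheta {Rp : ℝ} (hRp : 0 < Rp) (p : ℝ × ℝ) :
    ‖slicePointTheta Rp p‖ = Rp * Real.exp p.1 := by
  have : slicePointTheta Rp p = slicePoint Rp (p.1, p.2 + Real.pi / 2) := by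
    rw [slicePoint_eq, slicePointTheta]
    simp only [Real.sin_add_pi_div_two, Real.cos_add_pi_div_two, mul_neg, neg_smul, sub_eq_add_neg]
  rw [this, norm_slicePoint hRp]

/-- Translation in `u` is dilation of space, whose velocity is the position vector. -/
theorem hasDerivAt_slicePoint_fst (Rp u θ : ℝ) :
    HasDerivAt (fun u => slicePoint Rp (u, θ)) (slicePoint Rp (u, θ)) u := by
  simp only [slicePoint_eq]
  exact ((((Real.hasDerivAt_exp u).const_mul Rp).mul_const (Real.sin θ)).smul_const (e3 0)).add
    ((((Real.hasDerivAt_exp u).const_mul Rp).mul_const (Real.cos θ)).smul_const (e3 2))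

theorem hasDerivAt_slicePoint_snd (Rp u θ : ℝ) :
    HasDerivAt (fun θ => slicePoint Rp (u, θ)) (slicePointTheta Rp (u, θ)) θ := by
  simp only [slicePoint_eq, slicePointTheta]
  have := ((((Real.hasDerivAt_sin θ).const_mul (Rp * Real.exp u))).smul_const (e3 0)).add
    ((((Real.hasDerivAt_cos θ).const_mul (Rp * Real.exp u))).smul_const (e3 2))
  refine this.congr_deriv ?_
  simp only [mul_neg, neg_smul, sub_eq_add_neg]

theorem hasDerivAt_slicePointTheta_snd (Rp u θ : ℝ) :
    HasDerivAt (fun θ => slicePointTheta Rp (u, θ)) (-slicePoint Rp (u, θ)) θ := by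
  simp only [slicePoint_eq, slicePointTheta]
  have := ((((Real.hasDerivAt_cos θ).const_mul (Rp * Real.exp u))).smul_const (e3 0)).sub
    ((((Real.hasDerivAt_sin θ).const_mul (Rp * Real.exp u))).smul_const (e3 2))
  refine this.congr_deriv ?_
  simp only [mul_neg, neg_smul]
  abel

theorem hasDerivAt_comp_apply {E : Type*} [NormedAddCommGroup E] [NormedSpace ℝ E]
    {G : E → E →L[ℝ] ℝ} {G' : E →L[ℝ] E →L[ℝ] ℝ} {γ τ : ℝ → E} {γ' τ' : E} {t : ℝ}
    (hG : HasFDerivAt G G' (γ t)) (hγ : HasDerivAt γ γ' t) (hτ : HasDerivAt τ τ' t) :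
    HasDerivAt (fun t => G (γ t) (τ t)) (G' γ' (τ t) + G (γ t) τ') t :=
  (hG.comp_hasDerivAt t hγ).clm_apply hτ

-- Pull the lift `F` back along the slice `φ = 0`, for all real `θ`. With `X = slicePoint` and `Y =
-- slicePointTheta`, both of length `R`, a derivative of order `k` in `(u, θ)` brings at most `Rᵏ`,
-- which the decay of the derivatives of `F` compensates to `O(1/R)`. The factor `sin θ` in the
-- `θ`-derivative comes from axisymmetry, which replaces `∂F/∂x₀` by `R sin θ` times a second
-- derivative of `F`.
set_option maxHeartbeats 400000 in
theorem exists_strip_representation {Rp : ℝ} {f : ℝ → ℝ → ℝ} (hRp : 0 < Rp)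
    (hf : IsRegularScalar Rp f) : ∃ f0 fu fk fL : ℝ × ℝ → ℝ,
      IsDecaying f0 ∧ IsDecaying fu ∧ IsDecaying fk ∧ IsDecaying fL ∧
      (∀ u θ, 0 ≤ u → θ ∈ Icc 0 Real.pi → f (Rp * Real.exp u) θ = f0 (u, θ)) ∧
      (∀ u θ, 0 ≤ u → HasDerivWithinAt (fun u => f0 (u, θ)) (fu (u, θ)) (Ici 0) u) ∧
      (∀ u θ, 0 < u → θ ∈ Ioo 0 Real.pi →
        HasDerivAt (fun t => f0 (u, t)) (Real.sin θ * fk (u, θ)) θ) ∧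
      ∀ u θ, 0 < u →
        deriv (deriv fun u => f0 (u, θ)) u + deriv (deriv fun t => f0 (u, t)) θ = fL (u, θ) := by
  obtain ⟨F, hFf, hF, C, hC⟩ := hf
  set X : Set (EuclideanSpace ℝ (Fin 3)) := {x | Rp ≤ ‖x‖} with hX
  have hXu : UniqueDiffOn ℝ X := uniqueDiffOn_exterior hRp
  set F1 := fderivWithin ℝ F X with hF1
  set F2 := fderivWithin ℝ F1 X with hF2
  have sF1 : ContDiffOn ℝ ∞ F1 X := hF.fderivWithin hXu (by simp)
  have sF2 : ContDiffOn ℝ ∞ F2 X := sF1.fderivWithin hXu (by simp)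
  have hopen : IsOpen {x : EuclideanSpace ℝ (Fin 3) | Rp < ‖x‖} :=
    isOpen_lt continuous_const continuous_norm
  have hnhd : ∀ x : EuclideanSpace ℝ (Fin 3), Rp < ‖x‖ → X ∈ 𝓝 x := fun x hx =>
    mem_of_superset (hopen.mem_nhds hx) fun y hy =>
      show Rp ≤ ‖y‖ from (show Rp < ‖y‖ from hy).le
  have dF : ∀ x, Rp < ‖x‖ → HasFDerivAt F (F1 x) x := fun x hx =>
    ((hF.differentiableOn (by simp)) x hx.le).hasFDerivWithinAt.hasFDerivAt (hnhd x hx)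
  have dF1 : ∀ x, Rp < ‖x‖ → HasFDerivAt F1 (F2 x) x := fun x hx =>
    ((sF1.differentiableOn (by simp)) x hx.le).hasFDerivWithinAt.hasFDerivAt (hnhd x hx)
  have bF : ∀ x, Rp < ‖x‖ → |F x| ≤ C / ‖x‖ := fun x hx => by
    simpa using hC 0 (by norm_num) x hx
  have bF1 : ∀ x, Rp < ‖x‖ → ‖F1 x‖ ≤ C / ‖x‖ ^ 2 := fun x hx => by
    have := hC 1 (by norm_num) x hx
    rwa [← norm_iteratedFDeriv_fderiv, norm_iteratedFDeriv_zero, (dF x hx).fderiv] at this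
  have bF2 : ∀ x, Rp < ‖x‖ → ‖F2 x‖ ≤ C / ‖x‖ ^ 3 := fun x hx => by
    have := hC 2 le_rfl x hx
    rw [← norm_iteratedFDeriv_fderiv, ← norm_iteratedFDeriv_fderiv, norm_iteratedFDeriv_zero] at this
    have e : fderiv ℝ F =ᶠ[𝓝 x] F1 := by
      filter_upwards [hopen.mem_nhds hx] with y hy using (dF y hy).fderiv
    rwa [e.fderiv_eq, (dF1 x hx).fderiv] at this
  have hmaps : MapsTo (slicePoint Rp) halfPlane X := by
    intro p hp
    have h1 : 1 ≤ Real.exp p.1 := Real.one_le_exp hp.1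
    simp only [hX, mem_ofPred_eq, norm_slicePoint hRp]
    nlinarith
  have hmaps' : ∀ u θ, 0 < u → Rp < ‖slicePoint Rp (u, θ)‖ := by
    intro u θ hu
    have h1 : 1 < Real.exp u := Real.one_lt_exp_iff.2 hu
    rw [norm_slicePoint hRp]
    nlinarith
  have hC0 : 0 ≤ C := by
    have h1 := hmaps' 1 0 one_pos
    have h2 := (abs_nonneg _).trans (bF _ h1)
    by_contra! h3
    exact absurd h2 (not_le.2 (div_neg_of_neg_of_pos h3 (hRp.trans h1)))
  have cσ : ContDiffOn ℝ ∞ (slicePoint Rp) halfPlane := (contDiff_slicePoint Rp).contDiffOn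
  have cτ : ContDiffOn ℝ ∞ (slicePointTheta Rp) halfPlane :=
    (contDiff_slicePointTheta Rp).contDiffOn
  have c0 := hF.comp cσ hmaps
  have c1 := sF1.comp cσ hmaps
  have c2 := sF2.comp cσ hmaps
  have hE : ∀ u : ℝ, C / (Rp * Real.exp u) = C / Rp * Real.exp (-u) := fun u => by
    rw [Real.exp_neg]; field_simp
  have hCR : 0 ≤ C / Rp := by positivity
  have b1 : ∀ u θ (y : EuclideanSpace ℝ (Fin 3)), 0 < u →
      |F1 (slicePoint Rp (u, θ)) y| ≤ C / (Rp * Real.exp u) ^ 2 * ‖y‖ := fun u θ y hu => by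
    have := bF1 _ (hmaps' u θ hu)
    rw [norm_slicePoint hRp] at this
    exact ((F1 _).le_opNorm y).trans (by gcongr)
  have b2 : ∀ u θ (y z : EuclideanSpace ℝ (Fin 3)), 0 < u →
      |F2 (slicePoint Rp (u, θ)) y z| ≤ C / (Rp * Real.exp u) ^ 3 * ‖y‖ * ‖z‖ :=
    fun u θ y z hu => by
      have := bF2 _ (hmaps' u θ hu)
      rw [norm_slicePoint hRp] at this
      exact ((F2 _).le_opNorm₂ y z).trans (by gcongr)
  refine ⟨fun p => F (slicePoint Rp p), fun p => F1 (slicePoint Rp p) (slicePoint Rp p),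
    fun p => (Rp * Real.exp p.1) ^ 2 * Real.cos p.2 * F2 (slicePoint Rp p) (e3 1) (e3 1) -
      Rp * Real.exp p.1 * F1 (slicePoint Rp p) (e3 2),
    fun p => F2 (slicePoint Rp p) (slicePoint Rp p) (slicePoint Rp p) +
      F2 (slicePoint Rp p) (slicePointTheta Rp p) (slicePointTheta Rp p), ?_, ?_, ?_, ?_,
    ?_, ?_, ?_, ?_⟩
  · refine IsDecaying.of_bound_interior c0 hCR fun u θ hu => ?_
    rw [← hE, ← norm_slicePoint hRp (u, θ)]
    exact bF _ (hmaps' u θ hu)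
  · refine IsDecaying.of_bound_interior (c1.clm_apply cσ) hCR fun u θ hu => ?_
    refine (b1 u θ _ hu).trans (le_of_eq ?_)
    rw [norm_slicePoint hRp, ← hE]
    field_simp
  · refine IsDecaying.of_bound_interior (C := 2 * (C / Rp)) ?_ (by positivity) fun u θ hu => ?_
    · refine ContDiffOn.sub (ContDiffOn.mul (ContDiff.contDiffOn (by fun_prop)) ?_)
        (ContDiffOn.mul (ContDiff.contDiffOn (by fun_prop)) ?_)
      · exact (c2.clm_apply contDiffOn_const).clm_apply contDiffOn_const
      · exact c1.clm_apply contDiffOn_const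
    · have i1 := b1 u θ (e3 2) hu
      have i2 := b2 u θ (e3 1) (e3 1) hu
      rw [norm_e3, mul_one] at i1
      rw [norm_e3, mul_one, mul_one] at i2
      have hR : 0 < Rp * Real.exp u := by positivity
      refine (abs_sub _ _).trans ?_
      rw [abs_mul, abs_mul, abs_mul, abs_of_pos hR, abs_of_pos (by positivity :
        0 < (Rp * Real.exp u) ^ 2)]
      calc _ ≤ (Rp * Real.exp u) ^ 2 * 1 * (C / (Rp * Real.exp u) ^ 3) +
            Rp * Real.exp u * (C / (Rp * Real.exp u) ^ 2) := by
            gcongr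
            exact Real.abs_cos_le_one _
        _ = 2 * (C / (Rp * Real.exp u)) := by field_simp; ring
        _ = _ := by rw [hE]; ring
  · refine IsDecaying.of_bound_interior (C := 2 * (C / Rp))
      (((c2.clm_apply cσ).clm_apply cσ).add ((c2.clm_apply cτ).clm_apply cτ))
      (by positivity) fun u θ hu => ?_
    have i1 := b2 u θ (slicePoint Rp (u, θ)) (slicePoint Rp (u, θ)) hu
    have i2 := b2 u θ (slicePointTheta Rp (u, θ)) (slicePointTheta Rp (u, θ)) hu
    rw [norm_slicePoint hRp] at i1
    rw [norm_slicePointTheta hRp] at i2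
    refine (abs_add_le _ _).trans ((add_le_add i1 i2).trans (le_of_eq ?_))
    rw [mul_assoc 2, ← hE]
    field_simp
    ring
  · intro u θ hu hθ
    refine (hFf _ _ 0 ?_ hθ).symm
    have := Real.one_le_exp hu
    nlinarith
  · intro u θ hu
    have h1 := ((hF.differentiableOn (by simp)) _
      (hmaps (show (u, θ) ∈ halfPlane from ⟨hu, mem_univ _⟩))).hasFDerivWithinAt
    exact h1.comp_hasDerivWithinAt u (hasDerivAt_slicePoint_fst Rp u θ).hasDerivWithinAt
      (fun s hs => hmaps (show (s, θ) ∈ halfPlane from ⟨hs, mem_univ _⟩))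
  · intro u θ hu hθ
    have h1 := (dF _ (hmaps' u θ hu)).comp_hasDerivAt θ (hasDerivAt_slicePoint_snd Rp u θ)
    refine h1.congr_deriv ?_
    have hsin : 0 < Real.sin θ := Real.sin_pos_of_pos_of_lt_pi hθ.1 hθ.2
    set R := Rp * Real.exp u with hR
    have hR0 : 0 < R := by positivity
    have hRR : Rp < R := by
      have := hmaps' u θ hu
      rwa [norm_slicePoint hRp] at this
    -- differentiate the axisymmetry twice in the azimuth
    have d1 : ∀ φ, HasDerivAt (fun φ => spherical R θ φ)
        ((-(R * Real.sin θ * Real.sin φ)) • e3 0 + (R * Real.sin θ * Real.cos φ) • e3 1) φ := by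
      intro φ
      simp only [spherical_eq]
      have := ((((Real.hasDerivAt_cos φ).const_mul (R * Real.sin θ)).smul_const (e3 0)).add
        (((Real.hasDerivAt_sin φ).const_mul (R * Real.sin θ)).smul_const (e3 1))).add_const
        ((R * Real.cos θ) • e3 2)
      refine this.congr_deriv ?_
      simp only [mul_neg]
    have hout : ∀ φ, Rp < ‖spherical R θ φ‖ := fun φ => by rwa [norm_spherical hR0.le]
    have z1 : ∀ φ, F1 (spherical R θ φ)
        ((-(R * Real.sin θ * Real.sin φ)) • e3 0 + (R * Real.sin θ * Real.cos φ) • e3 1) = 0 := by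
      intro φ
      have h2 := (dF _ (hout φ)).comp_hasDerivAt φ (d1 φ)
      have h3 : F ∘ (fun φ => spherical R θ φ) = fun _ => f R θ := by
        funext ψ
        exact hFf R θ ψ hRR.le (Ioo_subset_Icc_self hθ)
      rw [h3] at h2
      exact h2.unique (hasDerivAt_const φ _)
    have d2 : HasDerivAt (fun φ => (-(R * Real.sin θ * Real.sin φ)) • e3 0 +
        (R * Real.sin θ * Real.cos φ) • e3 1) ((-(R * Real.sin θ)) • e3 0) 0 := by
      have := (((Real.hasDerivAt_sin 0).const_mul (R * Real.sin θ)).fun_neg.smul_const (e3 0)).add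
        (((Real.hasDerivAt_cos 0).const_mul (R * Real.sin θ)).smul_const (e3 1))
      refine this.congr_deriv ?_
      simp
    -- The second azimuthal derivative at `φ = 0` reads `R² sin² θ F₁₁ - R sin θ F₀ = 0`; dividing
    -- by `R sin θ` gives `F₀ = R sin θ F₁₁`, where the indices denote partials along `e3`.
    have h4 := hasDerivAt_comp_apply (dF1 _ (hout 0)) (d1 0) d2
    have h5 := (h4.congr_of_eventuallyEq
      (Eventually.of_forall fun φ => (z1 φ).symm)).unique (hasDerivAt_const 0 0)
    have h6 : spherical R θ 0 = slicePoint Rp (u, θ) := rfl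
    simp only [h6, Real.sin_zero, Real.cos_zero, mul_zero, neg_zero, zero_smul,
      zero_add, mul_one, map_smul, smul_apply, smul_eq_mul] at h5
    simp only [slicePointTheta, ← hR, map_sub, map_smul, smul_eq_mul]
    have h7 : R * Real.sin θ ≠ 0 := (mul_pos hR0 hsin).ne'
    have h8 : F1 (slicePoint Rp (u, θ)) (e3 0) =
        R * Real.sin θ * F2 (slicePoint Rp (u, θ)) (e3 1) (e3 1) := by
      apply mul_left_cancel₀ h7
      linear_combination -h5
    rw [h8]
    ring
  · intro u θ hu
    have hs : ∀ y ∈ Ioi (0 : ℝ), deriv (fun u => F (slicePoint Rp (u, θ))) y =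
        F1 (slicePoint Rp (y, θ)) (slicePoint Rp (y, θ)) := fun y hy =>
      ((dF _ (hmaps' y θ hy)).comp_hasDerivAt y (hasDerivAt_slicePoint_fst Rp y θ)).deriv
    have ht : ∀ t, deriv (fun t => F (slicePoint Rp (u, t))) t =
        F1 (slicePoint Rp (u, t)) (slicePointTheta Rp (u, t)) := fun t =>
      ((dF _ (hmaps' u t hu)).comp_hasDerivAt t (hasDerivAt_slicePoint_snd Rp u t)).deriv
    have e1 : deriv (deriv fun u => F (slicePoint Rp (u, θ))) u =
        F2 (slicePoint Rp (u, θ)) (slicePoint Rp (u, θ)) (slicePoint Rp (u, θ)) +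
          F1 (slicePoint Rp (u, θ)) (slicePoint Rp (u, θ)) := by
      have e : deriv (fun u => F (slicePoint Rp (u, θ))) =ᶠ[𝓝 u]
          fun y => F1 (slicePoint Rp (y, θ)) (slicePoint Rp (y, θ)) := by
        filter_upwards [Ioi_mem_nhds hu] with y hy using hs y hy
      rw [e.deriv_eq]
      exact (hasDerivAt_comp_apply (γ := fun u => slicePoint Rp (u, θ)) (t := u)
        (dF1 _ (hmaps' u θ hu)) (hasDerivAt_slicePoint_fst Rp u θ)
        (hasDerivAt_slicePoint_fst Rp u θ)).deriv
    have e2 : deriv (deriv fun t => F (slicePoint Rp (u, t))) θ =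
        F2 (slicePoint Rp (u, θ)) (slicePointTheta Rp (u, θ)) (slicePointTheta Rp (u, θ)) +
          F1 (slicePoint Rp (u, θ)) (-slicePoint Rp (u, θ)) := by
      rw [show deriv (fun t => F (slicePoint Rp (u, t))) = _ from funext ht]
      exact (hasDerivAt_comp_apply (γ := fun t => slicePoint Rp (u, t)) (t := θ)
        (dF1 _ (hmaps' u θ hu)) (hasDerivAt_slicePoint_snd Rp u θ)
        (hasDerivAt_slicePointTheta_snd Rp u θ)).deriv
    -- As `X_uu = X` and `X_θθ = -X`, the first-order terms cancel, leaving `F₂(X, X) + F₂(Y, Y)`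
    -- with `F₂` the second differential.
    rw [e1, e2, map_neg]
    ring

/-! ### The Kerr-Newman background in half-plane coordinates

In terms of `u = log (R / R₊)` one has `r = R P`, `a = R b`, `Σ = R² D`, `Δ = R² (1 - exp (-2 u))²`
and `e^{2γ} = sin² θ R² N / D`. -/

section Profiles

variable (M a Q Rp u θ : ℝ)

/-- `P = r / R`. -/
noncomputable def kP : ℝ := 1 + M / Rp * Real.exp (-u) + Real.exp (-u) ^ 2

/-- `∂P/∂u`. -/
noncomputable def kP1 : ℝ := -(M / Rp * Real.exp (-u)) - 2 * Real.exp (-u) ^ 2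

/-- `b = a / R`. -/
noncomputable def kB : ℝ := a / Rp * Real.exp (-u)

/-- `D = Σ / R²`. -/
noncomputable def kD : ℝ := kP M Rp u ^ 2 + kB a Rp u ^ 2 * Real.cos θ ^ 2

/-- `∂D/∂u`. -/
noncomputable def kD1 : ℝ :=
  2 * (kP M Rp u * kP1 M Rp u) - 2 * (kB a Rp u ^ 2 * Real.cos θ ^ 2)

/-- `N = ((r² + a²)² - a² Δ sin² θ) / R⁴`. -/
noncomputable def kN : ℝ := (kP M Rp u ^ 2 + kB a Rp u ^ 2) ^ 2 -
  kB a Rp u ^ 2 * (1 - Real.exp (-u) ^ 2) ^ 2 * Real.sin θ ^ 2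

/-- `∂N/∂u`. -/
noncomputable def kN1 : ℝ :=
  2 * (kP M Rp u ^ 2 + kB a Rp u ^ 2) *
      (2 * (kP M Rp u * kP1 M Rp u) - 2 * kB a Rp u ^ 2) -
    (-(2 * kB a Rp u ^ 2 * (1 - Real.exp (-u) ^ 2) ^ 2) +
      kB a Rp u ^ 2 * (4 * (1 - Real.exp (-u) ^ 2) * Real.exp (-u) ^ 2)) * Real.sin θ ^ 2

/-- The factor `J` in `ω = a M cos θ (5 - cos 2θ) + 2 a b² cos θ sin⁴ θ J`. -/
noncomputable def kJ : ℝ := M * (kD M a Rp u θ)⁻¹ +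
  Q ^ 2 / Rp * Real.exp (-u) * kP M Rp u * (kD M a Rp u θ)⁻¹ ^ 2

/-- `∂J/∂u`. -/
noncomputable def kJ1 : ℝ := -(M * (kD M a Rp u θ)⁻¹ ^ 2 * kD1 M a Rp u θ) +
  Q ^ 2 / Rp * (Real.exp (-u) * kP1 M Rp u * (kD M a Rp u θ)⁻¹ ^ 2 -
    Real.exp (-u) * kP M Rp u * (kD M a Rp u θ)⁻¹ ^ 2 -
    2 * (Real.exp (-u) * kP M Rp u * (kD M a Rp u θ)⁻¹ ^ 3 * kD1 M a Rp u θ))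

/-- `∂J/∂θ` divided by `sin θ`. -/
noncomputable def kJ2 : ℝ :=
  M * (2 * kB a Rp u ^ 2 * Real.cos θ * (kD M a Rp u θ)⁻¹ ^ 2) +
    Q ^ 2 / Rp * Real.exp (-u) * kP M Rp u *
      (4 * kB a Rp u ^ 2 * Real.cos θ * (kD M a Rp u θ)⁻¹ ^ 3)

theorem hasDerivAt_exp_neg : HasDerivAt (fun u => Real.exp (-u)) (-Real.exp (-u)) u := by
  simpa using (hasDerivAt_neg u).exp

theorem hasDerivAt_kP : HasDerivAt (fun u => kP M Rp u) (kP1 M Rp u) u := by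
  have h := hasDerivAt_exp_neg u
  refine (((h.const_mul (M / Rp)).const_add 1).add (h.fun_pow 2)).congr_deriv ?_
  unfold kP1
  norm_num
  ring

theorem hasDerivAt_kB : HasDerivAt (fun u => kB a Rp u) (-kB a Rp u) u :=
  ((hasDerivAt_exp_neg u).const_mul (a / Rp)).congr_deriv (by unfold kB; ring)

theorem hasDerivAt_kD : HasDerivAt (fun u => kD M a Rp u θ) (kD1 M a Rp u θ) u := by
  refine (((hasDerivAt_kP M Rp u).fun_pow 2).add
    (((hasDerivAt_kB a Rp u).fun_pow 2).mul_const (Real.cos θ ^ 2))).congr_deriv ?_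
  unfold kD1
  norm_num
  ring

theorem hasDerivAt_kD_theta : HasDerivAt (fun t => kD M a Rp u t)
    (-(2 * kB a Rp u ^ 2 * Real.cos θ * Real.sin θ)) θ := by
  refine ((((Real.hasDerivAt_cos θ).fun_pow 2).const_mul (kB a Rp u ^ 2)).const_add
    (kP M Rp u ^ 2)).congr_deriv ?_
  norm_num
  ring

theorem hasDerivAt_kN : HasDerivAt (fun u => kN M a Rp u θ) (kN1 M a Rp u θ) u := by
  have hb := (hasDerivAt_kB a Rp u).fun_pow 2
  refine (((((hasDerivAt_kP M Rp u).fun_pow 2).fun_add hb).fun_pow 2).sub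
    ((hb.fun_mul ((((hasDerivAt_exp_neg u).fun_pow 2).const_sub 1).fun_pow 2)).mul_const
      (Real.sin θ ^ 2))).congr_deriv ?_
  unfold kN1
  norm_num
  ring

theorem hasDerivAt_kN_theta : HasDerivAt (fun t => kN M a Rp u t)
    (-(2 * kB a Rp u ^ 2 * (1 - Real.exp (-u) ^ 2) ^ 2 * Real.cos θ * Real.sin θ)) θ := by
  refine ((((Real.hasDerivAt_sin θ).fun_pow 2).const_mul
    (kB a Rp u ^ 2 * (1 - Real.exp (-u) ^ 2) ^ 2)).const_sub
      ((kP M Rp u ^ 2 + kB a Rp u ^ 2) ^ 2)).congr_deriv ?_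
  norm_num
  ring


variable {M Rp}

theorem one_add_sq_le_kP (hM : 0 < M) (hRp : 0 < Rp) : 1 + Real.exp (-u) ^ 2 ≤ kP M Rp u := by
  have : 0 ≤ M / Rp * Real.exp (-u) := by positivity
  unfold kP
  linarith

theorem one_le_kD (hM : 0 < M) (hRp : 0 < Rp) : 1 ≤ kD M a Rp u θ := by
  have h1 := one_add_sq_le_kP u hM hRp
  have h2 : 0 ≤ kB a Rp u ^ 2 * Real.cos θ ^ 2 := by positivity
  have h3 := sq_nonneg (Real.exp (-u))
  unfold kD
  nlinarith

/-- Because `(1 - exp (-2u))² ≤ P²`, the negative term is at most `b² P²`, which is absorbed by the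
expansion of `(P² + b²)²`, leaving at least `P⁴`. This makes `N⁻¹` a bounded smooth coefficient. -/
theorem one_le_kN (hM : 0 < M) (hRp : 0 < Rp) : 1 ≤ kN M a Rp u θ := by
  have h1 := one_add_sq_le_kP u hM hRp
  have h3 := sq_nonneg (Real.exp (-u))
  set x := Real.exp (-u) ^ 2
  set y := kB a Rp u ^ 2 with hy
  have hy0 : 0 ≤ y := sq_nonneg _
  set P := kP M Rp u
  have h4 : (1 - x) ^ 2 ≤ P ^ 2 := by nlinarith
  have h5 : 1 ≤ P ^ 2 := by nlinarith
  have h6 : (1 - x) ^ 2 * Real.sin θ ^ 2 ≤ P ^ 2 * 1 :=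
    mul_le_mul h4 (Real.sin_sq_le_one θ) (sq_nonneg _) (sq_nonneg _)
  have h7 : y * (1 - x) ^ 2 * Real.sin θ ^ 2 ≤ y * P ^ 2 := by
    rw [mul_assoc]
    exact mul_le_mul_of_nonneg_left (by linarith) hy0
  unfold kN
  nlinarith [mul_nonneg hy0 (sq_nonneg P)]

theorem hasDerivAt_inv_kD (hM : 0 < M) (hRp : 0 < Rp) :
    HasDerivAt (fun u => (kD M a Rp u θ)⁻¹) (-((kD M a Rp u θ)⁻¹ ^ 2 * kD1 M a Rp u θ)) u := by
  have h0 : kD M a Rp u θ ≠ 0 := (zero_lt_one.trans_le (one_le_kD a u θ hM hRp)).ne'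
  refine ((hasDerivAt_kD M a Rp u θ).fun_inv h0).congr_deriv ?_
  field_simp

theorem hasDerivAt_inv_kD_theta (hM : 0 < M) (hRp : 0 < Rp) :
    HasDerivAt (fun t => (kD M a Rp u t)⁻¹)
      (Real.sin θ * (2 * kB a Rp u ^ 2 * Real.cos θ * (kD M a Rp u θ)⁻¹ ^ 2)) θ := by
  have h0 : kD M a Rp u θ ≠ 0 := (zero_lt_one.trans_le (one_le_kD a u θ hM hRp)).ne'
  refine ((hasDerivAt_kD_theta M a Rp u θ).fun_inv h0).congr_deriv ?_
  field_simp

theorem hasDerivAt_kJ (hM : 0 < M) (hRp : 0 < Rp) :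
    HasDerivAt (fun u => kJ M a Q Rp u θ) (kJ1 M a Q Rp u θ) u := by
  have h := hasDerivAt_inv_kD a u θ hM hRp
  refine ((h.const_mul M).add ((((hasDerivAt_exp_neg u).const_mul (Q ^ 2 / Rp)).fun_mul
    (hasDerivAt_kP M Rp u)).fun_mul (h.fun_pow 2))).congr_deriv ?_
  unfold kJ1
  norm_num
  ring

theorem hasDerivAt_kJ_theta (hM : 0 < M) (hRp : 0 < Rp) :
    HasDerivAt (fun t => kJ M a Q Rp u t) (Real.sin θ * kJ2 M a Q Rp u θ) θ := by
  have h := hasDerivAt_inv_kD_theta a u θ hM hRp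
  refine ((h.const_mul M).add ((h.fun_pow 2).const_mul
    (Q ^ 2 / Rp * Real.exp (-u) * kP M Rp u))).congr_deriv ?_
  unfold kJ2
  norm_num
  ring

variable {a Q}

theorem rBL_eq (hRp : 0 < Rp) (h4 : 4 * Rp ^ 2 = M ^ 2 - a ^ 2 - Q ^ 2) :
    rBL M a Q (Rp * Real.exp u) = Rp * Real.exp u * kP M Rp u := by
  unfold rBL kP
  rw [← h4, Real.exp_neg]
  have := Real.exp_pos u
  field_simp

theorem mul_kB (hRp : 0 < Rp) : Rp * Real.exp u * kB a Rp u = a := by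
  unfold kB
  rw [Real.exp_neg]
  have := Real.exp_pos u
  field_simp

theorem Sigma_eq (hRp : 0 < Rp) (h4 : 4 * Rp ^ 2 = M ^ 2 - a ^ 2 - Q ^ 2) :
    Sigma M a Q (Rp * Real.exp u) θ = (Rp * Real.exp u) ^ 2 * kD M a Rp u θ := by
  unfold Sigma kD
  rw [rBL_eq u hRp h4]
  linear_combination -(Rp * Real.exp u * kB a Rp u + a) * Real.cos θ ^ 2 * mul_kB (a := a) u hRp

theorem Delta_eq (hRp : 0 < Rp) (h4 : 4 * Rp ^ 2 = M ^ 2 - a ^ 2 - Q ^ 2) :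
    Delta M a Q (Rp * Real.exp u) = (Rp * Real.exp u) ^ 2 * (1 - Real.exp (-u) ^ 2) ^ 2 := by
  unfold Delta
  rw [rBL_eq u hRp h4]
  have e : Rp * Real.exp u * kP M Rp u = Rp * Real.exp u * (1 + Real.exp (-u) ^ 2) + M := by
    unfold kP
    rw [Real.exp_neg]
    have := Real.exp_pos u
    field_simp
    ring
  have e2 : Real.exp u * Real.exp (-u) = 1 := by rw [← Real.exp_add]; simp
  rw [e]
  linear_combination (4 * Rp ^ 2 * (Real.exp u * Real.exp (-u) + 1)) * e2 + h4

theorem axialNormSq_eq (hM : 0 < M) (hRp : 0 < Rp) (h4 : 4 * Rp ^ 2 = M ^ 2 - a ^ 2 - Q ^ 2) :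
    axialNormSq M a Q (Rp * Real.exp u) θ =
      Real.sin θ ^ 2 * (Rp * Real.exp u) ^ 2 * kN M a Rp u θ / kD M a Rp u θ := by
  unfold axialNormSq
  rw [Sigma_eq u θ hRp h4, Delta_eq u hRp h4, rBL_eq u hRp h4]
  have h0 : 0 < kD M a Rp u θ := zero_lt_one.trans_le (one_le_kD a u θ hM hRp)
  have hR : 0 < Rp * Real.exp u := by positivity
  have e : a ^ 2 = (Rp * Real.exp u * kB a Rp u) ^ 2 := by rw [mul_kB u hRp]
  rw [e]
  unfold kN
  set R := Rp * Real.exp u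
  field_simp

theorem bgGamma_eq (hM : 0 < M) (hRp : 0 < Rp) (h4 : 4 * Rp ^ 2 = M ^ 2 - a ^ 2 - Q ^ 2)
    (hθ : θ ∈ Ioo 0 Real.pi) : bgGamma M a Q (Rp * Real.exp u) θ =
      Real.log (Real.sin θ) + (Real.log Rp + u) + Real.log (kN M a Rp u θ) / 2 -
        Real.log (kD M a Rp u θ) / 2 := by
  have hs : 0 < Real.sin θ := Real.sin_pos_of_pos_of_lt_pi hθ.1 hθ.2
  have h0 : 0 < kD M a Rp u θ := zero_lt_one.trans_le (one_le_kD a u θ hM hRp)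
  have h1 : 0 < kN M a Rp u θ := zero_lt_one.trans_le (one_le_kN a u θ hM hRp)
  have hu := Real.exp_pos u
  unfold bgGamma
  rw [axialNormSq_eq u θ hM hRp h4, Real.log_div (by positivity) h0.ne',
    Real.log_mul (by positivity) h1.ne', Real.log_mul (by positivity) (by positivity),
    Real.log_pow, Real.log_pow, Real.log_mul hRp.ne' hu.ne', Real.log_exp]
  push_cast
  ring

theorem exp_bgGamma_eq (hM : 0 < M) (hRp : 0 < Rp) (h4 : 4 * Rp ^ 2 = M ^ 2 - a ^ 2 - Q ^ 2)
    (hθ : θ ∈ Ioo 0 Real.pi) : Real.exp (-2 * bgGamma M a Q (Rp * Real.exp u) θ) =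
      (1 / Rp ^ 2 * Real.exp (-u) ^ 2 * kD M a Rp u θ * (kN M a Rp u θ)⁻¹) / Real.sin θ ^ 2 := by
  have hs : 0 < Real.sin θ := Real.sin_pos_of_pos_of_lt_pi hθ.1 hθ.2
  have h0 : 0 < kD M a Rp u θ := zero_lt_one.trans_le (one_le_kD a u θ hM hRp)
  have h1 : 0 < kN M a Rp u θ := zero_lt_one.trans_le (one_le_kN a u θ hM hRp)
  have hu := Real.exp_pos u
  have e : -2 * bgGamma M a Q (Rp * Real.exp u) θ =
      -Real.log (axialNormSq M a Q (Rp * Real.exp u) θ) := by unfold bgGamma; ring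
  rw [e, Real.exp_neg, Real.exp_log, axialNormSq_eq u θ hM hRp h4, Real.exp_neg]
  · field_simp
  · rw [axialNormSq_eq u θ hM hRp h4]
    positivity

theorem bgLambda_eq (hM : 0 < M) (hRp : 0 < Rp) (h4 : 4 * Rp ^ 2 = M ^ 2 - a ^ 2 - Q ^ 2) :
    bgLambda M a Q (Rp * Real.exp u) θ =
      Real.sin θ ^ 2 * (2 * Q * kB a Rp u * kP M Rp u * (kD M a Rp u θ)⁻¹) := by
  have h0 : 0 < kD M a Rp u θ := zero_lt_one.trans_le (one_le_kD a u θ hM hRp)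
  unfold bgLambda
  rw [Sigma_eq u θ hRp h4, rBL_eq u hRp h4]
  have e := mul_kB (a := a) u hRp
  have hR : 0 < Rp * Real.exp u := by positivity
  set R := Rp * Real.exp u
  nth_rw 1 [← e]
  field_simp

theorem denom_eq (hRp : 0 < Rp) (h4 : 4 * Rp ^ 2 = M ^ 2 - a ^ 2 - Q ^ 2) :
    a ^ 2 + 2 * rBL M a Q (Rp * Real.exp u) ^ 2 + a ^ 2 * Real.cos (2 * θ) =
      2 * ((Rp * Real.exp u) ^ 2 * kD M a Rp u θ) := by
  rw [← Sigma_eq u θ hRp h4, Sigma, Real.cos_two_mul]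
  ring

/-- Uses `P² + b² = D + b² sin² θ`. In this form the part depending on `u` visibly carries `sin² θ`.
-/
theorem bgEta_eq (hM : 0 < M) (hRp : 0 < Rp) (h4 : 4 * Rp ^ 2 = M ^ 2 - a ^ 2 - Q ^ 2) :
    bgEta M a Q (Rp * Real.exp u) θ = -(2 * Q) * (Real.cos θ *
      (1 + kB a Rp u ^ 2 * Real.sin θ ^ 2 * (kD M a Rp u θ)⁻¹)) := by
  have h0 : 0 < kD M a Rp u θ := zero_lt_one.trans_le (one_le_kD a u θ hM hRp)
  unfold bgEta
  rw [denom_eq u θ hRp h4, rBL_eq u hRp h4]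
  have e : a ^ 2 = (Rp * Real.exp u * kB a Rp u) ^ 2 := by rw [mul_kB u hRp]
  have hR : 0 < Rp * Real.exp u := by positivity
  rw [e]
  set R := Rp * Real.exp u
  have hD : kD M a Rp u θ = kP M Rp u ^ 2 + kB a Rp u ^ 2 * Real.cos θ ^ 2 := rfl
  field_simp
  rw [Real.sin_sq, hD]
  ring

/-- The bracket in the numerator is `2 (M Σ + Q² r)`, so one factor `Σ` cancels. All dependence on
`u` now sits behind `sin⁴ θ`. -/
theorem bgOmega_eq (hM : 0 < M) (hRp : 0 < Rp) (h4 : 4 * Rp ^ 2 = M ^ 2 - a ^ 2 - Q ^ 2) :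
    bgOmega M a Q (Rp * Real.exp u) θ = a * M * (Real.cos θ * (6 - 2 * Real.cos θ ^ 2)) +
      2 * a * (kB a Rp u ^ 2 * (Real.cos θ * Real.sin θ ^ 4 * kJ M a Q Rp u θ)) := by
  have h0 : 0 < kD M a Rp u θ := zero_lt_one.trans_le (one_le_kD a u θ hM hRp)
  have hnum : a ^ 2 * M + 2 * rBL M a Q (Rp * Real.exp u) *
      (Q ^ 2 + M * rBL M a Q (Rp * Real.exp u)) + a ^ 2 * M * Real.cos (2 * θ) =
      2 * (M * ((Rp * Real.exp u) ^ 2 * kD M a Rp u θ) +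
        Q ^ 2 * (Rp * Real.exp u * kP M Rp u)) := by
    rw [← rBL_eq u hRp h4]
    linear_combination M * denom_eq (M := M) (a := a) (Q := Q) u θ hRp h4
  unfold bgOmega
  rw [hnum, denom_eq u θ hRp h4, Real.cos_two_mul]
  have e : a ^ 3 = a * (Rp * Real.exp u * kB a Rp u) ^ 2 := by rw [mul_kB u hRp]; ring
  have hx : Real.exp (-u) / Rp = 1 / (Rp * Real.exp u) := by rw [Real.exp_neg]; field_simp
  have hJ : kJ M a Q Rp u θ = M * (kD M a Rp u θ)⁻¹ +
      Q ^ 2 * (1 / (Rp * Real.exp u)) * kP M Rp u * (kD M a Rp u θ)⁻¹ ^ 2 := by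
    rw [← hx]; unfold kJ; ring
  have hR : 0 < Rp * Real.exp u := by positivity
  rw [hJ, e]
  set R := Rp * Real.exp u
  field_simp
  ring

end Profiles

/-! ### Order of vanishing of the background derivatives on the axes -/

/-- The chain rule `R ∂_R = ∂_u`; only agreement near `u` is needed. -/
theorem mul_dR_eq {f : ℝ → ℝ → ℝ} {φ : ℝ → ℝ} {φ' Rp u θ : ℝ} (hRp : 0 < Rp)
    (hf : ∀ᶠ v in 𝓝 u, f (Rp * Real.exp v) θ = φ v) (hφ : HasDerivAt φ φ' u) :
    Rp * Real.exp u * dR f (Rp * Real.exp u) θ = φ' := by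
  have hR : 0 < Rp * Real.exp u := by positivity
  have hlog : Real.log (Rp * Real.exp u / Rp) = u := by
    rw [mul_div_cancel_left₀ _ hRp.ne', Real.log_exp]
  have hd : HasDerivAt (fun s => Real.log (s / Rp)) (1 / (Rp * Real.exp u)) (Rp * Real.exp u) := by
    have h1 := ((hasDerivAt_id (Rp * Real.exp u)).div_const Rp).log
      (by simp only [id]; positivity)
    refine h1.congr_deriv ?_
    simp only [id]
    field_simp
  have hφ' : HasDerivAt φ φ' (Real.log (Rp * Real.exp u / Rp)) := by rwa [hlog]
  have h2 := hφ'.comp (Rp * Real.exp u) hd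
  have hev : (fun s => f s θ) =ᶠ[𝓝 (Rp * Real.exp u)] φ ∘ fun s => Real.log (s / Rp) := by
    have ht : Tendsto (fun s => Real.log (s / Rp)) (𝓝 (Rp * Real.exp u)) (𝓝 u) := by
      have := hd.continuousAt.tendsto
      rwa [hlog] at this
    filter_upwards [ht.eventually hf, Ioi_mem_nhds hR] with s hs hs0
    have hs1 : 0 < s / Rp := div_pos hs0 hRp
    rw [Real.exp_log hs1, mul_div_cancel₀ _ hRp.ne'] at hs
    exact hs
  unfold dR
  rw [hev.deriv_eq, h2.deriv]
  field_simp

theorem dTheta_eq {f : ℝ → ℝ → ℝ} {φ : ℝ → ℝ} {φ' R θ : ℝ}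
    (hf : ∀ᶠ t in 𝓝 θ, f R t = φ t) (hφ : HasDerivAt φ φ' θ) : dTheta f R θ = φ' := by
  unfold dTheta
  rw [Filter.EventuallyEq.deriv_eq hf, hφ.deriv]

/-- The powers of `sin θ` are exactly what the weights `exp (-2γ) ~ sin⁻² θ` and `exp (-4γ) ~ sin⁻⁴
θ` require. The remaining factors are polynomials in `exp (-u)`, `sin θ`, `cos θ`, `D⁻¹`, `N⁻¹`,
hence smooth and bounded for `u ≥ 0`. -/
theorem background_coefficients {M a Q Rp : ℝ} (hM : 0 < M) (hRp : 0 < Rp)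
    (h4 : 4 * Rp ^ 2 = M ^ 2 - a ^ 2 - Q ^ 2) :
    ∃ cG1 cG2 cE1 cE2 cL1 cL2 cl cT1 cT2 c2 : ℝ × ℝ → ℝ,
      (IsBoundedSmooth cG1 ∧ IsBoundedSmooth cG2 ∧ IsBoundedSmooth cE1 ∧ IsBoundedSmooth cE2 ∧
        IsBoundedSmooth cL1 ∧ IsBoundedSmooth cL2 ∧ IsBoundedSmooth cl ∧ IsBoundedSmooth cT1 ∧
        IsBoundedSmooth cT2 ∧ IsBoundedSmooth c2) ∧
      ∀ u, ∀ θ ∈ Ioo 0 Real.pi,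
        Rp * Real.exp u * dR (bgGamma M a Q) (Rp * Real.exp u) θ = cG1 (u, θ) ∧
        dTheta (bgGamma M a Q) (Rp * Real.exp u) θ =
          Real.cos θ / Real.sin θ + Real.sin θ * cG2 (u, θ) ∧
        Rp * Real.exp u * dR (bgEta M a Q) (Rp * Real.exp u) θ = Real.sin θ ^ 2 * cE1 (u, θ) ∧
        dTheta (bgEta M a Q) (Rp * Real.exp u) θ = Real.sin θ * cE2 (u, θ) ∧
        Rp * Real.exp u * dR (bgLambda M a Q) (Rp * Real.exp u) θ =
          Real.sin θ ^ 2 * cL1 (u, θ) ∧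
        dTheta (bgLambda M a Q) (Rp * Real.exp u) θ = Real.sin θ * cL2 (u, θ) ∧
        bgLambda M a Q (Rp * Real.exp u) θ = Real.sin θ ^ 2 * cl (u, θ) ∧
        Rp * Real.exp u * (dR (bgOmega M a Q) (Rp * Real.exp u) θ +
          bgLambda M a Q (Rp * Real.exp u) θ * dR (bgEta M a Q) (Rp * Real.exp u) θ) =
            Real.sin θ ^ 4 * cT1 (u, θ) ∧
        dTheta (bgOmega M a Q) (Rp * Real.exp u) θ +
          bgLambda M a Q (Rp * Real.exp u) θ * dTheta (bgEta M a Q) (Rp * Real.exp u) θ =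
            Real.sin θ ^ 3 * cT2 (u, θ) ∧
        Real.exp (-2 * bgGamma M a Q (Rp * Real.exp u) θ) = c2 (u, θ) / Real.sin θ ^ 2 := by
  have hs := IsBoundedSmooth.sin
  have hc := IsBoundedSmooth.cos
  have hx := IsBoundedSmooth.exp_neg
  have hb : IsBoundedSmooth fun p => kB a Rp p.1 := (IsBoundedSmooth.const _).mul hx
  have hP : IsBoundedSmooth fun p => kP M Rp p.1 :=
    ((IsBoundedSmooth.const 1).add ((IsBoundedSmooth.const _).mul hx)).add (hx.pow 2)
  have hP1 : IsBoundedSmooth fun p => kP1 M Rp p.1 :=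
    (((IsBoundedSmooth.const _).mul hx).neg).sub ((IsBoundedSmooth.const 2).mul (hx.pow 2))
  have hD : IsBoundedSmooth fun p => kD M a Rp p.1 p.2 :=
    (hP.pow 2).add ((hb.pow 2).mul (hc.pow 2))
  have hD1 : IsBoundedSmooth fun p => kD1 M a Rp p.1 p.2 :=
    ((IsBoundedSmooth.const 2).mul (hP.mul hP1)).sub
      ((IsBoundedSmooth.const 2).mul ((hb.pow 2).mul (hc.pow 2)))
  have hV : IsBoundedSmooth fun p => (kD M a Rp p.1 p.2)⁻¹ :=
    IsBoundedSmooth.inv hD.contDiffOn fun p _ => one_le_kD a p.1 p.2 hM hRp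
  have hy : IsBoundedSmooth fun p => 1 - Real.exp (-p.1) ^ 2 :=
    (IsBoundedSmooth.const 1).sub (hx.pow 2)
  have hN : IsBoundedSmooth fun p => kN M a Rp p.1 p.2 :=
    (((hP.pow 2).add (hb.pow 2)).pow 2).sub (((hb.pow 2).mul (hy.pow 2)).mul (hs.pow 2))
  have hZ : IsBoundedSmooth fun p => (kN M a Rp p.1 p.2)⁻¹ :=
    IsBoundedSmooth.inv hN.contDiffOn fun p _ => one_le_kN a p.1 p.2 hM hRp
  have hN1 : IsBoundedSmooth fun p => kN1 M a Rp p.1 p.2 := by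
    unfold kN1
    repeat' first
      | exact hs | exact hc | exact hx | exact hb | exact hP | exact hP1
      | exact IsBoundedSmooth.const _
      | apply IsBoundedSmooth.add | apply IsBoundedSmooth.sub | apply IsBoundedSmooth.mul
      | apply IsBoundedSmooth.neg
  have hJ : IsBoundedSmooth fun p => kJ M a Q Rp p.1 p.2 := by
    unfold kJ
    repeat' first
      | exact hV | exact hx | exact hP
      | exact IsBoundedSmooth.const _
      | apply IsBoundedSmooth.add | apply IsBoundedSmooth.mul
  have hJ1 : IsBoundedSmooth fun p => kJ1 M a Q Rp p.1 p.2 := by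
    unfold kJ1
    repeat' first
      | exact hV | exact hx | exact hP | exact hP1 | exact hD1
      | exact IsBoundedSmooth.const _
      | apply IsBoundedSmooth.add | apply IsBoundedSmooth.sub | apply IsBoundedSmooth.mul
      | apply IsBoundedSmooth.neg
  have hJ2 : IsBoundedSmooth fun p => kJ2 M a Q Rp p.1 p.2 := by
    unfold kJ2
    repeat' first
      | exact hc | exact hV | exact hx | exact hP | exact hb
      | exact IsBoundedSmooth.const _
      | apply IsBoundedSmooth.add | apply IsBoundedSmooth.mul
  set cE1 : ℝ × ℝ → ℝ := fun p => -(2 * Q) * (Real.cos p.2 *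
    (-(2 * (kB a Rp p.1 ^ 2 * (kD M a Rp p.1 p.2)⁻¹)) -
      kB a Rp p.1 ^ 2 * ((kD M a Rp p.1 p.2)⁻¹ ^ 2 * kD1 M a Rp p.1 p.2))) with hcE1
  set cE2 : ℝ × ℝ → ℝ := fun p => 2 * Q *
    (1 + kB a Rp p.1 ^ 2 * Real.sin p.2 ^ 2 * (kD M a Rp p.1 p.2)⁻¹) -
    2 * Q * (Real.cos p.2 * (2 * kB a Rp p.1 ^ 2 * Real.cos p.2 * (kD M a Rp p.1 p.2)⁻¹ +
      2 * kB a Rp p.1 ^ 4 * Real.sin p.2 ^ 2 * Real.cos p.2 * (kD M a Rp p.1 p.2)⁻¹ ^ 2))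
    with hcE2
  set cl : ℝ × ℝ → ℝ := fun p =>
    2 * Q * kB a Rp p.1 * kP M Rp p.1 * (kD M a Rp p.1 p.2)⁻¹ with hcl
  have bE1 : IsBoundedSmooth cE1 := by
    repeat' first
      | exact hc | exact hV | exact hb | exact hD1
      | exact IsBoundedSmooth.const _
      | apply IsBoundedSmooth.sub | apply IsBoundedSmooth.mul
      | apply IsBoundedSmooth.neg
  have bE2 : IsBoundedSmooth cE2 := by
    repeat' first
      | exact hs | exact hc | exact hV | exact hb
      | exact IsBoundedSmooth.const _
      | apply IsBoundedSmooth.add | apply IsBoundedSmooth.sub | apply IsBoundedSmooth.mul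
      | apply IsBoundedSmooth.neg
  have bl : IsBoundedSmooth cl := by
    repeat' first
      | exact hV | exact hb | exact hP
      | exact IsBoundedSmooth.const _
      | apply IsBoundedSmooth.mul
  refine ⟨fun p => 1 + kN1 M a Rp p.1 p.2 * (kN M a Rp p.1 p.2)⁻¹ * 2⁻¹ -
      kD1 M a Rp p.1 p.2 * (kD M a Rp p.1 p.2)⁻¹ * 2⁻¹,
    fun p => kB a Rp p.1 ^ 2 * Real.cos p.2 * (kD M a Rp p.1 p.2)⁻¹ -
      kB a Rp p.1 ^ 2 * (1 - Real.exp (-p.1) ^ 2) ^ 2 * Real.cos p.2 * (kN M a Rp p.1 p.2)⁻¹,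
    cE1, cE2,
    fun p => 2 * Q * (kB a Rp p.1 * kP1 M Rp p.1 * (kD M a Rp p.1 p.2)⁻¹ -
      kB a Rp p.1 * kP M Rp p.1 * (kD M a Rp p.1 p.2)⁻¹ -
      kB a Rp p.1 * kP M Rp p.1 * ((kD M a Rp p.1 p.2)⁻¹ ^ 2 * kD1 M a Rp p.1 p.2)),
    fun p => 2 * Q * kB a Rp p.1 * kP M Rp p.1 * (2 * Real.cos p.2 * (kD M a Rp p.1 p.2)⁻¹ +
      Real.sin p.2 ^ 2 * (2 * kB a Rp p.1 ^ 2 * Real.cos p.2 * (kD M a Rp p.1 p.2)⁻¹ ^ 2)),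
    cl,
    fun p => 2 * a * (Real.cos p.2 * (kB a Rp p.1 ^ 2 * kJ1 M a Q Rp p.1 p.2 -
      2 * kB a Rp p.1 ^ 2 * kJ M a Q Rp p.1 p.2)) + cl p * cE1 p,
    fun p => -(6 * a * M) + 2 * a * (kB a Rp p.1 ^ 2 *
      (4 * Real.cos p.2 ^ 2 * kJ M a Q Rp p.1 p.2 - Real.sin p.2 ^ 2 * kJ M a Q Rp p.1 p.2 +
        Real.cos p.2 * Real.sin p.2 ^ 2 * kJ2 M a Q Rp p.1 p.2)) + cl p * cE2 p,
    fun p => 1 / Rp ^ 2 * Real.exp (-p.1) ^ 2 * kD M a Rp p.1 p.2 * (kN M a Rp p.1 p.2)⁻¹,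
    ⟨?_, ?_, bE1, bE2, ?_, ?_, bl, ?_, ?_, ?_⟩, fun u θ hθ => ?_⟩
  -- The remaining boundedness goals concern `cG1`, `cG2`, `cL1`, `cL2`, `cT1`, `cT2` and `c2`.
  iterate 7
    repeat' first
      | exact hs | exact hc | exact hV | exact hZ | exact hb | exact hP | exact hP1 | exact hD
      | exact hD1 | exact hN1 | exact hx | exact hJ | exact hJ1 | exact hJ2
      | exact bl | exact bE1 | exact bE2
      | exact IsBoundedSmooth.const _
      | apply IsBoundedSmooth.add | apply IsBoundedSmooth.sub | apply IsBoundedSmooth.mul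
      | apply IsBoundedSmooth.neg | apply IsBoundedSmooth.pow
  have hsin : 0 < Real.sin θ := Real.sin_pos_of_pos_of_lt_pi hθ.1 hθ.2
  have h0 : kD M a Rp u θ ≠ 0 := (zero_lt_one.trans_le (one_le_kD a u θ hM hRp)).ne'
  have h1 : kN M a Rp u θ ≠ 0 := (zero_lt_one.trans_le (one_le_kN a u θ hM hRp)).ne'
  have dV := hasDerivAt_inv_kD a u θ hM hRp
  have dV' := hasDerivAt_inv_kD_theta a u θ hM hRp
  have db := hasDerivAt_kB a Rp u
  have dP := hasDerivAt_kP M Rp u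
  have dJ := hasDerivAt_kJ a Q u θ hM hRp
  have dJ' := hasDerivAt_kJ_theta a Q u θ hM hRp
  have ds := Real.hasDerivAt_sin θ
  have dc := Real.hasDerivAt_cos θ
  have eE1 : Rp * Real.exp u * dR (bgEta M a Q) (Rp * Real.exp u) θ =
      Real.sin θ ^ 2 * cE1 (u, θ) := by
    refine (mul_dR_eq hRp (Eventually.of_forall fun v => bgEta_eq v θ hM hRp h4)
      ((((((db.fun_pow 2).mul_const (Real.sin θ ^ 2)).fun_mul dV).const_add 1).const_mul
        (Real.cos θ)).const_mul (-(2 * Q)))).trans ?_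
    simp only [hcE1]
    norm_num
    ring
  have eE2 : dTheta (bgEta M a Q) (Rp * Real.exp u) θ = Real.sin θ * cE2 (u, θ) := by
    refine (dTheta_eq (Eventually.of_forall fun t => bgEta_eq u t hM hRp h4)
      ((dc.fun_mul ((((ds.fun_pow 2).const_mul (kB a Rp u ^ 2)).fun_mul dV').const_add
        1)).const_mul (-(2 * Q)))).trans ?_
    simp only [hcE2]
    norm_num
    ring
  have el := bgLambda_eq (a := a) (Q := Q) u θ hM hRp h4
  refine ⟨?_, ?_, eE1, eE2, ?_, ?_, el, ?_, ?_, exp_bgGamma_eq u θ hM hRp h4 hθ⟩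
  · refine (mul_dR_eq hRp (Eventually.of_forall fun v => bgGamma_eq v θ hM hRp h4 hθ)
      (((((hasDerivAt_id u).const_add (Real.log Rp)).const_add (Real.log (Real.sin θ))).fun_add
        (((hasDerivAt_kN M a Rp u θ).log h1).div_const 2)).fun_sub
          (((hasDerivAt_kD M a Rp u θ).log h0).div_const 2))).trans ?_
    ring
  · refine (dTheta_eq (Filter.eventually_of_mem (Ioo_mem_nhds hθ.1 hθ.2) fun t ht =>
      bgGamma_eq u t hM hRp h4 ht)
      ((((ds.log hsin.ne').add_const (Real.log Rp + u)).fun_add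
        (((hasDerivAt_kN_theta M a Rp u θ).log h1).div_const 2)).fun_sub
          (((hasDerivAt_kD_theta M a Rp u θ).log h0).div_const 2))).trans ?_
    ring
  · refine (mul_dR_eq hRp (Eventually.of_forall fun v => bgLambda_eq v θ hM hRp h4)
      ((((db.const_mul (2 * Q)).fun_mul dP).fun_mul dV).const_mul (Real.sin θ ^ 2))).trans ?_
    ring
  · refine (dTheta_eq (Eventually.of_forall fun t => bgLambda_eq u t hM hRp h4)
      ((ds.fun_pow 2).fun_mul (dV'.const_mul (2 * Q * kB a Rp u * kP M Rp u)))).trans ?_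
    norm_num
    ring
  · have e := mul_dR_eq hRp (Eventually.of_forall fun v => bgOmega_eq v θ hM hRp h4)
      ((((db.fun_pow 2).fun_mul (dJ.const_mul (Real.cos θ * Real.sin θ ^ 4))).const_mul
        (2 * a)).const_add (a * M * (Real.cos θ * (6 - 2 * Real.cos θ ^ 2))))
    have e' : Rp * Real.exp u * (bgLambda M a Q (Rp * Real.exp u) θ *
        dR (bgEta M a Q) (Rp * Real.exp u) θ) = bgLambda M a Q (Rp * Real.exp u) θ *
          (Real.sin θ ^ 2 * cE1 (u, θ)) := by
      rw [← eE1]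
      ring
    rw [mul_add, e, e', el]
    simp only [hcl]
    norm_num
    ring
  · have e := dTheta_eq (Eventually.of_forall fun t => bgOmega_eq u t hM hRp h4)
      (((dc.fun_mul (((dc.fun_pow 2).const_mul 2).const_sub 6)).const_mul (a * M)).fun_add
        ((((dc.fun_mul (ds.fun_pow 4)).fun_mul dJ').const_mul (kB a Rp u ^ 2)).const_mul (2 * a)))
    rw [e, eE2, el]
    simp only [hcl]
    norm_num
    have := Real.sin_sq_add_cos_sq θ
    -- The leading part of `ω` has `∂_θ [cos θ (6 - 2 cos² θ)] = -6 sin³ θ`, which is where the full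
    -- `sin³ θ` comes from.
    linear_combination (6 * a * M * Real.sin θ) * this

/-! ### The source of the Poisson equation -/

/-- After multiplication by `R` all negative powers of `sin θ` cancel: for instance `cot θ` in
`γ_{,θ}` meets `sin θ` in `γ'_{,θ}`, and `sin⁻⁴ θ` meets `sin³ θ` from the twist and one more `sin
θ` from its variation. Each term is a bounded coefficient times a decaying perturbation. -/
theorem exists_strip_source {M a Q Rp : ℝ} (hM : 0 < M) (hRp : 0 < Rp)
    (h4 : 4 * Rp ^ 2 = M ^ 2 - a ^ 2 - Q ^ 2) {g w e l : ℝ → ℝ → ℝ} (hg : IsRegularScalar Rp g)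
    (hw : IsRegularScalar Rp w) (he : IsRegularScalar Rp e) (hl : IsRegularScalar Rp l) :
    ∃ S : ℝ × ℝ → ℝ, IsDecaying S ∧ ∀ (n : ℝ → ℝ → ℝ) (u : ℝ), 0 < u → ∀ θ ∈ Ioo 0 Real.pi,
      Rp * Real.exp u * linHamiltonian M a Q g w e l n (Rp * Real.exp u) θ =
        S (u, θ) + 2 * (Rp * Real.exp u * hLaplace n (Rp * Real.exp u) θ) := by
  have hdata : ∀ f : ℝ → ℝ → ℝ, IsRegularScalar Rp f → ∃ f0 fu fk : ℝ × ℝ → ℝ,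
      IsDecaying f0 ∧ IsDecaying fu ∧ IsDecaying fk ∧ ∀ u θ, 0 < u → θ ∈ Ioo 0 Real.pi →
        f (Rp * Real.exp u) θ = f0 (u, θ) ∧
        dR f (Rp * Real.exp u) θ = fu (u, θ) / (Rp * Real.exp u) ∧
        dTheta f (Rp * Real.exp u) θ = Real.sin θ * fk (u, θ) := by
    intro f hf
    obtain ⟨f0, fu, fk, fL, h0, hu, hk, -, hf0, hfu, hfk, -⟩ := exists_strip_representation hRp hf
    refine ⟨f0, fu, fk, h0, hu, hk, fun u θ hu0 hθ => ⟨hf0 u θ hu0.le (Ioo_subset_Icc_self hθ),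
      ?_, ?_⟩⟩
    · rw [eq_div_iff (by positivity), mul_comm]
      exact mul_dR_eq hRp (by
        filter_upwards [Ioi_mem_nhds hu0] with v hv using
          hf0 v θ (le_of_lt hv) (Ioo_subset_Icc_self hθ))
        ((hfu u θ hu0.le).hasDerivAt (Ici_mem_nhds hu0))
    · exact dTheta_eq (by
        filter_upwards [Ioo_mem_nhds hθ.1 hθ.2] with t ht using
          hf0 u t hu0.le (Ioo_subset_Icc_self ht)) (hfk u θ hu0 hθ)
  obtain ⟨g0, gu, gk, bg0, bgu, bgk, eg⟩ := hdata g hg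
  obtain ⟨w0, wu, wk, bw0, bwu, bwk, ew⟩ := hdata w hw
  obtain ⟨e0, eu, ek, be0, beu, bek, ee⟩ := hdata e he
  obtain ⟨l0, lu, lk, bl0, blu, blk, el⟩ := hdata l hl
  obtain ⟨cG1, cG2, cE1, cE2, cL1, cL2, cl, cT1, cT2, c2, ⟨bG1, bG2, bE1, bE2, bL1, bL2, bl, bT1,
    bT2, b2⟩, hc⟩ := background_coefficients hM hRp h4
  have hs := IsBoundedSmooth.sin
  have hs2 := hs.pow 2
  have hcos := IsBoundedSmooth.cos
  have kE : IsBoundedSmooth fun p => Real.sin p.2 ^ 2 * cE1 p ^ 2 + cE2 p ^ 2 +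
      (Real.sin p.2 ^ 2 * cL1 p ^ 2 + cL2 p ^ 2) :=
    ((hs2.mul (bE1.pow 2)).add (bE2.pow 2)).add ((hs2.mul (bL1.pow 2)).add (bL2.pow 2))
  have kT : IsBoundedSmooth fun p => 2 * c2 p ^ 2 *
      (Real.sin p.2 ^ 4 * cT1 p ^ 2 + Real.sin p.2 ^ 2 * cT2 p ^ 2) :=
    ((IsBoundedSmooth.const 2).mul (b2.pow 2)).mul
      (((hs.pow 4).mul (bT1.pow 2)).add (hs2.mul (bT2.pow 2)))
  refine ⟨fun p => 4 * (cG1 p * gu p + (Real.cos p.2 + Real.sin p.2 ^ 2 * cG2 p) * gk p) -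
      c2 p * ((Real.sin p.2 ^ 2 * cE1 p ^ 2 + cE2 p ^ 2 +
        (Real.sin p.2 ^ 2 * cL1 p ^ 2 + cL2 p ^ 2)) * g0 p) +
      c2 p * (cE1 p * eu p + cE2 p * ek p + (cL1 p * lu p + cL2 p * lk p)) -
      2 * c2 p ^ 2 * (Real.sin p.2 ^ 4 * cT1 p ^ 2 + Real.sin p.2 ^ 2 * cT2 p ^ 2) * g0 p +
      c2 p ^ 2 * (cT1 p * (wu p + Real.sin p.2 ^ 2 * cl p * eu p +
          Real.sin p.2 ^ 2 * cE1 p * l0 p) +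
        cT2 p * (wk p + Real.sin p.2 ^ 2 * cl p * ek p + cE2 p * l0 p)), ?_, ?_⟩
  · have h1 := (IsBoundedSmooth.const 4).mul_decaying
      ((bG1.mul_decaying bgu).add ((hcos.add (hs2.mul bG2)).mul_decaying bgk))
    have h2 := b2.mul_decaying (kE.mul_decaying bg0)
    have h3 := b2.mul_decaying (((bE1.mul_decaying beu).add (bE2.mul_decaying bek)).add
      ((bL1.mul_decaying blu).add (bL2.mul_decaying blk)))
    have h4 := kT.mul_decaying bg0
    have h5 := (b2.pow 2).mul_decaying ((bT1.mul_decaying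
      ((bwu.add ((hs2.mul bl).mul_decaying beu)).add ((hs2.mul bE1).mul_decaying bl0))).add
        (bT2.mul_decaying ((bwk.add ((hs2.mul bl).mul_decaying bek)).add (bE2.mul_decaying bl0))))
    exact (((h1.sub h2).add h3).sub h4).add h5
  · intro n u hu θ hθ
    obtain ⟨rG1, rG2, rE1, rE2, rL1, rL2, rl, rT1, rT2, r2⟩ := hc u θ hθ
    obtain ⟨eg1, eg2, eg3⟩ := eg u θ hu hθ
    obtain ⟨-, ew2, ew3⟩ := ew u θ hu hθ
    obtain ⟨-, ee2, ee3⟩ := ee u θ hu hθ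
    obtain ⟨el1, el2, el3⟩ := el u θ hu hθ
    have hsin : Real.sin θ ≠ 0 := (Real.sin_pos_of_pos_of_lt_pi hθ.1 hθ.2).ne'
    have r4 : Real.exp (-4 * bgGamma M a Q (Rp * Real.exp u) θ) =
        (c2 (u, θ) / Real.sin θ ^ 2) ^ 2 := by
      rw [← r2, ← Real.exp_nat_mul]
      congr 1
      push_cast
      ring
    simp only [linHamiltonian, grad, hPair, Prod.fst_add, Prod.snd_add, Prod.smul_fst,
      Prod.smul_snd, smul_eq_mul]
    have hR : Rp * Real.exp u ≠ 0 := by positivity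
    generalize Rp * Real.exp u = R at *
    rw [mul_comm R, ← eq_div_iff hR] at rG1 rE1 rL1 rT1
    rw [rT1, rT2, rG1, rG2, rE1, rE2, rL1, rL2, rl, r2, r4, eg1, eg2, eg3, ew2, ew3, ee2, ee3, el1,
      el2, el3]
    field_simp

/-! ### The mixed boundary value problem in the half-strip -/

theorem mul_hLaplace_comp_log {N : ℝ × ℝ → ℝ} {Rp u θ : ℝ} (hRp : 0 < Rp)
    (hN : ContDiffOn ℝ 2 N (Ioi 0 ×ˢ Ioo 0 Real.pi)) (hu : 0 < u) (hθ : θ ∈ Ioo 0 Real.pi) :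
    Rp * Real.exp u * hLaplace (fun R θ => N (Real.log (R / Rp), θ)) (Rp * Real.exp u) θ =
      deriv (deriv fun u => N (u, θ)) u + deriv (deriv fun t => N (u, t)) θ := by
  have hR : Rp * Real.exp u ≠ 0 := by positivity
  have hlog : ∀ v t, N (Real.log (Rp * Real.exp v / Rp), t) = N (v, t) := fun v t => by
    rw [mul_div_cancel_left₀ _ hRp.ne', Real.log_exp]
  have d1 := fun v (hv : v ∈ Ioi (0 : ℝ)) =>
    hasDerivAt_of_contDiffOn_two isOpen_Ioi (ContDiffOn.slice_left hN hθ) hv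
  have d2 := fun t (ht : t ∈ Ioo 0 Real.pi) =>
    hasDerivAt_of_contDiffOn_two isOpen_Ioo (ContDiffOn.slice_right hN hu) ht
  unfold hLaplace
  rw [mul_add]
  congr 1
  · refine mul_dR_eq hRp ?_ (d1 u hu).2
    filter_upwards [Ioi_mem_nhds hu] with v hv
    exact mul_dR_eq hRp (Eventually.of_forall fun s => hlog s θ) (d1 v hv).1
  · rw [dTheta_eq (φ := fun t => 1 / (Rp * Real.exp u) * deriv (fun t => N (u, t)) t) ?_
      ((d2 θ hθ).2.const_mul _)]
    · field_simp
    · filter_upwards [Ioo_mem_nhds hθ.1 hθ.2] with t ht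
      rw [dTheta_eq (Eventually.of_forall fun s => hlog u s) (d2 t ht).1]

theorem deriv_deriv_const_mul_add {f g : ℝ → ℝ} {s : Set ℝ} (hs : IsOpen s)
    (hf : ContDiffOn ℝ 2 f s) (hg : ContDiffOn ℝ 2 g s) (c : ℝ) {x : ℝ} (hx : x ∈ s) :
    deriv (deriv fun y => c * f y + g y) x = c * deriv (deriv f) x + deriv (deriv g) x := by
  have e : deriv (fun y => c * f y + g y) =ᶠ[𝓝 x] fun y => c * deriv f y + deriv g y := by
    filter_upwards [hs.mem_nhds hx] with y hy
    exact (((hasDerivAt_of_contDiffOn_two hs hf hy).1.const_mul c).fun_add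
      (hasDerivAt_of_contDiffOn_two hs hg hy).1).deriv
  rw [e.deriv_eq]
  exact (((hasDerivAt_of_contDiffOn_two hs hf hx).2.const_mul c).fun_add
    (hasDerivAt_of_contDiffOn_two hs hg hx).2).deriv

/-- A decaying profile with value `0` and slope `1` at `u = 0`. -/
noncomputable def slopeProfile (u : ℝ) : ℝ := Real.exp (-u) - Real.exp (-u) ^ 2

theorem hasDerivAt_slopeProfile (u : ℝ) :
    HasDerivAt slopeProfile (2 * Real.exp (-u) ^ 2 - Real.exp (-u)) u := by
  refine ((hasDerivAt_exp_neg u).sub ((hasDerivAt_exp_neg u).fun_pow 2)).congr_deriv ?_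
  norm_num
  ring

theorem deriv_deriv_slopeProfile (u : ℝ) :
    deriv (deriv slopeProfile) u = Real.exp (-u) - 4 * Real.exp (-u) ^ 2 := by
  rw [show deriv slopeProfile = _ from funext fun u => (hasDerivAt_slopeProfile u).deriv]
  refine ((((hasDerivAt_exp_neg u).fun_pow 2).const_mul 2).sub
    (hasDerivAt_exp_neg u)).deriv.trans ?_
  norm_num
  ring

theorem contDiff_slopeProfile : ContDiff ℝ ∞ slopeProfile := by
  unfold slopeProfile
  fun_prop

/-- Subtracting `2 g0 - 2 χ(u) gu(0, θ)`, with `χ = slopeProfile`, reduces to the homogeneous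
problem. The corner condition `hp` is what keeps the second term from disturbing the Dirichlet
values. -/
theorem exists_mixed_strip_solution {g0 gu gL S : ℝ × ℝ → ℝ} (hg0 : IsDecaying g0)
    (hgu : IsDecaying gu) (hgL : IsDecaying gL) (hS : IsDecaying S)
    (hd : ∀ u θ, 0 ≤ u → HasDerivWithinAt (fun u => g0 (u, θ)) (gu (u, θ)) (Ici 0) u)
    (hL : ∀ u θ, 0 < u → deriv (deriv fun u => g0 (u, θ)) u +
      deriv (deriv fun t => g0 (u, t)) θ = gL (u, θ))
    (hp : gu (0, 0) = 0 ∧ gu (0, Real.pi) = 0) :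
    ∃ N : ℝ × ℝ → ℝ, ContDiffOn ℝ 1 N halfPlane ∧
      ContDiffOn ℝ 2 N (Ioi 0 ×ˢ Ioo 0 Real.pi) ∧
      (∀ u, N (u, 0) = 2 * g0 (u, 0) ∧ N (u, Real.pi) = 2 * g0 (u, Real.pi)) ∧
      (∀ θ, HasDerivWithinAt (fun u => N (u, θ)) 0 (Ici 0) 0) ∧
      (∃ K, ∀ u θ, 0 ≤ u → |N (u, θ)| ≤ K * Real.exp (-u / 2)) ∧
      ∀ u θ, 0 < u → θ ∈ Ioo 0 Real.pi →
        S (u, θ) + 2 * (deriv (deriv fun u => N (u, θ)) u +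
          deriv (deriv fun t => N (u, t)) θ) = 0 := by
  have hcomp : ∀ f : ℝ × ℝ → ℝ, ContDiffOn ℝ ∞ f halfPlane →
      ContDiff ℝ ∞ fun t => f (0, t) := fun f hf =>
    contDiffOn_univ.1 (ContDiffOn.slice_right hf (le_refl (0 : ℝ)))
  obtain ⟨G1, hG1, hGd1⟩ := exists_theta_deriv hgu.contDiffOn
  obtain ⟨G2, hG2, hGd2⟩ := exists_theta_deriv hG1
  have cG := hcomp gu hgu.contDiffOn
  have cG2 := hcomp G2 hG2
  obtain ⟨K2, hK2, bG2⟩ := exists_abs_le_of_contDiffOn hG2 0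
  obtain ⟨K0, hK0, bgu⟩ := hgu.isBoundedSmooth.bound
  obtain ⟨C0, hC0, bg0⟩ := hg0.bound
  obtain ⟨CL, hCL, bgL⟩ := hgL.bound
  obtain ⟨CS, hCS, bS⟩ := hS.bound
  have hx : ∀ u : ℝ, 0 ≤ u → Real.exp (-u) ≤ 1 := fun u hu => Real.exp_le_one_iff.2 (by linarith)
  have hx0 : ∀ u : ℝ, 0 < Real.exp (-u) := fun u => Real.exp_pos _
  have bχ : ∀ u, 0 ≤ u → |slopeProfile u| ≤ Real.exp (-u) := fun u hu => by
    unfold slopeProfile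
    have := hx u hu
    have := hx0 u
    rw [abs_le]
    constructor <;> nlinarith
  have bχ2 : ∀ u, 0 ≤ u → |Real.exp (-u) - 4 * Real.exp (-u) ^ 2| ≤ 3 * Real.exp (-u) :=
      fun u hu => by
    have := hx u hu
    have := hx0 u
    rw [abs_le]
    constructor <;> nlinarith
  -- This is `-S/2` minus the Laplacian of the subtracted function; `G2` is the second
  -- `θ`-derivative of `gu`.
  set H : ℝ × ℝ → ℝ := fun p => -(S p / 2) - 2 * gL p +
    2 * ((Real.exp (-p.1) - 4 * Real.exp (-p.1) ^ 2) * gu (0, p.2) +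
      slopeProfile p.1 * G2 (0, p.2)) with hH
  have cχ := contDiff_slopeProfile
  have sH : ContDiffOn ℝ ∞ H halfPlane := by
    refine ((hS.contDiffOn.div_const 2).neg.sub (contDiffOn_const.mul hgL.contDiffOn)).add
      (ContDiff.contDiffOn ?_)
    have h1 : ContDiff ℝ ∞ fun p : ℝ × ℝ => gu (0, p.2) := cG.comp contDiff_snd
    have h2 : ContDiff ℝ ∞ fun p : ℝ × ℝ => G2 (0, p.2) := cG2.comp contDiff_snd
    have h3 : ContDiff ℝ ∞ fun p : ℝ × ℝ => slopeProfile p.1 := cχ.comp contDiff_fst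
    exact contDiff_const.mul ((ContDiff.mul (by fun_prop) h1).add (h3.mul h2))
  have bH : ∀ u t, 0 ≤ u → t ∈ Icc 0 Real.pi →
      |H (u, t)| ≤ (CS / 2 + 2 * CL + 2 * (3 * K0 + K2)) * Real.exp (-u) := by
    intro u t hu ht
    have h1 := bS u t hu
    have h2 := bgL u t hu
    have h3 : |(Real.exp (-u) - 4 * Real.exp (-u) ^ 2) * gu (0, t)| ≤
        3 * Real.exp (-u) * K0 := by
      rw [abs_mul]
      exact mul_le_mul (bχ2 u hu) (bgu 0 t le_rfl) (abs_nonneg _) (by positivity)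
    have h4 : |slopeProfile u * G2 (0, t)| ≤ Real.exp (-u) * K2 := by
      rw [abs_mul]
      exact mul_le_mul (bχ u hu) (bG2 0 ⟨le_rfl, le_rfl⟩ t ht) (abs_nonneg _) (by positivity)
    simp only [hH]
    rw [abs_le] at *
    constructor <;> linarith
  obtain ⟨v, cv1, cv2, v0, vd, ⟨K, hK⟩, hv⟩ := exists_strip_solution sH bH
  set N : ℝ × ℝ → ℝ := fun p => 2 * g0 p + (-2 * (slopeProfile p.1 * gu (0, p.2)) + v p) with hN
  have cP : ContDiff ℝ ∞ fun p : ℝ × ℝ => slopeProfile p.1 * gu (0, p.2) :=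
    (cχ.comp contDiff_fst).mul (cG.comp contDiff_snd)
  have hsub : Ioi (0 : ℝ) ×ˢ Ioo 0 Real.pi ⊆ halfPlane :=
    prod_mono Ioi_subset_Ici_self (subset_univ _)
  have c2 : ∀ {f : ℝ × ℝ → ℝ}, ContDiffOn ℝ ∞ f halfPlane →
      ContDiffOn ℝ 2 f (Ioi 0 ×ˢ Ioo 0 Real.pi) := fun hf => contDiffOn_infty.1 (hf.mono hsub) 2
  have cP2 := c2 cP.contDiffOn
  have cg2 := c2 hg0.contDiffOn
  have cR : ContDiffOn ℝ 2 (fun p : ℝ × ℝ => -2 * (slopeProfile p.1 * gu (0, p.2)) + v p)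
      (Ioi 0 ×ˢ Ioo 0 Real.pi) := (contDiffOn_const.mul cP2).add cv2
  refine ⟨N, ?_, (contDiffOn_const.mul cg2).add cR, fun u => ?_, fun θ => ?_,
    ⟨2 * C0 + 2 * K0 + K, fun u θ hu => ?_⟩, fun u θ hu hθ => ?_⟩
  · exact (contDiffOn_const.mul (hg0.contDiffOn.of_le (m := 1) (by simp))).add
      ((contDiff_const.mul (cP.of_le (m := 1) (by simp))).add cv1).contDiffOn
  · simp [hN, hp.1, hp.2, (v0 u).1, (v0 u).2]
  · have h1 := ((hd 0 θ le_rfl).const_mul 2).fun_add (((((hasDerivAt_slopeProfile 0).mul_const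
      (gu (0, θ))).const_mul (-2)).fun_add (vd θ)).hasDerivWithinAt (s := Ici 0))
    refine h1.congr_deriv ?_
    norm_num
  · have h1 := bg0 u θ hu
    have h2 : |slopeProfile u * gu (0, θ)| ≤ Real.exp (-u) * K0 := by
      rw [abs_mul]
      exact mul_le_mul (bχ u hu) (bgu 0 θ le_rfl) (abs_nonneg _) (by positivity)
    have h3 := hK u θ
    rw [abs_of_nonneg hu] at h3
    have h4 : Real.exp (-u) ≤ Real.exp (-u / 2) := Real.exp_le_exp.2 (by linarith)
    have h5 : C0 * Real.exp (-u) ≤ C0 * Real.exp (-u / 2) := mul_le_mul_of_nonneg_left h4 hC0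
    have h6 : Real.exp (-u) * K0 ≤ Real.exp (-u / 2) * K0 := mul_le_mul_of_nonneg_right h4 hK0
    simp only [hN]
    rw [abs_le] at *
    constructor <;> linarith
  · have eu : deriv (deriv fun u => N (u, θ)) u = 2 * deriv (deriv fun u => g0 (u, θ)) u +
        (-2 * (deriv (deriv slopeProfile) u * gu (0, θ)) + deriv (deriv fun u => v (u, θ)) u) := by
      simp only [hN]
      rw [deriv_deriv_const_mul_add isOpen_Ioi (ContDiffOn.slice_left cg2 hθ)
        (ContDiffOn.slice_left cR hθ) 2 hu, deriv_deriv_const_mul_add isOpen_Ioi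
        (ContDiffOn.slice_left cP2 hθ) (ContDiffOn.slice_left cv2 hθ) (-2) hu]
      simp only [deriv_mul_const_field']
    have et : deriv (deriv fun t => N (u, t)) θ = 2 * deriv (deriv fun t => g0 (u, t)) θ +
        (-2 * (slopeProfile u * G2 (0, θ)) + deriv (deriv fun t => v (u, t)) θ) := by
      simp only [hN]
      rw [deriv_deriv_const_mul_add isOpen_Ioo (ContDiffOn.slice_right cg2 hu)
        (ContDiffOn.slice_right cR hu) 2 hθ, deriv_deriv_const_mul_add isOpen_Ioo
        (ContDiffOn.slice_right cP2 hu) (ContDiffOn.slice_right cv2 hu) (-2) hθ]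
      simp only [deriv_const_mul_field']
      rw [show deriv (fun t => gu (0, t)) = fun t => G1 (0, t) from
        funext fun t => (hGd1 0 t le_rfl).deriv, (hGd2 0 θ le_rfl).deriv]
    have h1 := hv u θ hu hθ
    have h2 := hL u θ hu
    simp only [hH] at h1
    rw [eu, et, deriv_deriv_slopeProfile]
    linear_combination 4 * h2 + 2 * h1

/-! ### Existence for regular data -/

theorem four_mul_Rplus_sq {M a Q : ℝ} (hsub : a ^ 2 + Q ^ 2 < M ^ 2) :
    4 * Rplus M a Q ^ 2 = M ^ 2 - a ^ 2 - Q ^ 2 := by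
  unfold Rplus
  rw [div_pow, Real.sq_sqrt (by linarith)]
  ring

theorem exists_isMixedSolution {M a Q : ℝ} (hM : 0 < M) (hsub : a ^ 2 + Q ^ 2 < M ^ 2)
    {g w e l : ℝ → ℝ → ℝ} (hreg : IsRegularData (Rplus M a Q) g w e l) :
    ∃ n, IsMixedSolution M a Q g w e l n ∧
      ContDiffOn ℝ 1 (fun p : ℝ × ℝ => n p.1 p.2) (Ici (Rplus M a Q) ×ˢ Icc 0 Real.pi) := by
  have hRp : 0 < Rplus M a Q := by
    unfold Rplus
    have := Real.sqrt_pos.2 (sub_pos.2 hsub)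
    positivity
  have h4 := four_mul_Rplus_sq hsub
  obtain ⟨S, hS, hS'⟩ := exists_strip_source hM hRp h4 hreg.regular_gamma hreg.regular_omega
    hreg.regular_eta hreg.regular_lambda
  obtain ⟨g0, gu, gk, gL, hg0, hgu, -, hgL, eg0, dgu, -, egL⟩ :=
    exists_strip_representation hRp hreg.regular_gamma
  -- The pole condition on `γ'_{,R}` is carried to `u = 0` by the chain rule and uniqueness of
  -- one-sided derivatives.
  have hpole : ∀ θ ∈ ({0, Real.pi} : Set ℝ), θ ∈ Icc 0 Real.pi → gu (0, θ) = 0 := by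
    intro θ hθ hθ'
    have h1 := hreg.gamma_poles θ hθ
    have h2 : HasDerivWithinAt (fun u => Rplus M a Q * Real.exp u) (Rplus M a Q) (Ici 0) 0 := by
      simpa using ((Real.hasDerivAt_exp 0).const_mul (Rplus M a Q)).hasDerivWithinAt (s := Ici 0)
    have h3 : MapsTo (fun u => Rplus M a Q * Real.exp u) (Ici 0) (Ici (Rplus M a Q)) :=
      fun u hu => le_mul_of_one_le_right hRp.le (Real.one_le_exp hu)
    have h4 := HasDerivWithinAt.comp (h₂ := fun R => g R θ) (0 : ℝ) (by simpa using h1) h2 h3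
    have h5 := h4.congr_of_mem (f₁ := fun u => g0 (u, θ)) (fun u hu => (eg0 u θ hu hθ').symm)
      (le_refl (0 : ℝ))
    simpa using (uniqueDiffWithinAt_Ici (0 : ℝ)).eq_deriv _ (dgu 0 θ le_rfl) h5
  have h0 : (0 : ℝ) ∈ Icc 0 Real.pi := ⟨le_rfl, Real.pi_pos.le⟩
  have hpi : Real.pi ∈ Icc 0 Real.pi := ⟨Real.pi_pos.le, le_rfl⟩
  obtain ⟨N, cN1, cN2, ND, NN, ⟨K, hK⟩, hN⟩ := exists_mixed_strip_solution hg0 hgu hgL hS dgu egL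
    ⟨hpole 0 (by simp) h0, hpole Real.pi (by simp) hpi⟩
  have hlog : ∀ R, Rplus M a Q ≤ R → 0 ≤ Real.log (R / Rplus M a Q) := fun R hR =>
    Real.log_nonneg ((one_le_div hRp).2 hR)
  have hexp : ∀ R, 0 < R → Rplus M a Q * Real.exp (Real.log (R / Rplus M a Q)) = R :=
    fun R hR => by rw [Real.exp_log (by positivity), mul_div_cancel₀ _ hRp.ne']
  have clog : ContDiffOn ℝ ∞ (fun p : ℝ × ℝ => (Real.log (p.1 / Rplus M a Q), p.2))
      (Ici (Rplus M a Q) ×ˢ univ) :=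
    ((contDiff_fst.div_const _).contDiffOn.log fun p hp =>
      (div_pos (hRp.trans_le hp.1) hRp).ne').prodMk contDiff_snd.contDiffOn
  have c1 : ContDiffOn ℝ 1 (fun p : ℝ × ℝ => N (Real.log (p.1 / Rplus M a Q), p.2))
      (Ici (Rplus M a Q) ×ˢ Icc 0 Real.pi) :=
    cN1.comp ((clog.of_le (by simp)).mono (prod_mono_right (subset_univ _)))
      fun p hp => ⟨hlog p.1 hp.1, mem_univ _⟩
  refine ⟨fun R θ => N (Real.log (R / Rplus M a Q), θ), ⟨c1.continuousOn, ?_, ?_, ?_, ?_, ?_⟩, c1⟩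
  · exact cN2.comp ((contDiffOn_infty.1 clog 2).mono
      (prod_mono Ioi_subset_Ici_self (subset_univ _)))
      fun p hp => ⟨Real.log_pos ((one_lt_div hRp).2 hp.1), hp.2⟩
  · intro R θ hR hθ
    have hR0 : 0 < R := hRp.trans hR
    have hu : 0 < Real.log (R / Rplus M a Q) := Real.log_pos ((one_lt_div hRp).2 hR)
    have h1 := hS' (fun R θ => N (Real.log (R / Rplus M a Q), θ)) _ hu θ hθ
    rw [mul_hLaplace_comp_log hRp cN2 hu hθ, hN _ θ hu hθ, hexp R hR0] at h1
    exact (mul_eq_zero.1 h1).resolve_left hR0.ne'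
  -- The bound `exp (-u / 2)` is `(R / R₊)^(-1/2)`, uniform in `θ`.
  · have hlim : Tendsto (fun R => K * Real.exp (-Real.log (R / Rplus M a Q) / 2)) atTop (𝓝 0) := by
      have h1 : Tendsto (fun R => -Real.log (R / Rplus M a Q) / 2) atTop atBot :=
        (tendsto_neg_atTop_atBot.comp (Real.tendsto_log_atTop.comp
          (tendsto_id.atTop_div_const hRp))).atBot_div_const two_pos
      simpa using (Real.tendsto_exp_atBot.comp h1).const_mul K
    refine squeeze_zero_norm' ?_ (hlim.comp tendsto_fst)
    filter_upwards [tendsto_fst.eventually (eventually_ge_atTop (Rplus M a Q))] with p hp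
    exact hK _ p.2 (hlog p.1 hp)
  · intro R hR
    have h1 := ND (Real.log (R / Rplus M a Q))
    rwa [← eg0 _ 0 (hlog R hR) h0, ← eg0 _ Real.pi (hlog R hR) hpi,
      hexp R (hRp.trans_le hR)] at h1
  · intro θ _
    have h1 : HasDerivWithinAt (fun R => Real.log (R / Rplus M a Q)) (1 / Rplus M a Q)
        (Ici (Rplus M a Q)) (Rplus M a Q) := by
      have := ((hasDerivAt_id (Rplus M a Q)).div_const (Rplus M a Q)).log
        (by simpa using hRp.ne')
      simpa [hRp.ne'] using this.hasDerivWithinAt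
    have h2 := HasDerivWithinAt.comp (h₂ := fun u => N (u, θ)) (h₂' := 0) (s' := Ici 0)
      (Rplus M a Q) (by simpa [hRp.ne'] using NN θ) h1 fun R hR => hlog R hR
    simpa [Function.comp_def] using h2

end KerrNewman

theorem theorem3 (M a Q : ℝ) (hM : 0 < M) (hsub : a ^ 2 + Q ^ 2 < M ^ 2)
    (γ' ω' η' lam' : ℝ → ℝ → ℝ)
    (hreg : KerrNewman.IsRegularData (KerrNewman.Rplus M a Q) γ' ω' η' lam') :
    ∃ ν' : ℝ → ℝ → ℝ,
      KerrNewman.IsMixedSolution M a Q γ' ω' η' lam' ν' ∧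
      ContDiffOn ℝ 1 (fun p : ℝ × ℝ => ν' p.1 p.2)
        (Set.Ici (KerrNewman.Rplus M a Q) ×ˢ Set.Icc 0 Real.pi) ∧
      ∀ μ : ℝ → ℝ → ℝ, KerrNewman.IsMixedSolution M a Q γ' ω' η' lam' μ →
        ∀ R θ : ℝ, KerrNewman.Rplus M a Q ≤ R → θ ∈ Set.Icc 0 Real.pi → μ R θ = ν' R θ := by
  obtain ⟨n, hn, hn1⟩ := KerrNewman.exists_isMixedSolution hM hsub hreg
  exact ⟨n, hn, hn1, fun μ hμ R θ hR hθ => hn.unique hsub hμ hR hθ⟩
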